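/- For a bi-infinite sequence $a=(a_n)_{n\in\mathbb Z}$ of positive integers put $\lambda_k(a)=[a_k;a_{k+1},a_{k+2},\dots]+[0;a_{k-1},a_{k-2},\dots]$, $m(a)=\sup_{k\in\mathbb Z}\lambda_k(a)$ and $\ell(a)=\limsup_{k\to+\infty}\lambda_k(a)$. Let $M=\{m(a)<\infty\}$ and $L=\{\ell(a)<\infty\}$ be the Markov and Lagrange spectra. Words are finite strings of positive integers, $v^T$ is the reversed word, $\overline v$ is the infinite periodic repetition of $v$ (to the left or to the right), and an asterisk marks position $0$. A notation $\lambda_0(\dots w^*\dots)$ refers to the position marked in $w^*$ below. Let $w=11122322221$, marked as $w^*=111223^*22221$, and $\tau=12221\,w\,11123$, $\tau^*=12221\,w^*\,11123$. Put $$i_1=m(\overline{21}\,123232111111112321\,\tau^*\,212111111111232321\,\overline{12}),\qquad j_1=m(\overline{21}\,1232321212112221\,w\,w\,w^*\,w\,11121\,\overline{12}).$$ Let $F$ be the finite set consisting of the following words and their transposes: (1) $13$, $32323$, $32322$, $1223221$, $21223222$, $1112232223$, $21112232222$, $11w$, $w2$, $321w11$, $221w112$, $1221w11$, $221w1111$,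 $22221w11123$, $32221w11123$, $32221w11122$, $332221w11121121$, $232221w1112112$, $2211111223222222$, $1211111223222222$, $33211111223222222$, $211111223222223$, $2111112232222221$, $2111112232222222$, $21111122322222233$, $123211111223222222321$, $2123211111223222222322$; (2) $221\tau2$, $121\tau2$, $21\tau22$, $21\tau23$, $2121\tau$, $21\tau211$, $11121\tau$, $3321\tau2$, $321121\tau$, $221121\tau$, $121\tau33$, $121\tau321$, $121\tau322$, $21\tau2123$, $21\tau2122$, $212321\tau21211$, $12321\tau212112$, $21112321\tau2121111$, $1112321\tau21211112$, $2111112321\tau212111111$, $111112321\tau2121111112$, $11111112321\tau212111111112$, $211111112321\tau21211111111$, $1111111112321\tau21211111111$, $11111112321\tau2121111111111$; (3) $22221w11122$. Then $$(M\setminus L)\cap(i_1,j_1)=C\cup D\cup X,$$ where $$C=\{\lambda_0(\gamma\,21212112221\,w\,w^*\,\overline w):\ \gamma\,21212112221\,ww \text{ is a left-infinite sequence in }\{1,2,3\}\text{ containing no word of }F\}$$ is a Cantor set (nonempty, compact, perfect, totally disconnected); $$D=\{\lambda_0(\overline{w^T}w^Tw^T\,12221121212\,\theta\,21212112221\,w\,w^*\,\overline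 w)\}$$ with $\theta$ ranging over the (possibly empty) finite words in $\{1,2,3\}$ such that $[0;\theta]\ge[0;\theta^T]$ and $12221121212\,\theta\,21212112221$ contains no word of $F$, is an infinite set of isolated points of $M$; and $$X=\{\lambda_0(\overline{w^T}w^Tw^T\,x\,w\,w^*\,\overline w):\ x\in\{122211212121212112221,\ 1222112121212112221,\ 12221121212112221\}\}$$ consists of exactly three isolated points of $M$, none of which lies in $D$. -/

import Mathlib

namespace MarkovLagrange

noncomputable section

/-! ### Continued fractions and the two spectra -/

/-- The finite continued fraction `[0; a₁, …, aₙ]`, with value `0` for the empty word. -/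
def finCF : List ℕ → ℝ
  | [] => 0
  | a :: l => 1 / ((a : ℝ) + finCF l)

/-- The infinite continued fraction `[0; s 0, s 1, s 2, …]`, the limit of its convergents
(which exists whenever all `s n` are positive integers). -/
def infCF (s : ℕ → ℕ) : ℝ :=
  Filter.limUnder Filter.atTop (fun n : ℕ => finCF ((List.range n).map s))

/-- `λ_k(a) = [a_k; a_{k+1}, a_{k+2}, …] + [0; a_{k-1}, a_{k-2}, …]`. -/
def lam (a : ℤ → ℕ) (k : ℤ) : ℝ :=
  (a k : ℝ) + infCF (fun n : ℕ => a (k + 1 + n)) + infCF (fun n : ℕ => a (k - 1 - n))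

/-- The Markov value `m(a) = sup_{k ∈ ℤ} λ_k(a)`, possibly infinite. -/
def markovValue (a : ℤ → ℕ) : EReal := ⨆ k : ℤ, (lam a k : EReal)

/-- The Lagrange value `ℓ(a) = limsup_{k → ∞} λ_k(a)`, possibly infinite. -/
def lagrangeValue (a : ℤ → ℕ) : EReal :=
  Filter.limsup (fun k : ℤ => (lam a k : EReal)) Filter.atTop

/-- The Markov spectrum: the finite Markov values of bi-infinite sequences of positive integers. -/
def markovSpectrum : Set ℝ :=
  {t | ∃ a : ℤ → ℕ, (∀ k, 0 < a k) ∧ markovValue a = (t : EReal)}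

/-- The Lagrange spectrum: the finite Lagrange values of bi-infinite sequences of positive
integers. -/
def lagrangeSpectrum : Set ℝ :=
  {t | ∃ a : ℤ → ℕ, (∀ k, 0 < a k) ∧ lagrangeValue a = (t : EReal)}

/-- A Cantor set on the real line. -/
def IsCantorSet (S : Set ℝ) : Prop :=
  S.Nonempty ∧ IsCompact S ∧ Perfect S ∧ IsTotallyDisconnected S

/-- `t` is an isolated point of `S`. -/
def IsIsolatedPoint (S : Set ℝ) (t : ℝ) : Prop :=
  t ∈ S ∧ ∃ ε > 0, ∀ s ∈ S, |s - t| < ε → s = t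

/-! ### Words and sequences -/

/-- The one-sided sequence `v s`: the finite word `v` followed by the sequence `s`. -/
def pre (v : List ℕ) (s : ℕ → ℕ) : ℕ → ℕ := fun n => v.getD n (s (n - v.length))

/-- The one-sided periodic sequence `v v v …` (for a nonempty word `v`). -/
def per (v : List ℕ) : ℕ → ℕ := fun n => v.getD (n % v.length) 0

/-- The bi-infinite sequence `… l₂ l₁ l₀ r₀* r₁ r₂ …`: the left half is given by `l`, read from
right to left, and `r 0` is at position `0`. -/
def glue (l r : ℕ → ℕ) : ℤ → ℕ
  | Int.ofNat n => r n
  | Int.negSucc n => l n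

/-- The word `v` occurs in the left-infinite sequence `… s₂ s₁ s₀` (with `s` being read from right
to left). -/
def OccursLeft (v : List ℕ) (s : ℕ → ℕ) : Prop :=
  ∃ i : ℕ, ∀ j : ℕ, ∀ h : j < v.reverse.length, s (i + j) = v.reverse[j]

/-- All letters of the word are `1`, `2` or `3`. -/
def Letters123 (v : List ℕ) : Prop := ∀ d ∈ v, d = 1 ∨ d = 2 ∨ d = 3

/-! ### The words of the result -/

/-- The part `11122` of `w` to the left of the marked letter of `w* = 11122 3* 22221`. -/
def wL : List ℕ := [1, 1, 1, 2, 2]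

/-- The part `3* 22221` of `w` that starts at the marked letter. -/
def wR : List ℕ := [3, 2, 2, 2, 2, 1]

/-- `w = 11122322221`. -/
def w : List ℕ := wL ++ wR

/-- `τ = 12221 w 11123`. -/
def τ : List ℕ := [1, 2, 2, 2, 1] ++ w ++ [1, 1, 1, 2, 3]

/-- `u = 21212112221`; its transpose is `12221121212`. -/
def u : List ℕ := [2, 1, 2, 1, 2, 1, 1, 2, 2, 2, 1]

/-- The bi-infinite sequence `l v w w* w w w …`, where `l` is read from right to left and the
marked letter is at position `0`. -/
def toW (l : ℕ → ℕ) (v : List ℕ) : ℤ → ℕ :=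
  glue (pre (v ++ w ++ wL).reverse l) (pre wR (per w))

/-- The sequence `(21)^∞ 123232111111112321 τ* 212111111111232321 (12)^∞`, where
`τ* = 12221 w* 11123`. -/
def seqI : ℤ → ℕ :=
  glue (pre ([1, 2, 3, 2, 3, 2, 1, 1, 1, 1, 1, 1, 1, 1, 2, 3, 2, 1] ++ [1, 2, 2, 2,
      1] ++ wL).reverse (per [1, 2]))
    (pre (wR ++ [1, 1, 1, 2, 3] ++ [2, 1, 2, 1, 1, 1, 1, 1, 1, 1, 1, 1, 2, 3, 2, 3, 2,
      1]) (per [1, 2]))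

/-- The sequence `(21)^∞ 1232321212112221 w w w* w 11121 (12)^∞`. -/
def seqJ : ℤ → ℕ :=
  glue (pre ([1, 2, 3, 2, 3, 2, 1, 2, 1, 2, 1, 1, 2, 2, 2, 1] ++ w ++ w ++ wL).reverse (per [1, 2]))
    (pre (wR ++ w ++ [1, 1, 1, 2, 1]) (per [1, 2]))

/-- The open interval `(i₁, j₁)` of the real line, with endpoints `i₁ = m(seqI)` and
`j₁ = m(seqJ)`. -/
def intervalIJ : Set ℝ :=
  {t | markovValue seqI < (t : EReal) ∧ (t : EReal) < markovValue seqJ}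

/-- The forbidden words of the first list (local uniqueness). -/
def localWords : List (List ℕ) :=
  [[1, 3],
   [3, 2, 3, 2, 3],
   [3, 2, 3, 2, 2],
   [1, 2, 2, 3, 2, 2, 1],
   [2, 1, 2, 2, 3, 2, 2, 2],
   [1, 1, 1, 2, 2, 3, 2, 2, 2, 3],
   [2, 1, 1, 1, 2, 2, 3, 2, 2, 2, 2],
   [1, 1] ++ w,
   w ++ [2],
   [3, 2, 1] ++ w ++ [1, 1],
   [2, 2, 1] ++ w ++ [1, 1, 2],
   [1, 2, 2, 1] ++ w ++ [1, 1],
   [2, 2, 1] ++ w ++ [1, 1, 1, 1],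
   [2, 2, 2, 2, 1] ++ w ++ [1, 1, 1, 2, 3],
   [3, 2, 2, 2, 1] ++ w ++ [1, 1, 1, 2, 3],
   [3, 2, 2, 2, 1] ++ w ++ [1, 1, 1, 2, 2],
   [3, 3, 2, 2, 2, 1] ++ w ++ [1, 1, 1, 2, 1, 1, 2, 1],
   [2, 3, 2, 2, 2, 1] ++ w ++ [1, 1, 1, 2, 1, 1, 2],
   [2, 2, 1, 1, 1, 1, 1, 2, 2, 3, 2, 2, 2, 2, 2, 2],
   [1, 2, 1, 1, 1, 1, 1, 2, 2, 3, 2, 2, 2, 2, 2, 2],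
   [3, 3, 2, 1, 1, 1, 1, 1, 2, 2, 3, 2, 2, 2, 2, 2, 2],
   [2, 1, 1, 1, 1, 1, 2, 2, 3, 2, 2, 2, 2, 2, 3],
   [2, 1, 1, 1, 1, 1, 2, 2, 3, 2, 2, 2, 2, 2, 2, 1],
   [2, 1, 1, 1, 1, 1, 2, 2, 3, 2, 2, 2, 2, 2, 2, 2],
   [2, 1, 1, 1, 1, 1, 2, 2, 3, 2, 2, 2, 2, 2, 2, 3, 3],
   [1, 2, 3, 2, 1, 1, 1, 1, 1, 2, 2, 3, 2, 2, 2, 2, 2, 2, 3, 2, 1],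
   [2, 1, 2, 3, 2, 1, 1, 1, 1, 1, 2, 2, 3, 2, 2, 2, 2, 2, 2, 3, 2, 2]]

/-- The forbidden words of the second list (around `τ`). -/
def tauWords : List (List ℕ) :=
  [[2, 2, 1] ++ τ ++ [2],
   [1, 2, 1] ++ τ ++ [2],
   [2, 1] ++ τ ++ [2, 2],
   [2, 1] ++ τ ++ [2, 3],
   [2, 1, 2, 1] ++ τ,
   [2, 1] ++ τ ++ [2, 1, 1],
   [1, 1, 1, 2, 1] ++ τ,
   [3, 3, 2, 1] ++ τ ++ [2],
   [3, 2, 1, 1, 2, 1] ++ τ,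
   [2, 2, 1, 1, 2, 1] ++ τ,
   [1, 2, 1] ++ τ ++ [3, 3],
   [1, 2, 1] ++ τ ++ [3, 2, 1],
   [1, 2, 1] ++ τ ++ [3, 2, 2],
   [2, 1] ++ τ ++ [2, 1, 2, 3],
   [2, 1] ++ τ ++ [2, 1, 2, 2],
   [2, 1, 2, 3, 2, 1] ++ τ ++ [2, 1, 2, 1, 1],
   [1, 2, 3, 2, 1] ++ τ ++ [2, 1, 2, 1, 1, 2],
   [2, 1, 1, 1, 2, 3, 2, 1] ++ τ ++ [2, 1, 2, 1, 1, 1, 1],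
   [1, 1, 1, 2, 3, 2, 1] ++ τ ++ [2, 1, 2, 1, 1, 1, 1, 2],
   [2, 1, 1, 1, 1, 1, 2, 3, 2, 1] ++ τ ++ [2, 1, 2, 1, 1, 1, 1, 1, 1],
   [1, 1, 1, 1, 1, 2, 3, 2, 1] ++ τ ++ [2, 1, 2, 1, 1, 1, 1, 1, 1, 2],
   [1, 1, 1, 1, 1, 1, 1, 2, 3, 2, 1] ++ τ ++ [2, 1, 2, 1, 1, 1, 1, 1, 1, 1, 1, 2],
   [2, 1, 1, 1, 1, 1, 1, 1, 2, 3, 2, 1] ++ τ ++ [2, 1, 2, 1, 1, 1, 1, 1, 1, 1, 1],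
   [1, 1, 1, 1, 1, 1, 1, 1, 1, 2, 3, 2, 1] ++ τ ++ [2, 1, 2, 1, 1, 1, 1, 1, 1, 1, 1],
   [1, 1, 1, 1, 1, 1, 1, 2, 3, 2, 1] ++ τ ++ [2, 1, 2, 1, 1, 1, 1, 1, 1, 1, 1, 1, 1]]

/-- The self-replicating word `22221 w 11122`. -/
def selfWord : List ℕ := [2, 2, 2, 2, 1] ++ w ++ [1, 1, 1, 2, 2]

/-- The finite set `F` of forbidden words: the words of the lists above and their transposes. -/
def F : Set (List ℕ) :=
  {v | v ∈ localWords ++ tauWords ++ [selfWord] ∨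
    v.reverse ∈ localWords ++ tauWords ++ [selfWord]}

/-! ### The three sets -/

/-- The values `λ₀(γ u w w* w w w …)`, where `γ u w w` is a left-infinite sequence in `{1, 2, 3}`
without factors in `F`. The sequence `γ` is read from right to left. -/
def setC : Set ℝ :=
  {t | ∃ γ : ℕ → ℕ, (∀ n, γ n = 1 ∨ γ n = 2 ∨ γ n = 3) ∧
    (∀ f ∈ F, ¬ OccursLeft f (pre (u ++ w ++ w).reverse γ)) ∧
    t = lam (toW γ u) 0}

/-- The values `λ₀(… wᵀ wᵀ wᵀ uᵀ θ u w w* w w w …)`, where `θ` is a finite word in `{1, 2, 3}` with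
`[0; θ] ≥ [0; θᵀ]` such that `uᵀ θ u` has no factor in `F`. (The left-infinite sequence
`… wᵀ wᵀ wᵀ` read from right to left is `per w`.) -/
def setD : Set ℝ :=
  {t | ∃ θ : List ℕ, Letters123 θ ∧ finCF θ.reverse ≤ finCF θ ∧
    (∀ f ∈ F, ¬ f <:+: u.reverse ++ θ ++ u) ∧
    t = lam (toW (per w) (w.reverse ++ w.reverse ++ u.reverse ++ θ ++ u)) 0}

/-- The three values `λ₀(… wᵀ wᵀ wᵀ x w w* w w w …)` for the words
`x = 122211212121212112221`, `x = 1222112121212112221` and `x = 12221121212112221`. -/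
def setX : Set ℝ :=
  {lam (toW (per w) (w.reverse ++ w.reverse ++ [1, 2, 2, 2, 1, 1, 2, 1, 2, 1, 2, 1, 2, 1, 2, 1, 1,
      2, 2, 2, 1])) 0,
   lam (toW (per w) (w.reverse ++ w.reverse ++ [1, 2, 2, 2, 1, 1, 2, 1, 2, 1, 2, 1, 2, 1, 1, 2, 2,
      2, 1])) 0,
   lam (toW (per w) (w.reverse ++ w.reverse ++ [1, 2, 2, 2, 1, 1, 2, 1, 2, 1, 2, 1, 1, 2, 2, 2,
      1])) 0}

end

end MarkovLagrange

/-!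
A continued fraction with partial quotients in `{1, 2, 3}` is known up to a small error from
finitely many of them, so every statement of the form "a sequence in which all `λ_k` are small
(large) near some position contains (avoids) a given word" is a finite search through the
extensions of a word. `srch` is such a search as a Boolean function that the kernel evaluates,
with rational interval bounds at the leaves, and `srch_sound` is its soundness. The only leaves
that no rational bound can close are those where `i₁` or `j₁` itself is extremal; there `13` is
forbidden and the extremal continuation `1, 2, 1, 2, …` is compared exactly.

The searches give the local picture. Below `j₁` no word of the first two lists occurs
(`BiNice.avoids_basicWords`); then a value above `i₁` comes from the self-replicating word `22221
w 11122` or its transpose (`lam_le_or_self`); the self-replicating word reproduces itself `11`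
places to the right (`self_add`), and it is preceded by another copy or by `u w` (`self_sub`). So
an occurrence starts a chain `w w w …` to the right. In the middle of a chain `λ` is below `i₁`,
so if a value in the interval is attained, then the chain has a beginning `u w w* w w …` and the
value is attained there (`Realizes.exists_first`, `Realizes.att_cases`).

Markov values below `j₁` are attained by a limit of shifts (`exists_realizes`). In a sequence with
Lagrange value in the interval, self-replication would hold from some position on; a chain would
then occupy a half-line, on which `u`, a word of length `11` without `3`, cannot recur, whereas a
limit of shifts requires it to recur. Hence the interval contains no Lagrange value
(`not_mem_lagrangeSpectrum`).

It remains to sort the sequences `… u w w* w w …` that realize a value in the interval. If the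
transposed self-replicating word does not occur, the value belongs to `C` (`Realizes.inC`).
Otherwise there is a transposed chain to the left, and the sequence is `… wᵀ wᵀ wᵀ y w w* w …`,
where `y` begins with `uᵀ` and ends with `u`: either `y = uᵀ θ u`, or the two overlap, which is
possible in just three ways (`exists_mid`). The condition `[0; θ] ≥ [0; θᵀ]` says that the value
at the left chain is not larger than the value at the right one (`dbl_lam_le_iff`,
`finCF_middle`). Conversely all these sequences realize their value at position `0`, since a
forbidden word cannot end inside the chain (`Starts.cross`, `realizes_of_starts`).

A value of the second kind is isolated: sequences with values converging to it accumulate at `… wᵀ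
wᵀ wᵀ y w w* w …`, so they eventually contain the beginnings of both chains and `y`, and by
self-replication they are equal to it (`Good.isolated`).

The set `C` is compact as a continuous image of a closed set of sequences, and totally
disconnected because its elements differ from a constant by irrational numbers. It is perfect
since the far left of a sequence can be changed in two ways: freely in `{1, 2}` if no `3` is
there, as every forbidden word contains a `3`, and otherwise behind a letter `3`, where by one
more search one of four pairs of ends is admissible (`InC.exists_ends`).
-/

namespace MarkovLagrange

open Filter Topology

/-! ### Infinite continued fractions -/

/-- The one-sided sequence without its first letter. -/
def tl (s : ℕ → ℕ) : ℕ → ℕ := fun n => s (n + 1)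

lemma finCF_prefix_succ (s : ℕ → ℕ) (n : ℕ) :
    finCF ((List.range (n + 1)).map s) =
      1 / ((s 0 : ℝ) + finCF ((List.range n).map (tl s))) := by
  rw [List.range_succ_eq_map, List.map_cons, finCF, List.map_map]
  rfl

lemma finCF_nonneg : ∀ l : List ℕ, 0 ≤ finCF l
  | [] => le_rfl
  | a :: l => by
    have := finCF_nonneg l
    rw [finCF]
    positivity

lemma finCF_le_one : ∀ l : List ℕ, (∀ a ∈ l, 0 < a) → finCF l ≤ 1
  | [], _ => by simp [finCF]
  | a :: l, h => by
    have h0 := finCF_nonneg l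
    have h1 : (1 : ℝ) ≤ a := by exact_mod_cast h a (by simp)
    rw [finCF, div_le_one (by linarith)]
    linarith

lemma finCF_prefix_mem {s : ℕ → ℕ} (hs : ∀ n, 0 < s n) (n : ℕ) :
    finCF ((List.range n).map s) ∈ Set.Icc (0 : ℝ) 1 :=
  ⟨finCF_nonneg _, finCF_le_one _ (by simp [hs])⟩

lemma abs_sub_le_two_steps {a b x y : ℝ} (ha : 1 ≤ a) (hb : 1 ≤ b) (hx : 0 ≤ x) (hy : 0 ≤ y) :
    |1 / (a + 1 / (b + x)) - 1 / (a + 1 / (b + y))| ≤ |x - y| / 4 := by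
  have hX : 2 ≤ a * (b + x) + 1 := by nlinarith
  have hY : 2 ≤ a * (b + y) + 1 := by nlinarith
  have hbx : 0 < b + x := by linarith
  have hby : 0 < b + y := by linarith
  have e : 1 / (a + 1 / (b + x)) - 1 / (a + 1 / (b + y)) =
      (x - y) / ((a * (b + x) + 1) * (a * (b + y) + 1)) := by
    have h1 : a + 1 / (b + x) ≠ 0 := by positivity
    have h2 : a + 1 / (b + y) ≠ 0 := by positivity
    have h3 : a * (b + x) + 1 ≠ 0 := by positivity
    have h4 : a * (b + y) + 1 ≠ 0 := by positivity
    field_simp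
    ring
  rw [e, abs_div, abs_of_pos (show 0 < (a * (b + x) + 1) * (a * (b + y) + 1) by positivity)]
  exact div_le_div_of_nonneg_left (abs_nonneg _) (by norm_num) (by nlinarith)

/-- Two steps of the continued fraction algorithm contract distances by a factor `4`, so sequences
that agree for a long time have close convergents. -/
lemma abs_finCF_sub_le (n : ℕ) : ∀ {s s' : ℕ → ℕ}, (∀ i, 0 < s i) → (∀ i, 0 < s' i) →
    (∀ i < 2 * n, s i = s' i) → ∀ m ≥ 2 * n, ∀ m' ≥ 2 * n,
    |finCF ((List.range m).map s) - finCF ((List.range m').map s')| ≤ (1 / 4) ^ n := by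
  induction n with
  | zero =>
    intro s s' hs hs' _ m _ m' _
    have h1 := finCF_prefix_mem hs m
    have h2 := finCF_prefix_mem hs' m'
    rw [pow_zero, abs_le]
    constructor <;> linarith [h1.1, h1.2, h2.1, h2.2]
  | succ n ih =>
    intro s s' hs hs' h m hm m' hm'
    obtain ⟨m, rfl⟩ := Nat.exists_eq_add_of_le' (show 2 ≤ m by omega)
    obtain ⟨m', rfl⟩ := Nat.exists_eq_add_of_le' (show 2 ≤ m' by omega)
    have hI := ih (s := tl (tl s)) (s' := tl (tl s')) (fun i => hs _) (fun i => hs' _)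
      (fun i hi => h (i + 2) (by omega)) m (by omega) m' (by omega)
    rw [finCF_prefix_succ, finCF_prefix_succ, finCF_prefix_succ, finCF_prefix_succ,
      ← h 0 (by omega), show tl s' 0 = tl s 0 from (h 1 (by omega)).symm]
    refine (abs_sub_le_two_steps (by exact_mod_cast hs 0) (by exact_mod_cast hs 1)
      (finCF_nonneg _) (finCF_nonneg _)).trans ?_
    rw [pow_succ]
    linarith

lemma tendsto_infCF {s : ℕ → ℕ} (hs : ∀ i, 0 < s i) :
    Tendsto (fun n : ℕ => finCF ((List.range n).map s)) atTop (𝓝 (infCF s)) := by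
  refine CauchySeq.tendsto_limUnder (cauchySeq_of_le_tendsto_0' (fun n => (1 / 4 : ℝ) ^ (n / 2)) ?_
    ((tendsto_pow_atTop_nhds_zero_of_lt_one (by norm_num) (by norm_num)).comp
      (Nat.tendsto_div_const_atTop (by norm_num))))
  intro n m hnm
  exact abs_finCF_sub_le (n / 2) hs hs (fun _ _ => rfl) n (by omega) m (by omega)

lemma abs_infCF_sub_le {s s' : ℕ → ℕ} (hs : ∀ i, 0 < s i) (hs' : ∀ i, 0 < s' i) (n : ℕ)
    (h : ∀ i < 2 * n, s i = s' i) : |infCF s - infCF s'| ≤ (1 / 4) ^ n := by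
  refine le_of_tendsto ((tendsto_infCF hs).sub (tendsto_infCF hs')).abs ?_
  filter_upwards [eventually_ge_atTop (2 * n)] with m hm
  exact abs_finCF_sub_le n hs hs' h m hm m hm

lemma infCF_mem_Icc {s : ℕ → ℕ} (hs : ∀ i, 0 < s i) : infCF s ∈ Set.Icc (0 : ℝ) 1 :=
  isClosed_Icc.mem_of_tendsto (tendsto_infCF hs) (Eventually.of_forall (finCF_prefix_mem hs))

lemma infCF_step {s : ℕ → ℕ} (hs : ∀ i, 0 < s i) : infCF s = 1 / ((s 0 : ℝ) + infCF (tl s)) := by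
  have h1 : (0 : ℝ) < s 0 := by exact_mod_cast hs 0
  have h2 := (infCF_mem_Icc (s := tl s) (fun i => hs _)).1
  refine tendsto_nhds_unique ((tendsto_add_atTop_iff_nat 1).2 (tendsto_infCF hs)) ?_
  simp only [finCF_prefix_succ]
  exact tendsto_const_nhds.div (tendsto_const_nhds.add (tendsto_infCF (s := tl s) (fun i => hs _)))
    (by positivity)

lemma infCF_pos {s : ℕ → ℕ} (hs : ∀ i, 0 < s i) : 0 < infCF s := by
  have h1 : (0 : ℝ) < s 0 := by exact_mod_cast hs 0
  have h2 := (infCF_mem_Icc (s := tl s) (fun i => hs _)).1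
  rw [infCF_step hs]
  positivity

lemma infCF_lt_one {s : ℕ → ℕ} (hs : ∀ i, 0 < s i) : infCF s < 1 := by
  have h1 : (1 : ℝ) ≤ s 0 := by exact_mod_cast hs 0
  have h2 := infCF_pos (s := tl s) (fun i => hs _)
  rw [infCF_step hs, div_lt_one (by positivity)]
  linarith

/-- The alternating lexicographic order of continued fractions: the comparison is decided by the
first index at which two sequences differ, and reversed at even indices. -/
lemma infCF_lt_of_first_diff (n : ℕ) : ∀ {s s' : ℕ → ℕ}, (∀ i, 0 < s i) → (∀ i, 0 < s' i) →
    (∀ i < n, s i = s' i) → s n < s' n →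
    (Even n → infCF s' < infCF s) ∧ (¬ Even n → infCF s < infCF s') := by
  induction n with
  | zero =>
    intro s s' hs hs' _ h
    refine ⟨fun _ => ?_, fun h => absurd Even.zero h⟩
    have h1 : (0 : ℝ) < s 0 := by exact_mod_cast hs 0
    have h2 : ((s 0 : ℝ)) + 1 ≤ s' 0 := by exact_mod_cast h
    have h3 := infCF_pos (s := tl s) (fun i => hs _)
    have h4 := infCF_lt_one (s := tl s) (fun i => hs _)
    have h5 := infCF_pos (s := tl s') (fun i => hs' _)
    rw [infCF_step hs, infCF_step hs']
    exact one_div_lt_one_div_of_lt (by positivity) (by linarith)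
  | succ n ih =>
    intro s s' hs hs' h hn
    have hI := ih (s := tl s) (s' := tl s') (fun i => hs _) (fun i => hs' _)
      (fun i hi => h (i + 1) (by omega)) hn
    have h1 : (0 : ℝ) < s 0 := by exact_mod_cast hs 0
    have h3 := infCF_pos (s := tl s) (fun i => hs _)
    have h5 := infCF_pos (s := tl s') (fun i => hs' _)
    rw [infCF_step hs, infCF_step hs', ← h 0 (by omega), Nat.even_add_one]
    refine ⟨fun he => ?_, fun he => ?_⟩
    · exact one_div_lt_one_div_of_lt (by positivity) (by linarith [hI.2 he])
    · exact one_div_lt_one_div_of_lt (by positivity) (by linarith [hI.1 (not_not.1 he)])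

lemma exists_first_diff {s s' : ℕ → ℕ} (h : s ≠ s') :
    ∃ n, (∀ i < n, s i = s' i) ∧ s n ≠ s' n := by
  have hex : ∃ n, s n ≠ s' n := Function.ne_iff.1 h
  classical
  exact ⟨Nat.find hex, fun i hi => not_not.1 (Nat.find_min hex hi), Nat.find_spec hex⟩

lemma infCF_injective {s s' : ℕ → ℕ} (hs : ∀ i, 0 < s i) (hs' : ∀ i, 0 < s' i)
    (h : infCF s = infCF s') : s = s' := by
  by_contra hne
  obtain ⟨n, hn, hd⟩ := exists_first_diff hne
  rcases lt_or_gt_of_ne hd with hlt | hlt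
  · have := infCF_lt_of_first_diff n hs hs' hn hlt
    by_cases he : Even n
    · exact (this.1 he).ne' h
    · exact (this.2 he).ne h
  · have := infCF_lt_of_first_diff n hs' hs (fun i hi => (hn i hi).symm) hlt
    by_cases he : Even n
    · exact (this.1 he).ne h
    · exact (this.2 he).ne' h

/-- An infinite continued fraction has an irrational value: the denominators of the values of the
successive tails of a rational one would decrease forever. -/
lemma infCF_irrational {s : ℕ → ℕ} (hs : ∀ i, 0 < s i) : Irrational (infCF s) := by
  suffices H : ∀ q : ℕ, ∀ s : ℕ → ℕ, (∀ i, 0 < s i) → ∀ p : ℤ, (q : ℝ) * infCF s = p → q = 0 by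
    rintro ⟨r, hr⟩
    refine r.den_ne_zero (H r.den s hs r.num ?_)
    rw [← hr, mul_comm]
    exact_mod_cast Rat.mul_den_eq_num r
  intro q
  induction q using Nat.strong_induction_on with
  | _ q ih =>
    intro s hs p hp
    by_contra hq
    have hq' : (0 : ℝ) < q := by positivity
    have h1 := infCF_pos hs
    have h2 := infCF_lt_one hs
    have h3 := infCF_pos (s := tl s) (fun i => hs _)
    have h4 : (0 : ℝ) < s 0 := by exact_mod_cast hs 0
    have hp0 : (0 : ℝ) < p := by rw [← hp]; positivity
    have hp1 : (p : ℝ) < q := by rw [← hp]; nlinarith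
    have hp0' : 0 < p := by exact_mod_cast hp0
    have hpq : p < q := by exact_mod_cast hp1
    lift p to ℕ using hp0'.le
    have e := infCF_step hs
    have e2 : infCF s * (s 0 + infCF (tl s)) = 1 := by rw [e]; field_simp
    have := ih p (by exact_mod_cast hpq) (tl s) (fun i => hs _) (q - s 0 * p) (by
      push_cast
      have : (q : ℝ) * (infCF s * (s 0 + infCF (tl s))) = q := by rw [e2, mul_one]
      rw [← mul_assoc, hp] at this
      push_cast at this
      linarith)
    omega

/-! ### Sequences with letters in `{1, 2, 3}` -/

/-- All letters of the one-sided sequence are `1`, `2` or `3`. -/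
def Nice (s : ℕ → ℕ) : Prop := ∀ n, s n = 1 ∨ s n = 2 ∨ s n = 3

lemma Nice.pos {s : ℕ → ℕ} (h : Nice s) (n : ℕ) : 0 < s n := by
  rcases h n with h | h | h <;> omega

lemma Nice.tl {s : ℕ → ℕ} (h : Nice s) : Nice (tl s) := fun n => h (n + 1)

lemma Nice.infCF_mem {s : ℕ → ℕ} (h : Nice s) : infCF s ∈ Set.Icc (1 / 4 : ℝ) (4 / 5) := by
  have key : ∀ t : ℕ → ℕ, Nice t → (1 / 4 : ℝ) ≤ infCF t := by
    intro t ht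
    have h1 := infCF_lt_one ht.tl.pos
    have h2 := infCF_pos ht.tl.pos
    have h3 : (t 0 : ℝ) ≤ 3 := by rcases ht 0 with h | h | h <;> norm_num [h]
    rw [infCF_step ht.pos]
    exact one_div_le_one_div_of_le (by positivity) (by linarith)
  refine ⟨key s h, ?_⟩
  have h1 := key _ h.tl
  have h3 : (1 : ℝ) ≤ s 0 := by exact_mod_cast h.pos 0
  rw [infCF_step h.pos, div_le_iff₀ (by positivity)]
  linarith

/-- If no `3` follows a `1`, then `[0; 1, 2, 1, 2, …]` is the largest possible value. -/
lemma Nice.infCF_le_per {s : ℕ → ℕ} (h : Nice s) (h13 : ∀ n, s n = 1 → s (n + 1) ≠ 3) :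
    infCF s ≤ infCF (per [1, 2]) := by
  have hp0 : ∀ n, per [1, 2] (2 * n) = 1 := fun n => by simp [per]
  have hp1 : ∀ n, per [1, 2] (2 * n + 1) = 2 := fun n => by
    simp [per, Nat.add_mod]
  have hp : ∀ n, 0 < per [1, 2] n := fun n => by
    rcases Nat.even_or_odd' n with ⟨m, rfl | rfl⟩
    · simp [hp0]
    · simp [hp1]
  by_cases hne : s = per [1, 2]
  · rw [hne]
  obtain ⟨n, hn, hd⟩ := exists_first_diff hne
  rcases Nat.even_or_odd' n with ⟨m, rfl | rfl⟩
  · rw [hp0] at hd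
    have := (infCF_lt_of_first_diff (2 * m) hp h.pos (fun i hi => (hn i hi).symm)
      (by rw [hp0]; have := h.pos (2 * m); omega)).1 (by simp)
    exact this.le
  · rw [hp1] at hd
    have h1 : s (2 * m) = 1 := by rw [hn _ (by omega), hp0]
    have := (infCF_lt_of_first_diff (2 * m + 1) h.pos hp hn
      (by rw [hp1]; have := h13 _ h1; rcases h (2 * m + 1) with h | h | h <;> omega)).2
      (by simp)
    exact this.le

/-! ### Words in bi-infinite sequences -/

/-- The word `l` is an initial segment of the one-sided sequence `s`. -/
def SP (l : List ℕ) (s : ℕ → ℕ) : Prop := ∀ i (h : i < l.length), s i = l[i]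

instance (l : List ℕ) (s : ℕ → ℕ) : Decidable (SP l s) :=
  inferInstanceAs (Decidable (∀ i (h : i < l.length), s i = l[i]))

/-- The part `a_k a_{k+1} …` of a bi-infinite sequence. -/
def rgt (a : ℤ → ℕ) (k : ℤ) : ℕ → ℕ := fun n => a (k + n)

/-- The part `a_{k-1} a_{k-2} …` of a bi-infinite sequence. -/
def lft (a : ℤ → ℕ) (k : ℤ) : ℕ → ℕ := fun n => a (k - 1 - n)

/-- The word `v` occurs in `a` with its first letter at position `k`. -/
def At (v : List ℕ) (a : ℤ → ℕ) (k : ℤ) : Prop := SP v (rgt a k)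

/-- The sequence read backwards. -/
def rev (a : ℤ → ℕ) : ℤ → ℕ := fun k => a (-k)

/-- All letters of the bi-infinite sequence are `1`, `2` or `3`. -/
def BiNice (a : ℤ → ℕ) : Prop := ∀ k, a k = 1 ∨ a k = 2 ∨ a k = 3

lemma BiNice.rgt {a : ℤ → ℕ} (h : BiNice a) (k : ℤ) : Nice (rgt a k) := fun _ => h _

lemma BiNice.lft {a : ℤ → ℕ} (h : BiNice a) (k : ℤ) : Nice (lft a k) := fun _ => h _

lemma BiNice.rev {a : ℤ → ℕ} (h : BiNice a) : BiNice (rev a) := fun _ => h _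

lemma lam_eq (a : ℤ → ℕ) (k : ℤ) :
    lam a k = (a k : ℝ) + infCF (rgt a (k + 1)) + infCF (lft a k) := rfl

lemma SP_nil (s : ℕ → ℕ) : SP [] s := fun _ h => absurd h (by simp)

lemma SP_cons {x : ℕ} {l : List ℕ} {s : ℕ → ℕ} : SP (x :: l) s ↔ s 0 = x ∧ SP l (tl s) := by
  constructor
  · intro h
    exact ⟨h 0 (by simp), fun i hi => h (i + 1) (by simpa using hi)⟩
  · rintro ⟨h0, h1⟩ i hi
    cases i with
    | zero => exact h0
    | succ i => exact h1 i (by simpa using hi)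

lemma SP_append {l m : List ℕ} {s : ℕ → ℕ} :
    SP (l ++ m) s ↔ SP l s ∧ SP m (fun n => s (l.length + n)) := by
  constructor
  · intro h
    refine ⟨fun i hi => ?_, fun i hi => ?_⟩
    · rw [h i (by simp; omega), List.getElem_append_left hi]
    · show s (l.length + i) = _
      rw [h (l.length + i) (by simp; omega), List.getElem_append_right (by omega)]
      simp
  · rintro ⟨h1, h2⟩ i hi
    by_cases hl : i < l.length
    · rw [h1 i hl, List.getElem_append_left hl]
    · rw [List.getElem_append_right (by omega)]
      rw [← h2 (i - l.length) (by simp at hi; omega)]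
      congr 1
      omega

lemma tl_rgt (a : ℤ → ℕ) (k : ℤ) : tl (rgt a k) = rgt a (k + 1) := by
  funext n
  simp only [tl, rgt]
  congr 1
  push_cast
  ring

lemma rgt_add (a : ℤ → ℕ) (k : ℤ) (m : ℕ) : (fun n => rgt a k (m + n)) = rgt a (k + m) := by
  funext n
  simp only [rgt]
  congr 1
  push_cast
  ring

lemma At_nil (a : ℤ → ℕ) (k : ℤ) : At [] a k := SP_nil _

lemma At_cons {x : ℕ} {l : List ℕ} {a : ℤ → ℕ} {k : ℤ} :
    At (x :: l) a k ↔ a k = x ∧ At l a (k + 1) := by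
  rw [At, SP_cons, tl_rgt]
  simp [rgt, At]

lemma At_append {l m : List ℕ} {a : ℤ → ℕ} {k : ℤ} :
    At (l ++ m) a k ↔ At l a k ∧ At m a (k + l.length) := by
  rw [At, SP_append, rgt_add]
  rfl

lemma At.apply {v : List ℕ} {a : ℤ → ℕ} {k : ℤ} (h : At v a k) (i : ℕ) (hi : i < v.length) :
    a (k + i) = v[i] := h i hi

lemma SP_reverse_lft {A : List ℕ} {a : ℤ → ℕ} {k : ℤ} :
    SP A.reverse (lft a k) ↔ At A a (k - A.length) := by
  induction A with
  | nil => simp [SP_nil, At_nil]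
  | cons x A ih =>
    rw [List.reverse_cons, SP_append, ih, SP_cons, At_cons]
    have e : k - ((x :: A).length : ℤ) + 1 = k - A.length := by
      simp
      ring
    have e' : k - ((x :: A).length : ℤ) = k - 1 - A.length := by
      simp
      ring
    rw [e, e']
    simp only [lft, List.length_reverse, Nat.add_zero]
    exact ⟨fun h => ⟨h.2.1, h.1⟩, fun h => ⟨h.2, h.1, SP_nil _⟩⟩

lemma rgt_rev (a : ℤ → ℕ) (k : ℤ) : rgt (rev a) k = lft a (-k + 1) := by
  funext n
  simp only [rgt, rev, lft]
  congr 1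
  ring

lemma lft_rev (a : ℤ → ℕ) (k : ℤ) : lft (rev a) k = rgt a (-k + 1) := by
  funext n
  simp only [rgt, rev, lft]
  congr 1
  ring

lemma rev_rev (a : ℤ → ℕ) : rev (rev a) = a := by
  funext k
  simp [rev]

lemma lam_rev (a : ℤ → ℕ) (k : ℤ) : lam (rev a) k = lam a (-k) := by
  rw [lam_eq, lam_eq, rgt_rev, lft_rev, show -(k + 1) + 1 = -k by ring]
  simp only [rev]
  ring

lemma At_rev {v : List ℕ} {a : ℤ → ℕ} {k : ℤ} :
    At v (rev a) k ↔ At v.reverse a (-k + 1 - v.length) := by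
  rw [At, rgt_rev, ← List.length_reverse, ← SP_reverse_lft, List.reverse_reverse]

lemma At.of_infix {f v : List ℕ} {a : ℤ → ℕ} {k : ℤ} (h : At v a k) (hf : f <:+: v) :
    ∃ j, At f a j := by
  obtain ⟨s, t, rfl⟩ := hf
  exact ⟨_, (At_append.1 (At_append.1 h).1).2⟩

/-- The shifted sequence. -/
def shift (a : ℤ → ℕ) (m : ℤ) : ℤ → ℕ := fun k => a (m + k)

lemma rgt_shift (a : ℤ → ℕ) (m k : ℤ) : rgt (shift a m) k = rgt a (m + k) := by
  funext n
  simp only [rgt, shift]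
  congr 1
  ring

lemma lft_shift (a : ℤ → ℕ) (m k : ℤ) : lft (shift a m) k = lft a (m + k) := by
  funext n
  simp only [lft, shift]
  congr 1
  ring

lemma lam_shift (a : ℤ → ℕ) (m k : ℤ) : lam (shift a m) k = lam a (m + k) := by
  rw [lam_eq, lam_eq, rgt_shift, lft_shift, ← add_assoc]
  rfl

lemma At_shift {v : List ℕ} {a : ℤ → ℕ} {m k : ℤ} : At v (shift a m) k ↔ At v a (m + k) := by
  rw [At, rgt_shift, At]

/-! ### A verified search through extensions of words -/

/-- `l` is a prefix of `m`, as a Boolean function that the kernel evaluates quickly. -/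
def pfx : List ℕ → List ℕ → Bool
  | [], _ => true
  | _ :: _, [] => false
  | a :: l, b :: m => Nat.beq a b && pfx l m

lemma pfx_iff : ∀ {l m : List ℕ}, pfx l m = true → l <+: m
  | [], _, _ => List.nil_prefix
  | _ :: _, [], h => by simp [pfx] at h
  | a :: l, b :: m, h => by
    simp only [pfx, Bool.and_eq_true] at h
    obtain rfl := Nat.eq_of_beq_eq_true h.1
    exact List.cons_prefix_cons.2 ⟨rfl, pfx_iff h.2⟩

lemma SP.of_prefix {l m : List ℕ} {s : ℕ → ℕ} (h : SP m s) (hl : l <+: m) : SP l s := by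
  obtain ⟨t, rfl⟩ := hl
  exact (SP_append.1 h).1

/-- Interval evaluation of the continued fraction `[0; xₙ, …, x₁ + t]` for a word `x₁ … xₙ` that is
listed from its far end, where `p / q ≤ t ≤ p' / q'`. The resulting bounds are passed on to `K`. -/
def ev : List ℕ → ℕ → ℕ → ℕ → ℕ → (ℕ → ℕ → ℕ → ℕ → Bool) → Bool
  | [], p, q, p', q', K => K p q p' q'
  | a :: l, p, q, p', q', K => ev l q' (a * q' + p') q (a * q + p) K

lemma ev_sound {s : ℕ → ℕ} (hs : Nice s) {K : ℕ → ℕ → ℕ → ℕ → Bool} :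
    ∀ (A : List ℕ) (p q p' q' : ℕ), ev A p q p' q' K = true → SP A.reverse s → 0 < q → 0 < q' →
      (p : ℝ) / q ≤ infCF (fun n => s (A.length + n)) →
      infCF (fun n => s (A.length + n)) ≤ (p' : ℝ) / q' →
      ∃ p q p' q' : ℕ, K p q p' q' = true ∧ 0 < q ∧ 0 < q' ∧ (p : ℝ) / q ≤ infCF s ∧
        infCF s ≤ (p' : ℝ) / q'
  | [], p, q, p', q', h, _, hq, hq', h1, h2 => by
    simp only [List.length_nil, Nat.zero_add] at h1 h2
    exact ⟨p, q, p', q', h, hq, hq', h1, h2⟩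
  | a :: A, p, q, p', q', h, hsp, hq, hq', h1, h2 => by
    rw [List.reverse_cons, SP_append, SP_cons] at hsp
    have ha : s A.length = a := by simpa using hsp.2.1
    have ha0 : 0 < a := ha ▸ hs.pos _
    have hst : infCF (fun n => s (A.length + n)) =
        1 / ((a : ℝ) + infCF (fun n => s ((a :: A).length + n))) := by
      rw [infCF_step (fun i => hs.pos _)]
      simp only [Nat.add_zero, ha]
      congr 3
      funext n
      simp only [tl, List.length_cons]
      congr 1
      omega
    have hpos : 0 ≤ infCF (fun n => s ((a :: A).length + n)) := (infCF_pos (fun i => hs.pos _)).le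
    have ha1 : (0 : ℝ) < a := by exact_mod_cast ha0
    have hqr : (0 : ℝ) < q := by exact_mod_cast hq
    have hqr' : (0 : ℝ) < q' := by exact_mod_cast hq'
    refine ev_sound hs A _ _ _ _ h hsp.1 (by positivity) (by positivity) ?_ ?_
    · rw [hst]
      have : (q' : ℝ) / ((a * q' + p' : ℕ) : ℝ) = 1 / (a + p' / q') := by
        push_cast
        field_simp
      rw [this]
      exact one_div_le_one_div_of_le (by positivity) (by linarith)
    · rw [hst]
      have : (q : ℝ) / ((a * q + p : ℕ) : ℝ) = 1 / (a + p / q) := by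
        push_cast
        field_simp
      rw [this]
      exact one_div_le_one_div_of_le (by positivity) (by linarith)

/-- Certificate for `λ ≤ N / D` at a letter `3` with the words `A` on its left and `B` on its right
(both listed from their far ends). The unknown continued fractions beyond the words lie in
`[1/4, 4/5]`. -/
def hiOK (N D : ℕ) (A B : List ℕ) : Bool :=
  ev A 1 4 4 5 fun _ _ p q => ev B 1 4 4 5 fun _ _ p' q' =>
    Nat.ble (D * (3 * (q * q') + p * q' + p' * q)) (N * (q * q'))

/-- Certificate for `N / D ≤ λ` at a letter `3` with the words `A` on its left and `B` on its right
(both listed from their far ends). -/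
def loOK (N D : ℕ) (A B : List ℕ) : Bool :=
  ev A 1 4 4 5 fun p q _ _ => ev B 1 4 4 5 fun p' q' _ _ =>
    Nat.ble (N * (q * q')) (D * (3 * (q * q') + p * q' + p' * q))

lemma ev_start {s : ℕ → ℕ} (hs : Nice s) {K : ℕ → ℕ → ℕ → ℕ → Bool} {A : List ℕ}
    (h : ev A 1 4 4 5 K = true) (hA : SP A.reverse s) :
    ∃ p q p' q' : ℕ, K p q p' q' = true ∧ 0 < q ∧ 0 < q' ∧ (p : ℝ) / q ≤ infCF s ∧
        infCF s ≤ (p' : ℝ) / q' := by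
  have hn : Nice (fun n => s (A.length + n)) := fun n => hs _
  refine ev_sound hs A 1 4 4 5 h hA (by norm_num) (by norm_num) ?_ ?_
  · exact_mod_cast hn.infCF_mem.1
  · exact_mod_cast hn.infCF_mem.2

lemma hiOK_sound {a : ℤ → ℕ} (ha : BiNice a) {k : ℤ} (h3 : a k = 3) {N D : ℕ} (hD : 0 < D)
    {A B : List ℕ} (h : hiOK N D A B = true) (hA : SP A.reverse (lft a k))
    (hB : SP B.reverse (rgt a (k + 1))) : lam a k ≤ (N : ℝ) / D := by
  obtain ⟨_, _, p, q, h, -, hq, -, h1⟩ := ev_start (ha.lft k) h hA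
  obtain ⟨_, _, p', q', h, -, hq', -, h2⟩ := ev_start (ha.rgt (k + 1)) h hB
  have h' : ((D * (3 * (q * q') + p * q' + p' * q) : ℕ) : ℝ) ≤ ((N * (q * q') : ℕ) : ℝ) := by
    exact_mod_cast Nat.le_of_ble_eq_true h
  have hqr : (0 : ℝ) < q := by exact_mod_cast hq
  have hqr' : (0 : ℝ) < q' := by exact_mod_cast hq'
  have hDr : (0 : ℝ) < D := by exact_mod_cast hD
  have e : (3 : ℝ) + p / q + p' / q' = (3 * (q * q') + p * q' + p' * q) / (q * q') := by
    field_simp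
  have : (3 : ℝ) + p / q + p' / q' ≤ N / D := by
    rw [e, div_le_div_iff₀ (by positivity) hDr]
    push_cast at h'
    linarith
  rw [lam_eq, h3]
  push_cast
  linarith

lemma loOK_sound {a : ℤ → ℕ} (ha : BiNice a) {k : ℤ} (h3 : a k = 3) {N D : ℕ} (hD : 0 < D)
    {A B : List ℕ} (h : loOK N D A B = true) (hA : SP A.reverse (lft a k))
    (hB : SP B.reverse (rgt a (k + 1))) : (N : ℝ) / D ≤ lam a k := by
  obtain ⟨p, q, _, _, h, hq, -, h1, -⟩ := ev_start (ha.lft k) h hA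
  obtain ⟨p', q', _, _, h, hq', -, h2, -⟩ := ev_start (ha.rgt (k + 1)) h hB
  have h' : ((N * (q * q') : ℕ) : ℝ) ≤ ((D * (3 * (q * q') + p * q' + p' * q) : ℕ) : ℝ) := by
    exact_mod_cast Nat.le_of_ble_eq_true h
  have hqr : (0 : ℝ) < q := by exact_mod_cast hq
  have hqr' : (0 : ℝ) < q' := by exact_mod_cast hq'
  have hDr : (0 : ℝ) < D := by exact_mod_cast hD
  have e : (3 : ℝ) + p / q + p' / q' = (3 * (q * q') + p * q' + p' * q) / (q * q') := by
    field_simp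
  have : (N : ℝ) / D ≤ (3 : ℝ) + p / q + p' / q' := by
    rw [e, div_le_div_iff₀ hDr (by positivity)]
    push_cast at h'
    linarith
  rw [lam_eq, h3]
  push_cast
  linarith

/-- Certificate that some letter `3` of the word `Y`, preceded by the reversed word `X`, has
`N / D ≤ λ`. -/
def anyLo (N D : ℕ) : List ℕ → List ℕ → Bool
  | _, [] => false
  | X, y :: Y => (Nat.beq y 3 && loOK N D X.reverse Y.reverse) || anyLo N D (y :: X) Y

lemma anyLo_sound {a : ℤ → ℕ} (ha : BiNice a) {N D : ℕ} (hD : 0 < D) :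
    ∀ (X Y : List ℕ) (k : ℤ), anyLo N D X Y = true → SP X (lft a k) → At Y a k →
      ∃ k, (N : ℝ) / D ≤ lam a k
  | _, [], _, h, _, _ => by simp [anyLo] at h
  | X, y :: Y, k, h, hX, hY => by
    rw [At_cons] at hY
    rw [anyLo, Bool.or_eq_true, Bool.and_eq_true] at h
    rcases h with ⟨h3, h⟩ | h
    · refine ⟨k, loOK_sound ha ?_ hD h ?_ ?_⟩
      · rw [hY.1]
        exact Nat.eq_of_beq_eq_true h3
      · rwa [List.reverse_reverse]
      · rw [List.reverse_reverse]
        exact hY.2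
    · refine anyLo_sound ha hD (y :: X) Y (k + 1) h ?_ hY.2
      rw [SP_cons]
      refine ⟨by simpa [lft] using hY.1, ?_⟩
      convert hX using 1
      funext n
      simp only [tl, lft]
      congr 1
      push_cast
      ring

/-- A finite set of words over `{1, 2, 3}`, stored as a prefix tree. -/
inductive Trie
  | none
  | word
  | node (t₁ t₂ t₃ : Trie)

/-- The prefix tree with one more word. Words with a prefix in the tree are not added. -/
def Trie.insert : Trie → List ℕ → Trie
  | .word, _ => .word
  | _, [] => .word
  | .none, x :: l => bif Nat.beq x 1 then .node (Trie.insert .none l) .none .none else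
      bif Nat.beq x 2 then .node .none (Trie.insert .none l) .none else
      bif Nat.beq x 3 then .node .none .none (Trie.insert .none l) else .none
  | .node t₁ t₂ t₃, x :: l => bif Nat.beq x 1 then .node (t₁.insert l) t₂ t₃ else
      bif Nat.beq x 2 then .node t₁ (t₂.insert l) t₃ else
      bif Nat.beq x 3 then .node t₁ t₂ (t₃.insert l) else .node t₁ t₂ t₃

/-- Some word of the tree is a prefix of the given word. -/
def Trie.hit : Trie → List ℕ → Bool
  | .word, _ => true
  | .none, _ => false
  | .node _ _ _, [] => false
  | .node t₁ t₂ t₃, x :: l => bif Nat.beq x 1 then t₁.hit l else bif Nat.beq x 2 then t₂.hit l else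
      bif Nat.beq x 3 then t₃.hit l else false

lemma Trie.hit_insert : ∀ (f v : List ℕ) (t : Trie), (t.insert f).hit v = true →
    t.hit v = true ∨ f <+: v
  | [], _, _, _ => Or.inr List.nil_prefix
  | x :: f, [], t, h => by
    left
    cases t <;> simp only [Trie.insert, cond_eq_ite] at h ⊢ <;> (try split_ifs at h) <;>
      simp_all [Trie.hit]
  | x :: f, y :: v, t, h => by
    cases t with
    | word => exact Or.inl rfl
    | none =>
      right
      simp only [Trie.insert, cond_eq_ite] at h
      split_ifs at h with h1 h2 h3
      all_goals simp only [Trie.hit, cond_eq_ite] at h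
      all_goals try split_ifs at h with h4 h5 h6
      all_goals try simp at h
      all_goals
        simp only [Nat.beq_eq] at *
        subst_vars
        rcases Trie.hit_insert f v _ h with h | h
        · simp [Trie.hit] at h
        · exact List.cons_prefix_cons.2 ⟨rfl, h⟩
    | node t₁ t₂ t₃ =>
      simp only [Trie.insert, cond_eq_ite] at h
      split_ifs at h with h1 h2 h3
      all_goals simp only [Trie.hit, cond_eq_ite] at h ⊢
      all_goals try split_ifs at h with h4 h5 h6
      all_goals simp only [Nat.beq_eq] at *
      all_goals first
        | (subst_vars; rcases Trie.hit_insert f v _ h with h | h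
           · left; simpa using h
           · exact Or.inr (List.cons_prefix_cons.2 ⟨rfl, h⟩))
        | (left; simp_all)

/-- The prefix tree of a list of words. -/
def trie (forb : List (List ℕ)) : Trie := forb.foldl Trie.insert .none

lemma trie_hit {forb : List (List ℕ)} {v : List ℕ} (h : (trie forb).hit v = true) :
    ∃ f ∈ forb, f <+: v := by
  have key : ∀ (l : List (List ℕ)) (t : Trie), (l.foldl Trie.insert t).hit v = true →
      t.hit v = true ∨ ∃ f ∈ l, f <+: v := by
    intro l
    induction l with
    | nil => exact fun t h => Or.inl h
    | cons f l ih =>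
      intro t h
      rcases ih _ h with h | ⟨g, hg, hp⟩
      · rcases Trie.hit_insert f v t h with h | h
        · exact Or.inl h
        · exact Or.inr ⟨f, by simp, h⟩
      · exact Or.inr ⟨g, by simp [hg], hp⟩
  rcases key forb .none h with h | h
  · simp [Trie.hit] at h
  · exact h

/-- Exhaustive search through the extensions of the word `A 3 Bᵀ` by letters `1`, `2`, `3`, on the
side that `side` selects. A branch is closed if a word of `forb` starts at the left end, or
its transpose ends at the right end, or if `leaf` accepts it. -/
def srch (forb : Trie) (leaf : List ℕ → List ℕ → Bool) (side : ℕ → Bool) :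
    ℕ → List ℕ → List ℕ → Bool
  | 0, A, B => leaf A B
  | n + 1, A, B => forb.hit (A ++ 3 :: B.reverse) || (forb.hit (B ++ 3 :: A.reverse) ||
      (leaf A B || cond (side n)
        (srch forb leaf side n (1 :: A) B && (srch forb leaf side n (2 :: A) B &&
          srch forb leaf side n (3 :: A) B))
        (srch forb leaf side n A (1 :: B) && (srch forb leaf side n A (2 :: B) &&
          srch forb leaf side n A (3 :: B)))))

/-- None of the words, and none of their transposes, occurs in `a`. -/
def Avoids (forb : List (List ℕ)) (a : ℤ → ℕ) : Prop :=
  ∀ f ∈ forb, ∀ j, ¬ At f a j ∧ ¬ At f.reverse a j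

lemma Avoids.rev {forb : List (List ℕ)} {a : ℤ → ℕ} (h : Avoids forb a) : Avoids forb (rev a) := by
  intro f hf j
  rw [At_rev, At_rev, List.reverse_reverse]
  exact ⟨(h f hf _).2, (h f hf _).1⟩

lemma Avoids.not_hit {forb : List (List ℕ)} {a : ℤ → ℕ} (h : Avoids forb a) {v : List ℕ} {k : ℤ}
    (hv : At v a k ∨ At v.reverse a k) : (trie forb).hit v ≠ true := by
  intro hb
  obtain ⟨f, hf, hp⟩ := trie_hit hb
  rcases hv with hv | hv
  · exact (h f hf _).1 (hv.of_prefix hp)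
  · obtain ⟨j, hj⟩ := hv.of_infix (f := f.reverse) (List.reverse_infix.2 hp.isInfix)
    exact (h f hf j).2 hj

lemma srch_sound {a : ℤ → ℕ} (ha : BiNice a) {k : ℤ} (h3 : a k = 3) {forb : List (List ℕ)}
    (hf : Avoids forb a) {leaf : List ℕ → List ℕ → Bool} {side : ℕ → Bool} {Q : Prop}
    (hleaf : ∀ A B, leaf A B = true → SP A.reverse (lft a k) → SP B.reverse (rgt a (k + 1)) → Q) :
    ∀ n A B, srch (trie forb) leaf side n A B = true → SP A.reverse (lft a k) →
      SP B.reverse (rgt a (k + 1)) → Q := by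
  intro n
  induction n with
  | zero => exact fun A B h hA hB => hleaf A B h hA hB
  | succ n ih =>
    intro A B h hA hB
    have hW : At (A ++ 3 :: B.reverse) a (k - A.length) := by
      rw [At_append, At_cons]
      rw [SP_reverse_lft] at hA
      exact ⟨hA, by simpa using h3, by simpa [At] using hB⟩
    rw [srch, Bool.or_eq_true, Bool.or_eq_true, Bool.or_eq_true] at h
    rcases h with h | h | h | h
    · exact absurd h (hf.not_hit (Or.inl hW))
    · refine absurd h (hf.not_hit (k := k - A.length) (Or.inr ?_))
      convert hW using 1
      simp
    · exact hleaf A B h hA hB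
    · cases hs : side n
      · rw [hs, cond_false, Bool.and_eq_true, Bool.and_eq_true] at h
        have hx : ∀ x, a (k + 1 + B.length) = x → SP (x :: B).reverse (rgt a (k + 1)) := by
          intro x hx
          rw [List.reverse_cons, SP_append, SP_cons]
          exact ⟨hB, by simpa [rgt] using hx, SP_nil _⟩
        rcases ha (k + 1 + B.length) with e | e | e
        · exact ih _ _ h.1 hA (hx _ e)
        · exact ih _ _ h.2.1 hA (hx _ e)
        · exact ih _ _ h.2.2 hA (hx _ e)
      · rw [hs, cond_true, Bool.and_eq_true, Bool.and_eq_true] at h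
        have hx : ∀ x, a (k - 1 - A.length) = x → SP (x :: A).reverse (lft a k) := by
          intro x hx
          rw [List.reverse_cons, SP_append, SP_cons]
          exact ⟨hA, by simpa [lft] using hx, SP_nil _⟩
        rcases ha (k - 1 - A.length) with e | e | e
        · exact ih _ _ h.1 (hx _ e) hB
        · exact ih _ _ h.2.1 (hx _ e) hB
        · exact ih _ _ h.2.2 (hx _ e) hB

/-- The word has the prefix `P` when read from the centre to the left and `Q` when read from the
centre to the right. -/
def pat (P Q A B : List ℕ) : Bool := pfx P A.reverse && pfx Q B.reverse

lemma pat_sound {P Q A B : List ℕ} {s s' : ℕ → ℕ} (h : pat P Q A B = true) (hA : SP A.reverse s)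
    (hB : SP B.reverse s') : SP P s ∧ SP Q s' := by
  rw [pat, Bool.and_eq_true] at h
  exact ⟨hA.of_prefix (pfx_iff h.1), hB.of_prefix (pfx_iff h.2)⟩

/-! ### The finite verifications -/

/-- The words that are forbidden below `j₁`, that is, all words of `F` except the self-replicating
one and its transpose. -/
def basicWords : List (List ℕ) :=
  (localWords ++ tauWords) ++ (localWords ++ tauWords).map List.reverse

/-- Common denominator of the rational bounds for `i₁` and `j₁`. -/
abbrev den : ℕ := 10 ^ 40

/-- `iNum / den` and `(iNum + 2) / den` enclose `i₁`. -/
abbrev iNum : ℕ := 38340731702358507851194238949226787206938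

/-- `jNum / den` and `(jNum + 2) / den` enclose `j₁`. -/
abbrev jNum : ℕ := 38340731702358672264867676028950628645224

/-- The part of `22221 w 11122` to the left of the central letter, read from right to left. -/
abbrev selfL : List ℕ := [2, 2, 1, 1, 1, 1, 2, 2, 2, 2]

/-- The part of `22221 w 11122` to the right of the central letter. -/
abbrev selfR : List ℕ := [2, 2, 2, 2, 1, 1, 1, 1, 2, 2]

/-- The nonperiodic part of `seqI` to the left of position `0`, read from right to left. -/
abbrev iLeft : List ℕ := [2, 2, 1, 1, 1, 1, 2, 2, 2, 1, 1, 2, 3, 2, 1, 1, 1, 1, 1, 1, 1, 1, 2, 3,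
  2, 3, 2, 1]

/-- The nonperiodic part of `seqI` to the right of position `0`. -/
abbrev iRight : List ℕ := [2, 2, 2, 2, 1, 1, 1, 1, 2, 3, 2, 1, 2, 1, 1, 1, 1, 1, 1, 1, 1, 1, 2, 3,
  2, 3, 2, 1]

/-- The leaves of the search for the positions with `λ > i₁`. The last two patterns are the
centre of `seqI` and its transpose; there `i₁` is the exact maximum, so that no rational bound can
close the branch. -/
def leafI (A B : List ℕ) : Bool :=
  hiOK iNum den A B || (pat selfL selfR A B || (pat selfR selfL A B ||
    (pat iLeft iRight A B || pat iRight iLeft A B)))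

/-- Extensions on both sides in turn. -/
def alt (n : ℕ) : Bool := Nat.beq (n % 2) 0

/-- Some letter `3` of the word has `λ ≥ j₁`. -/
def leafBig (A B : List ℕ) : Bool := anyLo (jNum + 2) den [] (A ++ 3 :: B.reverse)

/-- The nonperiodic part of `seqJ` to the left of position `0`, read from right to left. -/
abbrev jLeft : List ℕ := [2, 2, 1, 1, 1, 1, 2, 2, 2, 2, 3, 2, 2, 1, 1, 1, 1, 2, 2, 2, 2, 3, 2, 2, 1,
  1, 1, 1, 2, 2, 2, 1, 1, 2, 1, 2, 1, 2, 3, 2, 3, 2, 1]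

/-- The nonperiodic part of `seqJ` to the right of position `0`. -/
abbrev jRight : List ℕ := [2, 2, 2, 2, 1, 1, 1, 1, 2, 2, 3, 2, 2, 2, 2, 1, 1, 1, 1, 2, 1]

/-- The leaves of the search for the continuations of `22221 w 11122` to the right. The last pattern
is the centre of `seqJ`, where `j₁` is the exact minimum. -/
def leafRight (A B : List ℕ) : Bool :=
  leafBig A B || (pat [] selfWord A B || pat jLeft jRight A B)

/-- The leaves of the search for the continuations of `22221 w w w 11122` to the left. -/
def leafLeft (A B : List ℕ) : Bool :=
  leafBig A B || (pat (u ++ w ++ wL).reverse [] A B || pat (selfWord.take 16 ++ wL).reverse [] A B)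

set_option maxRecDepth 100000 in
lemma srch_leafI : srch (trie basicWords) leafI alt 60 [] [] = true := by decide +kernel

lemma srch_13 : srch .none leafBig alt 16 [1] [] = true := by decide +kernel

set_option maxRecDepth 100000 in
lemma srch_basicWords : (localWords ++ tauWords).all (fun f =>
    decide (f.takeWhile (· != 3) ++ 3 :: (f.dropWhile (· != 3)).tail = f) &&
    srch (trie [[1, 3], [3, 1]]) leafBig alt 16 (f.takeWhile (· != 3))
      (f.dropWhile (· != 3)).tail.reverse) = true := by decide +kernel

set_option maxRecDepth 100000 in
lemma srch_leafRight : srch (trie basicWords) leafRight alt 80 selfL.reverse selfR.reverse =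
    true := by
  decide +kernel

set_option maxRecDepth 100000 in
lemma srch_leafLeft : srch (trie basicWords) leafLeft (fun _ => true) 60 selfL.reverse
    (wR.tail ++ w ++ w ++ wL).reverse = true := by
  decide +kernel

/-! ### Prefixed and periodic sequences -/

lemma pre_nil (s : ℕ → ℕ) : pre [] s = s := by
  funext n
  simp [pre]

lemma tl_pre_cons (x : ℕ) (v : List ℕ) (s : ℕ → ℕ) : tl (pre (x :: v) s) = pre v s := by
  funext n
  simp [tl, pre]

lemma pre_cons_zero (x : ℕ) (v : List ℕ) (s : ℕ → ℕ) : pre (x :: v) s 0 = x := by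
  simp [pre]

lemma pre_lt {v : List ℕ} {s : ℕ → ℕ} {n : ℕ} (h : n < v.length) : pre v s n = v[n] := by
  simp [pre, h]

lemma pre_add (v : List ℕ) (s : ℕ → ℕ) (n : ℕ) : pre v s (v.length + n) = s n := by
  simp [pre]

lemma SP_pre (v : List ℕ) (s : ℕ → ℕ) : SP v (pre v s) := fun _ hi => pre_lt hi

lemma SP_pre_append {v l : List ℕ} {s : ℕ → ℕ} : SP (v ++ l) (pre v s) ↔ SP l s := by
  rw [SP_append]
  simp only [pre_add]
  exact ⟨fun h => h.2, fun h => ⟨SP_pre v s, h⟩⟩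

lemma SP_range_map (s : ℕ → ℕ) (n : ℕ) : SP ((List.range n).map s) s := by
  intro i hi
  simp

lemma eq_pre_of_SP {v : List ℕ} {s : ℕ → ℕ} (h : SP v s) :
    s = pre v (fun n => s (v.length + n)) := by
  funext n
  by_cases hn : n < v.length
  · rw [pre_lt hn, h n hn]
  · obtain ⟨m, rfl⟩ := Nat.exists_eq_add_of_le (not_lt.1 hn)
    rw [pre_add]

lemma pre_append (v l : List ℕ) (s : ℕ → ℕ) : pre (v ++ l) s = pre v (pre l s) := by
  refine (eq_pre_of_SP (SP_append.1 (SP_pre (v ++ l) s)).1).trans ?_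
  congr 1
  refine (eq_pre_of_SP (SP_append.1 (SP_pre (v ++ l) s)).2).trans ?_
  congr 1
  funext n
  rw [← add_assoc, ← List.length_append, pre_add]

lemma Nice.pre {v : List ℕ} {s : ℕ → ℕ} (hv : Letters123 v) (hs : Nice s) : Nice (pre v s) := by
  intro n
  by_cases hn : n < v.length
  · rw [pre_lt hn]
    exact hv _ (List.getElem_mem hn)
  · obtain ⟨m, rfl⟩ := Nat.exists_eq_add_of_le (not_lt.1 hn)
    rw [pre_add]
    exact hs m

lemma per_nice {v : List ℕ} (hv : Letters123 v) (h0 : v ≠ []) : Nice (per v) := by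
  intro n
  have : n % v.length < v.length := Nat.mod_lt _ (List.length_pos_iff.2 h0)
  simp only [per, List.getD_eq_getElem _ _ this]
  exact hv _ (List.getElem_mem _)

lemma per_add (v : List ℕ) (n : ℕ) : per v (v.length + n) = per v n := by
  simp [per]

lemma pre_per (v : List ℕ) : pre v (per v) = per v := by
  have h : SP v (per v) := fun i hi => by simp [per, Nat.mod_eq_of_lt hi, hi]
  conv_rhs => rw [eq_pre_of_SP h]
  simp only [per_add]

lemma pre_pos {v : List ℕ} {s : ℕ → ℕ} (hv : ∀ x ∈ v, 0 < x) (hs : ∀ i, 0 < s i) (i : ℕ) :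
    0 < pre v s i := by
  by_cases hn : i < v.length
  · rw [pre_lt hn]
    exact hv _ (List.getElem_mem hn)
  · obtain ⟨m, rfl⟩ := Nat.exists_eq_add_of_le (not_lt.1 hn)
    rw [pre_add]
    exact hs m

/-- A common prefix preserves or reverses the order of the values, according to the parity of its
length. -/
lemma infCF_pre_le : ∀ (v : List ℕ) {s s' : ℕ → ℕ}, (∀ x ∈ v, 0 < x) → (∀ i, 0 < s i) →
    (∀ i, 0 < s' i) → infCF s ≤ infCF s' →
    (Even v.length → infCF (pre v s) ≤ infCF (pre v s')) ∧
      (¬ Even v.length → infCF (pre v s') ≤ infCF (pre v s))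
  | [], s, s', _, _, _, h => by simpa [pre_nil] using h
  | x :: v, s, s', hv, hs, hs', h => by
    have hv' : ∀ x ∈ v, 0 < x := fun y hy => hv y (by simp [hy])
    have ih := infCF_pre_le v hv' hs hs' h
    have hx : (0 : ℝ) < x := by exact_mod_cast hv x (by simp)
    have p1 := infCF_pos (pre_pos hv' hs)
    have p2 := infCF_pos (pre_pos hv' hs')
    rw [infCF_step (pre_pos hv hs), infCF_step (pre_pos hv hs'), tl_pre_cons, tl_pre_cons,
      pre_cons_zero, pre_cons_zero, List.length_cons, Nat.even_add_one]
    refine ⟨fun he => ?_, fun he => ?_⟩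
    · exact one_div_le_one_div_of_le (by positivity) (by linarith [ih.2 he])
    · exact one_div_le_one_div_of_le (by positivity) (by linarith [ih.1 (not_not.1 he)])

lemma lft_glue (l r : ℕ → ℕ) : lft (glue l r) 0 = l := by
  funext n
  simp only [lft]
  rw [show (0 : ℤ) - 1 - n = Int.negSucc n by rw [Int.negSucc_eq]; ring]
  rfl

lemma rgt_glue (l r : ℕ → ℕ) : rgt (glue l r) 0 = r := by
  funext n
  simp only [rgt]
  rw [show (0 : ℤ) + n = Int.ofNat n by simp]
  rfl

lemma rgt_glue_one (l r : ℕ → ℕ) : rgt (glue l r) 1 = tl r := by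
  rw [← rgt_glue l r, tl_rgt, zero_add, rgt_glue]

lemma glue_nice {l r : ℕ → ℕ} (hl : Nice l) (hr : Nice r) : BiNice (glue l r) := by
  rintro (n | n)
  · exact hr n
  · exact hl n

/-- Membership in `{1, 2, 3}` as a decidable property of words. -/
lemma letters_of_all {v : List ℕ} (h : v.all (fun d => d == 1 || d == 2 || d == 3) = true) :
    Letters123 v := by
  intro d hd
  have := List.all_eq_true.1 h d hd
  simp only [Bool.or_eq_true, beq_iff_eq] at this
  tauto

lemma nice_per12 : Nice (per [1, 2]) := per_nice (letters_of_all rfl) (by simp)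

/-! ### The endpoints of the interval -/

/-- The value `λ₀` of the sequence that defines `i₁`. -/
noncomputable def iVal : ℝ := lam seqI 0

/-- The value `λ₀` of the sequence that defines `j₁`. -/
noncomputable def jVal : ℝ := lam seqJ 0

lemma seqI_left : lft seqI 0 = pre iLeft (per [1, 2]) := lft_glue _ _

lemma seqI_right : rgt seqI 1 = pre iRight (per [1, 2]) :=
  (rgt_glue_one _ _).trans (tl_pre_cons 3 iRight _)

lemma seqJ_left : lft seqJ 0 = pre jLeft (per [1, 2]) := lft_glue _ _

lemma seqJ_right : rgt seqJ 1 = pre jRight (per [1, 2]) :=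
  (rgt_glue_one _ _).trans (tl_pre_cons 3 jRight _)

lemma seqI_nice : BiNice seqI :=
  glue_nice (nice_per12.pre (letters_of_all rfl)) (nice_per12.pre (letters_of_all rfl))

lemma seqJ_nice : BiNice seqJ :=
  glue_nice (nice_per12.pre (letters_of_all rfl)) (nice_per12.pre (letters_of_all rfl))

lemma SP_pre_per (v : List ℕ) (s : ℕ → ℕ) (n : ℕ) :
    SP (v ++ (List.range n).map s) (pre v s) := SP_pre_append.2 (SP_range_map s n)

lemma den_pos : 0 < den := by norm_num

lemma le_iVal : (iNum : ℝ) / den ≤ iVal :=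
  loOK_sound seqI_nice (k := 0) rfl den_pos
    (A := (iLeft ++ (List.range 80).map (per [1, 2])).reverse)
    (B := (iRight ++ (List.range 80).map (per [1, 2])).reverse) (by decide +kernel)
    (by rw [List.reverse_reverse, seqI_left]; exact SP_pre_per _ _ _)
    (by rw [List.reverse_reverse, zero_add, seqI_right]; exact SP_pre_per _ _ _)

lemma iVal_le : iVal ≤ ((iNum + 2 : ℕ) : ℝ) / den :=
  hiOK_sound seqI_nice (k := 0) rfl den_pos
    (A := (iLeft ++ (List.range 80).map (per [1, 2])).reverse)
    (B := (iRight ++ (List.range 80).map (per [1, 2])).reverse) (by decide +kernel)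
    (by rw [List.reverse_reverse, seqI_left]; exact SP_pre_per _ _ _)
    (by rw [List.reverse_reverse, zero_add, seqI_right]; exact SP_pre_per _ _ _)

lemma le_jVal : (jNum : ℝ) / den ≤ jVal :=
  loOK_sound seqJ_nice (k := 0) rfl den_pos
    (A := (jLeft ++ (List.range 80).map (per [1, 2])).reverse)
    (B := (jRight ++ (List.range 80).map (per [1, 2])).reverse) (by decide +kernel)
    (by rw [List.reverse_reverse, seqJ_left]; exact SP_pre_per _ _ _)
    (by rw [List.reverse_reverse, zero_add, seqJ_right]; exact SP_pre_per _ _ _)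

lemma jVal_le : jVal ≤ ((jNum + 2 : ℕ) : ℝ) / den :=
  hiOK_sound seqJ_nice (k := 0) rfl den_pos
    (A := (jLeft ++ (List.range 80).map (per [1, 2])).reverse)
    (B := (jRight ++ (List.range 80).map (per [1, 2])).reverse) (by decide +kernel)
    (by rw [List.reverse_reverse, seqJ_left]; exact SP_pre_per _ _ _)
    (by rw [List.reverse_reverse, zero_add, seqJ_right]; exact SP_pre_per _ _ _)

lemma jVal_lt : jVal < 3.84 := jVal_le.trans_lt (by norm_num)

lemma lt_iVal : 3.8 < iVal := lt_of_lt_of_le (by norm_num) le_iVal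

lemma iVal_lt_jVal : iVal < jVal :=
  iVal_le.trans_lt (lt_of_lt_of_le (by norm_num) le_jVal)

lemma BiNice.lam_le_of_ne {a : ℤ → ℕ} (ha : BiNice a) {k : ℤ} (h : a k ≠ 3) : lam a k ≤ 3.6 := by
  have h1 := (ha.lft k).infCF_mem.2
  have h2 := (ha.rgt (k + 1)).infCF_mem.2
  have h3 : (a k : ℝ) ≤ 2 := by rcases ha k with e | e | e <;> simp_all
  rw [lam_eq]
  norm_num
  linarith

/-- All letters `3` of the word `Y`, preceded by the reversed word `X`, except the one at the
index `c`, have `λ ≤ N / D`. -/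
def allHi (N D : ℕ) : ℕ → List ℕ → List ℕ → Bool
  | _, _, [] => true
  | c, X, y :: Y => (!Nat.beq y 3 || (Nat.beq c X.length || hiOK N D X.reverse Y.reverse)) &&
      allHi N D c (y :: X) Y

lemma allHi_sound {a : ℤ → ℕ} (ha : BiNice a) {N D : ℕ} (hD : 0 < D) (c : ℕ) :
    ∀ (X Y : List ℕ) (k : ℤ), allHi N D c X Y = true → SP X (lft a k) → At Y a k →
      ∀ i < Y.length, X.length + i ≠ c → a (k + i) = 3 → lam a (k + i) ≤ (N : ℝ) / D
  | _, [], _, _, _, _ => by simp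
  | X, y :: Y, k, h, hX, hY => by
    rw [allHi, Bool.and_eq_true, Bool.or_eq_true, Bool.or_eq_true] at h
    intro i hi hc h3
    rw [At_cons] at hY
    cases i with
    | zero =>
      simp only [Nat.cast_zero, add_zero] at h3 hc ⊢
      rcases h.1 with h | h | h
      · rw [← hY.1, h3] at h
        simp at h
      · exact absurd (Nat.eq_of_beq_eq_true h).symm hc
      · exact hiOK_sound ha h3 hD h (by rwa [List.reverse_reverse])
          (by rw [List.reverse_reverse]; exact hY.2)
    | succ i =>
      have := allHi_sound ha hD c (y :: X) Y (k + 1) h.2 (by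
        rw [SP_cons]
        refine ⟨by simpa [lft] using hY.1, ?_⟩
        convert hX using 1
        funext n
        simp only [tl, lft]
        congr 1
        push_cast
        ring) hY.2 i (by simpa using hi) (by simp only [List.length_cons]; omega)
      have e : k + 1 + (i : ℤ) = k + ((i + 1 : ℕ) : ℤ) := by
        push_cast
        ring
      rw [e] at this
      exact this h3

/-- The value of a sequence with only finitely many letters `3` is attained at position `0` if a
finite check of the other letters `3` succeeds. -/
lemma lam_glue_le {L R : List ℕ} (hL : Letters123 L) (hR : Letters123 R) {N : ℕ}
    (hN : (N : ℝ) / den ≤ lam (glue (pre L (per [1, 2])) (pre (3 :: R) (per [1, 2]))) 0)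
    (h36 : 3.6 ≤ lam (glue (pre L (per [1, 2])) (pre (3 :: R) (per [1, 2]))) 0)
    (h : allHi N den L.length [] (L.reverse ++ 3 :: R) = true) (k : ℤ) :
    lam (glue (pre L (per [1, 2])) (pre (3 :: R) (per [1, 2]))) k ≤
      lam (glue (pre L (per [1, 2])) (pre (3 :: R) (per [1, 2]))) 0 := by
  set a := glue (pre L (per [1, 2])) (pre (3 :: R) (per [1, 2])) with ha
  have hn : BiNice a := glue_nice (nice_per12.pre hL) (nice_per12.pre (by
    intro d hd
    rcases List.mem_cons.1 hd with h | h
    · simp [h]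
    · exact hR d h))
  by_cases h3 : a k = 3
  swap
  · exact (hn.lam_le_of_ne h3).trans h36
  by_cases hk0 : k = 0
  · rw [hk0]
  have hper : ∀ n, per [1, 2] n ≠ 3 := by
    intro n
    have : n % 2 = 0 ∨ n % 2 = 1 := by omega
    rcases this with h | h <;> simp [per, h]
  have h1 : SP L (lft a 0) := by rw [ha, lft_glue]; exact SP_pre _ _
  have h2 : At (3 :: R) a 0 := by rw [At, ha, rgt_glue]; exact SP_pre _ _
  have hW : At (L.reverse ++ 3 :: R) a (-L.length) := by
    rw [At_append]
    refine ⟨?_, by simpa using h2⟩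
    have := (SP_reverse_lft (A := L.reverse) (a := a) (k := 0)).1 (by simpa using h1)
    simpa using this
  have hlo : -(L.length : ℤ) ≤ k := by
    by_contra hlt
    obtain ⟨n, hn⟩ : ∃ n : ℕ, k = 0 - 1 - ((L.length + n : ℕ) : ℤ) :=
      ⟨(-k - 1 - L.length).toNat, by push_cast; omega⟩
    have : lft a 0 (L.length + n) = 3 := by rw [← h3, hn]; rfl
    rw [ha, lft_glue, pre_add] at this
    exact hper _ this
  have hhi : k < (3 :: R).length := by
    by_contra hlt
    obtain ⟨n, hn⟩ : ∃ n : ℕ, k = 0 + (((3 :: R).length + n : ℕ) : ℤ) :=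
      ⟨(k - (3 :: R).length).toNat, by push_cast at hlt ⊢; omega⟩
    have : rgt a 0 ((3 :: R).length + n) = 3 := by rw [← h3, hn]; rfl
    rw [ha, rgt_glue, pre_add] at this
    exact hper _ this
  have e : k = -(L.length : ℤ) + ((k + L.length).toNat : ℤ) := by omega
  rw [e]
  refine (allHi_sound hn den_pos L.length [] _ _ h (SP_nil _) hW _ ?_ ?_ ?_).trans hN
  · simp only [List.length_append, List.length_reverse]
    omega
  · simp only [List.length_nil]
    omega
  · rw [← e, h3]

lemma markovValue_eq {a : ℤ → ℕ} {k : ℤ} (h : ∀ j, lam a j ≤ lam a k) :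
    markovValue a = (lam a k : EReal) :=
  le_antisymm (iSup_le fun j => EReal.coe_le_coe_iff.2 (h j))
    (le_iSup (fun j => (lam a j : EReal)) k)

lemma markovValue_seqI : markovValue seqI = (iVal : EReal) :=
  markovValue_eq (lam_glue_le (L := iLeft) (R := iRight) (letters_of_all rfl) (letters_of_all rfl)
    le_iVal (by have := lt_iVal; rw [iVal] at this; exact le_of_lt (lt_trans (by norm_num) this))
    (by decide +kernel))

lemma markovValue_seqJ : markovValue seqJ = (jVal : EReal) :=
  markovValue_eq (lam_glue_le (L := jLeft) (R := jRight) (letters_of_all rfl) (letters_of_all rfl)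
    le_jVal (by
      have := lt_iVal.trans iVal_lt_jVal
      rw [jVal] at this
      exact le_of_lt (lt_trans (by norm_num) this))
    (by decide +kernel))

lemma mem_intervalIJ {t : ℝ} : t ∈ intervalIJ ↔ iVal < t ∧ t < jVal := by
  rw [intervalIJ, Set.mem_ofPred_eq, markovValue_seqI, markovValue_seqJ]
  simp

/-! ### Consequences of the searches -/

/-- The self-replicating word `22221 w 11122` occurs with its central letter at position `k`. -/
def Self (a : ℤ → ℕ) (k : ℤ) : Prop := At selfWord a (k - 10)

/-- The transpose of `22221 w 11122` occurs with its central letter at position `k`. -/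
def SelfT (a : ℤ → ℕ) (k : ℤ) : Prop := At selfWord.reverse a (k - 10)

lemma self_rev {a : ℤ → ℕ} {k : ℤ} : Self (rev a) k ↔ SelfT a (-k) := by
  rw [Self, At_rev, SelfT, show -(k - 10) + 1 - (selfWord.length : ℤ) = -k - 10 by
    rw [show selfWord.length = 21 from rfl]; push_cast; ring]

lemma selfT_rev {a : ℤ → ℕ} {k : ℤ} : SelfT (rev a) k ↔ Self a (-k) := by
  rw [← rev_rev a, self_rev, rev_rev, neg_neg]

/-- An occurrence of `A 3 B` in terms of the two halves of the sequence. -/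
lemma At_centre {A B : List ℕ} {a : ℤ → ℕ} {k : ℤ} :
    At (A ++ 3 :: B) a (k - A.length) ↔
      SP A.reverse (lft a k) ∧ a k = 3 ∧ SP B (rgt a (k + 1)) := by
  rw [At_append, At_cons, SP_reverse_lft, sub_add_cancel]
  rfl

lemma self_iff {a : ℤ → ℕ} {k : ℤ} :
    Self a k ↔ SP selfL (lft a k) ∧ a k = 3 ∧ SP selfR (rgt a (k + 1)) :=
  At_centre (A := selfL.reverse) (B := selfR)

lemma selfT_iff {a : ℤ → ℕ} {k : ℤ} :
    SelfT a k ↔ SP selfR (lft a k) ∧ a k = 3 ∧ SP selfL (rgt a (k + 1)) :=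
  At_centre (A := selfR.reverse) (B := selfL)

lemma leafBig_sound {a : ℤ → ℕ} (ha : BiNice a) (hj : ∀ k, lam a k < jVal) {A B : List ℕ} {k : ℤ}
    (h3 : a k = 3) (h : leafBig A B = true) (hA : SP A.reverse (lft a k))
    (hB : SP B.reverse (rgt a (k + 1))) : False := by
  obtain ⟨j, hj'⟩ := anyLo_sound ha den_pos [] _ (k - A.length) h (SP_nil _)
    (At_centre.2 ⟨hA, h3, hB⟩)
  exact absurd (hj j) (not_lt.2 (jVal_le.trans hj'))

lemma avoids_nil (a : ℤ → ℕ) : Avoids [] a := fun f hf => absurd hf (by simp)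

/-- The words `13` and `31` do not occur below `j₁`. -/
lemma not_At_13 {a : ℤ → ℕ} (ha : BiNice a) (hj : ∀ k, lam a k < jVal) (k : ℤ) :
    ¬ At [1, 3] a k := by
  intro h
  have h' := h
  rw [At_cons, At_cons] at h'
  refine srch_sound ha h'.2.1 (avoids_nil a) (leaf := leafBig) (Q := False)
    (fun A B h hA hB => leafBig_sound ha hj h'.2.1 h hA hB) 16 [1] [] srch_13 ?_ (SP_nil _)
  exact (At_centre (A := [1]) (B := []).1 (by simpa using h)).1

lemma BiNice.avoids_13 {a : ℤ → ℕ} (ha : BiNice a) (hj : ∀ k, lam a k < jVal) :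
    Avoids [[1, 3], [3, 1]] a := by
  have h31 : ∀ k, ¬ At [3, 1] a k := by
    intro k h
    refine not_At_13 ha.rev (fun k => (lam_rev a k).trans_lt (hj _)) (-k - 1) (At_rev.2 ?_)
    rwa [show -(-k - 1) + 1 - (([1, 3] : List ℕ).length : ℤ) = k by
      rw [show ([1, 3] : List ℕ).length = 2 from rfl]; push_cast; ring]
  intro f hf j
  simp only [List.mem_cons, List.not_mem_nil, or_false] at hf
  rcases hf with rfl | rfl
  · exact ⟨not_At_13 ha hj j, h31 j⟩
  · exact ⟨h31 j, not_At_13 ha hj j⟩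

/-- Below `j₁`, none of the words of the first two lists occurs. -/
lemma BiNice.avoids_basicWords {a : ℤ → ℕ} (ha : BiNice a) (hj : ∀ k, lam a k < jVal) :
    Avoids basicWords a := by
  have key : ∀ a : ℤ → ℕ, BiNice a → (∀ k, lam a k < jVal) → ∀ f ∈ localWords ++ tauWords,
      ∀ j, ¬ At f a j := by
    intro a ha hj f hf j h
    have hc := List.all_eq_true.1 srch_basicWords f hf
    rw [Bool.and_eq_true, decide_eq_true_eq] at hc
    rw [← hc.1, show j = j + (f.takeWhile (· != 3)).length - (f.takeWhile (· != 3)).length by ring,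
      At_centre] at h
    refine srch_sound ha h.2.1 (ha.avoids_13 hj) (leaf := leafBig) (Q := False)
      (fun A B h' hA hB => leafBig_sound ha hj h.2.1 h' hA hB) _ _ _ hc.2 h.1 ?_
    rw [List.reverse_reverse]
    exact h.2.2
  have key' : ∀ f ∈ localWords ++ tauWords, ∀ j, ¬ At f.reverse a j := by
    intro f hf j h
    refine key (MarkovLagrange.rev a) ha.rev (fun k => (lam_rev a k).trans_lt (hj _)) f hf
      (-j + 1 - f.length) (At_rev.2 ?_)
    convert h using 1
    ring
  intro f hf j
  rw [basicWords, List.mem_append, List.mem_map] at hf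
  rcases hf with hf | ⟨f, hf, rfl⟩
  · exact ⟨key a ha hj f hf j, key' f hf j⟩
  · rw [List.reverse_reverse]
    exact ⟨key' f hf j, key a ha hj f hf j⟩

lemma mem_basicWords_13 : [1, 3] ∈ basicWords := by decide +kernel

lemma Avoids.not_three_rgt {a : ℤ → ℕ} (h : Avoids basicWords a) (k : ℤ) (m n : ℕ)
    (h1 : rgt a k (m + n) = 1) : rgt a k (m + (n + 1)) ≠ 3 := by
  intro h3
  refine (h _ mem_basicWords_13 (k + (m + n : ℕ))).1 ?_
  rw [At_cons, At_cons]
  refine ⟨h1, ?_, At_nil _ _⟩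
  rw [← h3, rgt]
  congr 1
  push_cast
  ring

lemma Avoids.not_three_lft {a : ℤ → ℕ} (h : Avoids basicWords a) (k : ℤ) (m n : ℕ)
    (h1 : lft a k (m + n) = 1) : lft a k (m + (n + 1)) ≠ 3 := by
  intro h3
  refine (h _ mem_basicWords_13 (k - 1 - (m + (n + 1)))).2 ?_
  show At [3, 1] a _
  rw [At_cons, At_cons]
  refine ⟨h3, ?_, At_nil _ _⟩
  rw [← h1, lft]
  congr 1
  push_cast
  ring

/-- Among the extensions of a word to the left that avoid the forbidden words, the one by
`1, 2, 1, 2, …` is extremal. -/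
lemma Avoids.lft_le {a : ℤ → ℕ} (ha : BiNice a) (h : Avoids basicWords a) {v : List ℕ}
    (hv : Letters123 v) {k : ℤ} (hs : SP v (lft a k)) :
    (Even v.length → infCF (lft a k) ≤ infCF (pre v (per [1, 2]))) ∧
      (¬ Even v.length → infCF (pre v (per [1, 2])) ≤ infCF (lft a k)) := by
  have hn : Nice (fun n => lft a k (v.length + n)) := fun n => ha.lft k _
  rw [eq_pre_of_SP hs]
  exact infCF_pre_le v (fun x hx => by rcases hv x hx with h | h | h <;> omega) hn.pos
    nice_per12.pos (hn.infCF_le_per fun n h1 => h.not_three_lft k v.length n h1)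

/-- Among the extensions of a word to the right that avoid the forbidden words, the one by
`1, 2, 1, 2, …` is extremal. -/
lemma Avoids.rgt_le {a : ℤ → ℕ} (ha : BiNice a) (h : Avoids basicWords a) {v : List ℕ}
    (hv : Letters123 v) {k : ℤ} (hs : SP v (rgt a k)) :
    (Even v.length → infCF (rgt a k) ≤ infCF (pre v (per [1, 2]))) ∧
      (¬ Even v.length → infCF (pre v (per [1, 2])) ≤ infCF (rgt a k)) := by
  have hn : Nice (fun n => rgt a k (v.length + n)) := fun n => ha.rgt k _
  rw [eq_pre_of_SP hs]
  exact infCF_pre_le v (fun x hx => by rcases hv x hx with h | h | h <;> omega) hn.pos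
    nice_per12.pos (hn.infCF_le_per fun n h1 => h.not_three_rgt k v.length n h1)

/-- If the forbidden words are avoided, then every value above `i₁` comes from the self-replicating
word or its transpose. -/
theorem lam_le_or_self {a : ℤ → ℕ} (ha : BiNice a) (h : Avoids basicWords a) (k : ℤ) :
    lam a k ≤ iVal ∨ Self a k ∨ SelfT a k := by
  by_cases h3 : a k = 3
  swap
  · exact Or.inl ((ha.lam_le_of_ne h3).trans (le_of_lt (lt_trans (by norm_num) lt_iVal)))
  have hI : iVal = 3 + infCF (pre iRight (per [1, 2])) + infCF (pre iLeft (per [1, 2])) := by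
    rw [iVal, lam_eq, zero_add, seqI_left, seqI_right]
    norm_num [seqI, glue, pre, wR]
  refine srch_sound ha h3 h (leaf := leafI) ?_ 60 [] [] srch_leafI (SP_nil _) (SP_nil _)
  intro A B hl hA hB
  rw [leafI, Bool.or_eq_true, Bool.or_eq_true, Bool.or_eq_true, Bool.or_eq_true] at hl
  rcases hl with hl | hl | hl | hl | hl
  · exact Or.inl ((hiOK_sound ha h3 den_pos hl hA hB).trans le_iVal)
  · have := pat_sound hl hA hB
    exact Or.inr (Or.inl (self_iff.2 ⟨this.1, h3, this.2⟩))
  · have := pat_sound hl hA hB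
    exact Or.inr (Or.inr (selfT_iff.2 ⟨this.1, h3, this.2⟩))
  · have := pat_sound hl hA hB
    have h1 := (h.lft_le ha (letters_of_all rfl) this.1).1 (by decide)
    have h2 := (h.rgt_le ha (letters_of_all rfl) this.2).1 (by decide)
    left
    rw [lam_eq, h3, hI]
    push_cast
    linarith
  · have := pat_sound hl hA hB
    have h1 := (h.lft_le ha (letters_of_all rfl) this.1).1 (by decide)
    have h2 := (h.rgt_le ha (letters_of_all rfl) this.2).1 (by decide)
    left
    rw [lam_eq, h3, hI]
    push_cast
    linarith

/-- Self-replication: below `j₁`, the word `22221 w 11122` reproduces itself to the right. -/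
theorem self_add {a : ℤ → ℕ} (ha : BiNice a) (hj : ∀ k, lam a k < jVal) {k : ℤ}
    (hk : Self a k) : Self a (k + 11) := by
  have h := ha.avoids_basicWords hj
  have hs := self_iff.1 hk
  refine srch_sound ha hs.2.1 h (leaf := leafRight) ?_ 80 _ _ srch_leafRight
    (by simpa using hs.1) (by simpa using hs.2.2)
  intro A B hl hA hB
  rw [leafRight, Bool.or_eq_true, Bool.or_eq_true] at hl
  rcases hl with hl | hl | hl
  · exact (leafBig_sound ha hj hs.2.1 hl hA hB).elim
  · rw [Self, show k + 11 - 10 = k + 1 by ring]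
    exact (pat_sound hl hA hB).2
  · have := pat_sound hl hA hB
    have h1 := (h.lft_le ha (letters_of_all rfl) this.1).2 (by decide)
    have h2 := (h.rgt_le ha (letters_of_all rfl) this.2).2 (by decide)
    have hJ : jVal = 3 + infCF (pre jRight (per [1, 2])) + infCF (pre jLeft (per [1, 2])) := by
      rw [jVal, lam_eq, zero_add, seqJ_left, seqJ_right]
      norm_num [seqJ, glue, pre, wR]
    have h4 := hj k
    rw [lam_eq, hs.2.1, hJ] at h4
    push_cast at h4
    linarith

/-- A chain of self-replicating words is the periodic word. -/
lemma rgt_eq_per_of_self {a : ℤ → ℕ} {k : ℤ} (h : ∀ m : ℕ, Self a (k + 11 * m)) :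
    rgt a (k - 5) = per w := by
  funext n
  have hr : n % 11 < 11 := Nat.mod_lt _ (by norm_num)
  have h1 := (h (n / 11)).apply (5 + n % 11) (by rw [show selfWord.length = 21 from rfl]; omega)
  have key : ∀ r < 11, selfWord.getD (5 + r) 0 = w.getD r 0 := by decide
  rw [← List.getD_eq_getElem _ 0, key _ hr] at h1
  rw [per, show w.length = 11 from rfl, ← h1, rgt]
  congr 1
  push_cast
  omega

lemma rgt_of_per {a : ℤ → ℕ} {k : ℤ} (h : rgt a (k - 5) = per w) (i : ℕ) :
    rgt a (k - 5 + i) = fun n => per w (i + n) := by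
  rw [← h, ← rgt_add]

lemma self_chain {a : ℤ → ℕ} (ha : BiNice a) (hj : ∀ k, lam a k < jVal) {k : ℤ}
    (hk : Self a k) (m : ℕ) : Self a (k + 11 * m) := by
  induction m with
  | zero => simpa using hk
  | succ m ih =>
    have := self_add ha hj ih
    rwa [show k + 11 * (m : ℤ) + 11 = k + 11 * ((m + 1 : ℕ) : ℤ) by push_cast; ring] at this

/-- Below `j₁`, the first word `w` of a chain is preceded by `u`. -/
theorem self_sub {a : ℤ → ℕ} (ha : BiNice a) (hj : ∀ k, lam a k < jVal) {k : ℤ}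
    (hk : Self a k) : Self a (k - 11) ∨ At (u ++ w ++ w) a (k - 27) := by
  have h := ha.avoids_basicWords hj
  have hs := self_iff.1 hk
  have hper := rgt_eq_per_of_self (self_chain ha hj hk)
  refine srch_sound ha hs.2.1 h (leaf := leafLeft) ?_ 60 _ _ srch_leafLeft
    (by simpa using hs.1) ?_
  · intro A B hl hA hB
    rw [leafLeft, Bool.or_eq_true, Bool.or_eq_true] at hl
    rcases hl with hl | hl | hl
    · exact (leafBig_sound ha hj hs.2.1 hl hA hB).elim
    · right
      have h1 := SP_reverse_lft.1 (pat_sound hl hA hB).1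
      rw [At_append] at h1 ⊢
      refine ⟨h1.1, ?_⟩
      rw [show k - 27 + ((u ++ w).length : ℤ) = k - 5 by
        rw [show (u ++ w).length = 22 from rfl]; push_cast; ring, At, hper]
      decide +kernel
    · left
      have h1 := SP_reverse_lft.1 (pat_sound hl hA hB).1
      rw [Self, show k - 11 - 10 = k - ((selfWord.take 16 ++ wL).length : ℤ) by
        rw [show (selfWord.take 16 ++ wL).length = 21 from rfl]; push_cast; ring]
      exact h1
  · rw [List.reverse_reverse, show k + 1 = k - 5 + (6 : ℕ) by push_cast; ring, rgt_of_per hper]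
    decide +kernel

/-- A chain of words `w` that starts after `u` has its value in the interval `(i₁, j₁)`. -/
lemma lam_mem_of_chain {a : ℤ → ℕ} (ha : BiNice a) {k : ℤ} (hu : At (u ++ w ++ w) a (k - 27))
    (hper : rgt a (k - 5) = per w) : iVal < lam a k ∧ lam a k < jVal := by
  have h3 : a k = 3 := by
    have := congrFun hper 5
    simp only [rgt] at this
    rwa [show k - 5 + ((5 : ℕ) : ℤ) = k by push_cast; ring, show per w 5 = 3 from rfl] at this
  have hl : SP (u ++ w ++ wL).reverse.reverse.reverse (lft a k) := by
    rw [List.reverse_reverse, SP_reverse_lft]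
    rw [show u ++ w ++ w = (u ++ w ++ wL) ++ wR by simp [w], At_append] at hu
    exact hu.1
  have hr : SP (wR.tail ++ w ++ w ++ w ++ w).reverse.reverse (rgt a (k + 1)) := by
    rw [List.reverse_reverse, show k + 1 = k - 5 + (6 : ℕ) by push_cast; ring, rgt_of_per hper]
    decide +kernel
  refine ⟨iVal_le.trans_lt (lt_of_lt_of_le ?_ (loOK_sound ha h3 (N := iNum + 3) den_pos
      (A := (u ++ w ++ wL)) (by decide +kernel) (by rwa [List.reverse_reverse] at hl) hr)),
    lt_of_lt_of_le (lt_of_le_of_lt (hiOK_sound ha h3 (N := jNum - 1) den_pos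
      (A := (u ++ w ++ wL)) (by decide +kernel) (by rwa [List.reverse_reverse] at hl) hr) ?_)
        le_jVal⟩ <;> norm_num

/-- In the middle of a chain, the value is below `i₁`. -/
lemma lam_lt_of_mid_chain {a : ℤ → ℕ} (ha : BiNice a) {k : ℤ}
    (hper : rgt a (k - 27) = per w) : lam a k < iVal := by
  have h3 : a k = 3 := by
    have := congrFun hper 27
    simp only [rgt] at this
    rwa [show k - 27 + ((27 : ℕ) : ℤ) = k by push_cast; ring, show per w 27 = 3 from rfl] at this
  have hl : SP (w ++ w ++ wL).reverse (lft a k) := by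
    rw [SP_reverse_lft, At]
    rw [show k - ((w ++ w ++ wL).length : ℤ) = k - 27 from rfl, hper]
    decide +kernel
  have hr : SP (wR.tail ++ w ++ w).reverse.reverse (rgt a (k + 1)) := by
    rw [List.reverse_reverse, show k + 1 = k - 27 + (28 : ℕ) by push_cast; ring, ← rgt_add, hper]
    decide +kernel
  refine lt_of_le_of_lt (hiOK_sound ha h3 (N := iNum - 1) den_pos (A := (w ++ w ++ wL))
    (by decide +kernel) hl hr) (lt_of_lt_of_le ?_ le_iVal)
  norm_num

/-! ### Limits of shifted sequences -/

lemma tendsto_infCF_of_eventually {ι : Type*} {G : Filter ι} {x : ι → ℕ → ℕ} {s : ℕ → ℕ}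
    (hx : ∀ n i, 0 < x n i) (hs : ∀ i, 0 < s i) (h : ∀ i, ∀ᶠ n in G, x n i = s i) :
    Tendsto (fun n => infCF (x n)) G (𝓝 (infCF s)) := by
  rw [Metric.tendsto_nhds]
  intro ε hε
  obtain ⟨N, hN⟩ := exists_pow_lt_of_lt_one hε (show (1 / 4 : ℝ) < 1 by norm_num)
  have : ∀ᶠ n in G, ∀ i ∈ Finset.range (2 * N), x n i = s i :=
    (Filter.eventually_all_finset _).2 fun i _ => h i
  filter_upwards [this] with n hn
  rw [Real.dist_eq]
  exact (abs_infCF_sub_le (hx n) hs N fun i hi => hn i (Finset.mem_range.2 hi)).trans_lt hN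

lemma tendsto_lam {ι : Type*} {G : Filter ι} {x : ι → ℤ → ℕ} {a : ℤ → ℕ}
    (hx : ∀ n i, 0 < x n i) (ha : ∀ i, 0 < a i) (h : ∀ i, ∀ᶠ n in G, x n i = a i) (k : ℤ) :
    Tendsto (fun n => lam (x n) k) G (𝓝 (lam a k)) := by
  simp only [lam_eq]
  refine (Tendsto.add ?_ ?_).add ?_
  · refine tendsto_nhds_of_eventually_eq ?_
    filter_upwards [h k] with n hn
    rw [hn]
  · exact tendsto_infCF_of_eventually (fun n i => hx n _) (fun i => ha _) fun i => h _
  · exact tendsto_infCF_of_eventually (fun n i => hx n _) (fun i => ha _) fun i => h _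

lemma At_eventually_iff {ι : Type*} {G : Filter ι} {x : ι → ℤ → ℕ} {a : ℤ → ℕ}
    (h : ∀ i, ∀ᶠ n in G, x n i = a i) (v : List ℕ) (k : ℤ) :
    ∀ᶠ n in G, (At v (x n) k ↔ At v a k) := by
  have : ∀ᶠ n in G, ∀ i ∈ Finset.range v.length, x n (k + i) = a (k + i) :=
    (Filter.eventually_all_finset _).2 fun i _ => h _
  filter_upwards [this] with n hn
  refine forall_congr' fun i => forall_congr' fun hi => ?_
  simp only [rgt]
  rw [hn i (Finset.mem_range.2 hi)]

lemma BiNice.pos {a : ℤ → ℕ} (h : BiNice a) (k : ℤ) : 0 < a k := by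
  rcases h k with h | h | h <;> omega

lemma exists_subseq_limit {x : ℕ → ℤ → ℕ}
    (h : ∀ k, ∀ᶠ n in atTop, x n k = 1 ∨ x n k = 2 ∨ x n k = 3) :
    ∃ a, BiNice a ∧ ∃ φ : ℕ → ℕ, StrictMono φ ∧ ∀ k, ∀ᶠ n in atTop, x (φ n) k = a k := by
  classical
  set y : ℕ → ℤ → ℕ := fun n k => if x n k = 1 ∨ x n k = 2 ∨ x n k = 3 then x n k else 1 with hy
  have hc : IsCompact (Set.pi Set.univ fun _ : ℤ => ({1, 2, 3} : Set ℕ)) :=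
    isCompact_univ_pi fun _ => (Set.toFinite _).isCompact
  have hmem : ∀ n, y n ∈ Set.pi Set.univ fun _ : ℤ => ({1, 2, 3} : Set ℕ) := by
    intro n k _
    simp only [hy]
    split_ifs with hk
    · simpa using hk
    · simp
  obtain ⟨a, ha, φ, hφ, hlim⟩ := hc.tendsto_subseq hmem
  refine ⟨a, fun k => by simpa using ha k trivial, φ, hφ, fun k => ?_⟩
  have h1 := (tendsto_pi_nhds.1 hlim) k
  rw [nhds_discrete, tendsto_pure] at h1
  filter_upwards [h1, hφ.tendsto_atTop.eventually (h k)] with n hn hk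
  rw [← hn]
  simp [hy, hk]

/-- Shifts of a sequence whose relevant letters are eventually `1`, `2` or `3` accumulate at some
sequence. -/
lemma exists_shift_limit {a₀ : ℤ → ℕ} (h0 : ∀ k, 0 < a₀ k) {κ : ℕ → ℤ}
    (h : ∀ k, ∀ᶠ n in atTop, a₀ (κ n + k) = 1 ∨ a₀ (κ n + k) = 2 ∨ a₀ (κ n + k) = 3) :
    ∃ a, BiNice a ∧ ∃ φ : ℕ → ℕ, StrictMono φ ∧
      (∀ k, Tendsto (fun n => lam a₀ (κ (φ n) + k)) atTop (𝓝 (lam a k))) ∧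
      ∀ v k, ∀ᶠ n in atTop, (At v a₀ (κ (φ n) + k) ↔ At v a k) := by
  obtain ⟨a, ha, φ, hφ, hlim⟩ := exists_subseq_limit (x := fun n => shift a₀ (κ n)) h
  refine ⟨a, ha, φ, hφ, fun k => ?_, fun v k => ?_⟩
  · have := tendsto_lam (x := fun n => shift a₀ (κ (φ n))) (fun n i => h0 _) ha.pos hlim k
    simpa only [lam_shift] using this
  · simpa only [At_shift] using At_eventually_iff (x := fun n => shift a₀ (κ (φ n))) hlim v k

lemma cast_le_lam {a : ℤ → ℕ} (h : ∀ k, 0 < a k) (k : ℤ) : (a k : ℝ) ≤ lam a k := by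
  have h1 := infCF_pos (s := rgt a (k + 1)) fun i => h _
  have h2 := infCF_pos (s := lft a k) fun i => h _
  rw [lam_eq]
  linarith

lemma letter_of_lam_lt {a : ℤ → ℕ} (h : ∀ k, 0 < a k) {k : ℤ} (hk : lam a k < jVal) :
    a k = 1 ∨ a k = 2 ∨ a k = 3 := by
  have h1 := cast_le_lam h k
  have h2 := jVal_lt
  have h3 : (a k : ℝ) < (4 : ℕ) := by push_cast; linarith
  have h4 : a k < 4 := by exact_mod_cast h3
  have := h k
  omega

/-! ### Markov and Lagrange values in the interval -/

/-- The Markov value of `a` is `t`, and it is attained at some position. -/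
structure Realizes (a : ℤ → ℕ) (t : ℝ) : Prop where
  nice : BiNice a
  le : ∀ k, lam a k ≤ t
  att : ∃ k, lam a k = t

lemma Realizes.mem {a : ℤ → ℕ} {t : ℝ} (h : Realizes a t) : t ∈ markovSpectrum := by
  obtain ⟨k, hk⟩ := h.att
  exact ⟨a, h.nice.pos, by rw [markovValue_eq (k := k) (fun j => (h.le j).trans hk.ge), hk]⟩

lemma Realizes.rev {a : ℤ → ℕ} {t : ℝ} (h : Realizes a t) : Realizes (rev a) t := by
  obtain ⟨k, hk⟩ := h.att
  exact ⟨h.nice.rev, fun j => (lam_rev a j).trans_le (h.le _), -k, by rw [lam_rev, neg_neg, hk]⟩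

lemma Realizes.shift {a : ℤ → ℕ} {t : ℝ} (h : Realizes a t) (m : ℤ) : Realizes (shift a m) t := by
  obtain ⟨k, hk⟩ := h.att
  refine ⟨fun j => h.nice _, fun j => (lam_shift a m j).trans_le (h.le _), k - m, ?_⟩
  rw [lam_shift, add_sub_cancel, hk]

/-- Markov values below `j₁` are attained, after passing to a limit of shifts. -/
lemma exists_realizes {t : ℝ} (ht : t ∈ markovSpectrum) (hj : t < jVal) :
    ∃ a, Realizes a t ∧ lam a 0 = t := by
  obtain ⟨a₀, h0, hm⟩ := ht
  have hle : ∀ k, lam a₀ k ≤ t := by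
    intro k
    rw [← EReal.coe_le_coe_iff, ← hm]
    exact le_iSup (fun k => (lam a₀ k : EReal)) k
  have hgt : ∀ n : ℕ, ∃ k, t - 1 / ((n : ℝ) + 1) < lam a₀ k := by
    intro n
    have : ((t - 1 / ((n : ℝ) + 1) : ℝ) : EReal) < markovValue a₀ := by
      rw [hm, EReal.coe_lt_coe_iff]
      have : 0 < 1 / ((n : ℝ) + 1) := by positivity
      linarith
    obtain ⟨k, hk⟩ := lt_iSup_iff.1 this
    exact ⟨k, EReal.coe_lt_coe_iff.1 hk⟩
  choose κ hκ using hgt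
  obtain ⟨a, ha, φ, hφ, hlam, -⟩ := exists_shift_limit h0 (κ := κ) fun k =>
    Eventually.of_forall fun n => letter_of_lam_lt h0 ((hle _).trans_lt hj)
  have h1 : Tendsto (fun n => lam a₀ (κ (φ n))) atTop (𝓝 t) := by
    refine tendsto_of_tendsto_of_tendsto_of_le_of_le (g := fun n : ℕ => t - 1 / ((n : ℝ) + 1))
      (h := fun _ => t) ?_ tendsto_const_nhds (fun n => ?_) fun n => hle _
    · simpa using tendsto_const_nhds.sub (tendsto_one_div_add_atTop_nhds_zero_nat (𝕜 := ℝ))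
    · refine le_trans ?_ (hκ (φ n)).le
      have : (n : ℝ) ≤ φ n := by exact_mod_cast hφ.id_le n
      have := one_div_le_one_div_of_le (by positivity) (by linarith : (n : ℝ) + 1 ≤ φ n + 1)
      linarith
  have h2 : lam a 0 = t := tendsto_nhds_unique (by simpa using hlam 0) h1
  exact ⟨a, ⟨ha, fun k => le_of_tendsto (hlam k) (Eventually.of_forall fun n => hle _), 0, h2⟩, h2⟩

lemma three_not_mem_u : ∀ i (h : i < u.length), u[i] ≠ 3 := by decide

lemma At_u_ne_three {a : ℤ → ℕ} {k : ℤ} (h : At u a k) {j : ℤ} (h1 : k ≤ j) (h2 : j < k + 11) :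
    a j ≠ 3 := by
  have hi : (j - k).toNat < u.length := by
    rw [show u.length = 11 from rfl]
    omega
  have := h.apply _ hi
  rw [show k + ((j - k).toNat : ℤ) = j by omega] at this
  rw [this]
  exact three_not_mem_u _ hi

lemma At_u_rev_ne_three {a : ℤ → ℕ} {k : ℤ} (h : At u.reverse a k) {j : ℤ} (h1 : k ≤ j)
    (h2 : j < k + 11) : a j ≠ 3 := by
  have : At u (rev a) (-k + 1 - 11) := by
    rw [At_rev]
    convert h using 1
    rw [show u.length = 11 from rfl]
    push_cast
    ring
  have := At_u_ne_three this (j := -j) (by omega) (by omega)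
  simpa [rev] using this

/-- If `i₁ < t < j₁` is the Markov value of `a` and the self-replicating word occurs, then there is
a first occurrence, and it is preceded by `u w`. -/
lemma Realizes.exists_first {a : ℤ → ℕ} {t : ℝ} (h : Realizes a t) (hi : iVal < t) (hj : t < jVal)
    {k : ℤ} (hk : Self a k) :
    ∃ m : ℕ, Self a (k - 11 * m) ∧ At (u ++ w ++ w) a (k - 11 * m - 27) := by
  have hlt : ∀ k, lam a k < jVal := fun k => (h.le k).trans_lt hj
  by_contra hcon
  push Not at hcon
  have hall : ∀ m : ℕ, Self a (k - 11 * m) := by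
    intro m
    induction m with
    | zero => simpa using hk
    | succ m ih =>
      rcases self_sub h.nice hlt ih with h' | h'
      · rwa [show k - 11 * (m : ℤ) - 11 = k - 11 * ((m + 1 : ℕ) : ℤ) by push_cast; ring] at h'
      · exact absurd h' (hcon m ih)
  have hall' : ∀ j : ℤ, Self a (k + 11 * j) := by
    intro j
    rcases le_total 0 j with hj' | hj'
    · lift j to ℕ using hj'
      exact self_chain h.nice hlt hk j
    · have := hall (-j).toNat
      rwa [show k - 11 * ((-j).toNat : ℤ) = k + 11 * j by omega] at this
  have hper : ∀ j : ℤ, rgt a (k + 11 * j - 5) = per w := fun j =>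
    rgt_eq_per_of_self fun m => by
      rw [show k + 11 * j + 11 * (m : ℤ) = k + 11 * (j + m) by ring]
      exact hall' _
  obtain ⟨p, hp⟩ := h.att
  -- the letter at `p` has index `r` in its word `w`
  obtain ⟨j, r, hr, hpr⟩ : ∃ j : ℤ, ∃ r : ℕ, r < 11 ∧ p = k + 11 * j - 5 + r :=
    ⟨(p - k + 5) / 11, ((p - k + 5) % 11).toNat, by omega, by omega⟩
  have hap : ∀ i : ℕ, a (p + i) = per w (r + i) := by
    intro i
    rw [← hper j, rgt, hpr]
    congr 1
    push_cast
    ring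
  have h5 : p = k + 11 * j → False := by
    intro hpk
    have := lam_lt_of_mid_chain h.nice (k := p) (by
      rw [hpk, show k + 11 * j - 27 = k + 11 * (j - 2) - 5 by ring]
      exact hper _)
    linarith
  rcases lam_le_or_self h.nice (h.nice.avoids_basicWords hlt) p with h' | h' | h'
  · linarith
  · have h3 := (self_iff.1 h').2.1
    have := hap 0
    simp only [Nat.cast_zero, add_zero, h3] at this
    have key : ∀ r < 11, 3 = per w r → r = 5 := by decide
    have := key r hr this
    exact h5 (by rw [hpr, this]; push_cast; ring)
  · have h3 := (selfT_iff.1 h').2.1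
    have := hap 0
    simp only [Nat.cast_zero, add_zero, h3] at this
    have key : ∀ r < 11, 3 = per w r → r = 5 := by decide
    have := key r hr this
    exact h5 (by rw [hpr, this]; push_cast; ring)

/-- No Lagrange value lies in the interval: infinitely many occurrences of the self-replicating
word would make the sequence eventually periodic. -/
theorem not_mem_lagrangeSpectrum {t : ℝ} (hi : iVal < t) (hj : t < jVal) :
    t ∉ lagrangeSpectrum := by
  rintro ⟨a₀, h0, hl⟩
  have hev : ∀ r : ℝ, t < r → ∀ᶠ k : ℤ in atTop, lam a₀ k < r := by
    intro r hr
    have : Filter.limsup (fun k : ℤ => (lam a₀ k : EReal)) atTop < (r : EReal) := by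
      rw [show Filter.limsup (fun k : ℤ => (lam a₀ k : EReal)) atTop = t from hl]
      exact EReal.coe_lt_coe_iff.2 hr
    filter_upwards [Filter.eventually_lt_of_limsup_lt this] with k hk
    exact EReal.coe_lt_coe_iff.1 hk
  have hfr : ∀ r : ℝ, r < t → ∃ᶠ k : ℤ in atTop, r < lam a₀ k := by
    intro r hr
    have : (r : EReal) < Filter.limsup (fun k : ℤ => (lam a₀ k : EReal)) atTop := by
      rw [show Filter.limsup (fun k : ℤ => (lam a₀ k : EReal)) atTop = t from hl]
      exact EReal.coe_lt_coe_iff.2 hr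
    exact (Filter.frequently_lt_of_lt_limsup (by isBoundedDefault) this).mono fun k hk =>
      EReal.coe_lt_coe_iff.1 hk
  -- every sequence of shifts going to infinity accumulates at a sequence bounded by `t`
  have hlimit : ∀ κ : ℕ → ℤ, Tendsto κ atTop atTop → ∃ a, BiNice a ∧ (∀ k, lam a k ≤ t) ∧
      ∃ φ : ℕ → ℕ, StrictMono φ ∧
      (∀ k, Tendsto (fun n => lam a₀ (κ (φ n) + k)) atTop (𝓝 (lam a k))) ∧
      ∀ v k, ∀ᶠ n in atTop, (At v a₀ (κ (φ n) + k) ↔ At v a k) := by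
    intro κ hκ
    obtain ⟨a, ha, φ, hφ, hlam, hat⟩ := exists_shift_limit h0 (κ := κ) fun k => by
      have := (tendsto_atTop_add_const_right _ k hκ).eventually (hev _ hj)
      filter_upwards [this] with n hn
      exact letter_of_lam_lt h0 hn
    refine ⟨a, ha, fun k => ?_, φ, hφ, hlam, hat⟩
    refine le_of_forall_gt_imp_ge_of_dense fun r hr => le_of_tendsto (hlam k) ?_
    have := (tendsto_atTop_add_const_right _ k (hκ.comp hφ.tendsto_atTop)).eventually (hev _ hr)
    filter_upwards [this] with n hn
    exact hn.le
  -- the self-replication holds from some position on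
  have hself : ∃ K : ℤ, ∀ k ≥ K, Self a₀ k → Self a₀ (k + 11) := by
    by_contra hcon
    push Not at hcon
    choose κ hκ using fun n : ℕ => hcon n
    obtain ⟨a, ha, hle, φ, hφ, -, hat⟩ := hlimit κ
      (tendsto_atTop_mono (fun n => (hκ n).1) tendsto_natCast_atTop_atTop)
    obtain ⟨n, h1, h2⟩ := ((hat selfWord (-10)).and (hat selfWord 1)).exists
    have e1 : Self a 0 := h1.1 (hκ (φ n)).2.1
    have e2 := self_add ha (fun k => (hle k).trans_lt hj) e1
    refine (hκ (φ n)).2.2 ?_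
    have := h2.2 e2
    rwa [show κ (φ n) + 1 = κ (φ n) + 11 - 10 by ring] at this
  have hselfT : ∃ K : ℤ, ∀ k ≥ K, SelfT a₀ k → SelfT a₀ (k - 11) := by
    by_contra hcon
    push Not at hcon
    choose κ hκ using fun n : ℕ => hcon n
    obtain ⟨a, ha, hle, φ, hφ, -, hat⟩ := hlimit κ
      (tendsto_atTop_mono (fun n => (hκ n).1) tendsto_natCast_atTop_atTop)
    obtain ⟨n, h1, h2⟩ := ((hat selfWord.reverse (-10)).and (hat selfWord.reverse (-21))).exists
    have e1 : SelfT a 0 := h1.1 (hκ (φ n)).2.1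
    have e2 : Self (rev a) (0 + 11) := self_add ha.rev
      (fun k => (lam_rev a k).trans_lt ((hle _).trans_lt hj)) (self_rev.2 (by simpa using e1))
    rw [self_rev] at e2
    refine (hκ (φ n)).2.2 ?_
    have := h2.2 e2
    rwa [show κ (φ n) + -21 = κ (φ n) - 11 - 10 by ring] at this
  obtain ⟨K, hK⟩ := hself
  obtain ⟨K', hK'⟩ := hselfT
  -- a limit that realizes `t`
  have hex : ∀ n : ℕ, ∃ k : ℤ, (n : ℤ) ≤ k ∧ t - 1 / ((n : ℝ) + 1) < lam a₀ k := by
    intro n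
    have : t - 1 / ((n : ℝ) + 1) < t := by
      have : 0 < 1 / ((n : ℝ) + 1) := by positivity
      linarith
    obtain ⟨k, hk1, hk2⟩ := ((hfr _ this).and_eventually (eventually_ge_atTop (n : ℤ))).exists
    exact ⟨k, hk2, hk1⟩
  choose κ hκ using hex
  have hκt := tendsto_atTop_mono (fun n => (hκ n).1) (tendsto_natCast_atTop_atTop (R := ℤ))
  obtain ⟨a, ha, hle, φ, hφ, hlam, hat⟩ := hlimit κ hκt
  have h2 : t ≤ lam a 0 := by
    have h3 : Tendsto (fun n : ℕ => t - 1 / ((n : ℝ) + 1)) atTop (𝓝 t) := by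
      simpa using tendsto_const_nhds.sub (tendsto_one_div_add_atTop_nhds_zero_nat (𝕜 := ℝ))
    refine le_of_tendsto_of_tendsto' (h3.comp hφ.tendsto_atTop) (hlam 0) fun n => ?_
    simpa using (hκ (φ n)).2.le
  have hreal : Realizes a t := ⟨ha, hle, 0, le_antisymm (hle 0) h2⟩
  have hκφ := hκt.comp hφ.tendsto_atTop
  rcases lam_le_or_self ha (ha.avoids_basicWords fun k => (hle k).trans_lt hj) 0 with h' | h' | h'
  · linarith
  · obtain ⟨m, -, hu⟩ := hreal.exists_first hi hj h'
    rw [List.append_assoc, At_append] at hu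
    obtain ⟨n, hn1, hn2⟩ := ((hat selfWord (-10)).and (hκφ.eventually_ge_atTop K)).exists
    obtain ⟨n', hn1', hn2'⟩ := ((hat u _).and
      (hκφ.eventually_ge_atTop (κ (φ n) - (0 - 11 * m - 27)))).exists
    have hu' := hn1'.2 hu.1
    have hs : ∀ m : ℕ, Self a₀ (κ (φ n) + 11 * m) := by
      intro m
      induction m with
      | zero => simpa [Self, sub_eq_add_neg] using hn1.2 h'
      | succ m ih =>
        have := hK _ (by simp only [Function.comp] at hn2; omega) ih
        rwa [show κ (φ n) + 11 * (m : ℤ) + 11 = κ (φ n) + 11 * ((m + 1 : ℕ) : ℤ) by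
          push_cast; ring] at this
    simp only [Function.comp] at hn2'
    obtain ⟨q, hq1, hq2⟩ : ∃ q : ℕ, κ (φ n') + (0 - 11 * (m : ℤ) - 27) ≤ κ (φ n) + 11 * q ∧
        κ (φ n) + 11 * (q : ℤ) < κ (φ n') + (0 - 11 * (m : ℤ) - 27) + 11 :=
      ⟨((κ (φ n') + (0 - 11 * (m : ℤ) - 27) - κ (φ n) + 10) / 11).toNat, by omega, by omega⟩
    exact At_u_ne_three hu' hq1 hq2 (self_iff.1 (hs q)).2.1
  · obtain ⟨m, -, hu⟩ := hreal.rev.exists_first hi hj (k := 0)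
      (self_rev.2 (by simpa using h'))
    rw [List.append_assoc, At_append, At_rev] at hu
    set p : ℤ := -(0 - 11 * (m : ℤ) - 27) + 1 - u.length with hp
    obtain ⟨n, hn1, hn2⟩ := ((hat u.reverse p).and
      (hκφ.eventually_ge_atTop (K' - p))).exists
    have hu' := hn1.2 hu.1
    obtain ⟨n', hn1', hn2'⟩ := ((hat selfWord.reverse (-10)).and
      (hκφ.eventually_ge_atTop (κ (φ n) + p + 11))).exists
    simp only [Function.comp] at hn2 hn2'
    have hs : ∀ m : ℕ, K' + 11 * m ≤ κ (φ n') + 11 → SelfT a₀ (κ (φ n') - 11 * m) := by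
      intro m
      induction m with
      | zero => exact fun _ => by simpa [SelfT, sub_eq_add_neg] using hn1'.2 h'
      | succ m ih =>
        intro hm
        have := hK' _ (by push_cast at hm; omega) (ih (by push_cast at hm ⊢; omega))
        rwa [show κ (φ n') - 11 * (m : ℤ) - 11 = κ (φ n') - 11 * ((m + 1 : ℕ) : ℤ) by
          push_cast; ring] at this
    obtain ⟨q, hq1, hq2⟩ : ∃ q : ℕ, κ (φ n) + p ≤ κ (φ n') - 11 * q ∧
        κ (φ n') - 11 * (q : ℤ) < κ (φ n) + p + 11 :=
      ⟨((κ (φ n') - (κ (φ n) + p)) / 11).toNat, by omega, by omega⟩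
    exact At_u_rev_ne_three hu' hq1 hq2 (selfT_iff.1 (hs q (by omega))).2.1

/-! ### Chains of the word `w` -/

/-- The words agree as far as both are defined. -/
def compat : List ℕ → List ℕ → Bool
  | [], _ => true
  | _ :: _, [] => true
  | x :: l, y :: m => Nat.beq x y && compat l m

lemma compat_of_SP : ∀ {l m : List ℕ} {s : ℕ → ℕ}, SP l s → SP m s → compat l m = true
  | [], _, _, _, _ => by simp [compat]
  | _ :: _, [], _, _, _ => by simp [compat]
  | x :: l, y :: m, s, hl, hm => by
    rw [SP_cons] at hl hm
    rw [compat, ← hl.1, ← hm.1, compat_of_SP hl.2 hm.2]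
    simp

/-- The sequence continues with `u* w w w …`, where the second `w` is centred at position `k`. -/
structure Starts (a : ℤ → ℕ) (k : ℤ) : Prop where
  word : At (u ++ w ++ w) a (k - 27)
  per : rgt a (k - 5) = per w

lemma Starts.shift {a : ℤ → ℕ} {k m : ℤ} : Starts (shift a m) k ↔ Starts a (m + k) := by
  constructor
  · rintro ⟨h1, h2⟩
    rw [At_shift, ← add_sub_assoc] at h1
    rw [rgt_shift, ← add_sub_assoc] at h2
    exact ⟨h1, h2⟩
  · rintro ⟨h1, h2⟩
    exact ⟨by rwa [At_shift, ← add_sub_assoc], by rwa [rgt_shift, ← add_sub_assoc]⟩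

lemma Starts.per' {a : ℤ → ℕ} {k : ℤ} (h : Starts a k) : rgt a (k - 16) = MarkovLagrange.per w := by
  have h1 := (At_append.1 (At_append.1 h.word).1).2
  rw [show k - 27 + (u.length : ℤ) = k - 16 by
    rw [show u.length = 11 from rfl]; push_cast; ring, At] at h1
  rw [eq_pre_of_SP h1, rgt_add, show k - 16 + (w.length : ℤ) = k - 5 by
    rw [show w.length = 11 from rfl]; push_cast; ring, h.per, pre_per]

lemma per_w_add (m n : ℕ) : per w (11 * m + n) = per w n := by
  simp [per, show w.length = 11 from rfl]

/-- The beginning of `u w w w …`. -/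
def chainWord : List ℕ := u ++ (w ++ w ++ w ++ w ++ w ++ w)

lemma Starts.chainWord {a : ℤ → ℕ} {k : ℤ} (h : Starts a k) : At chainWord a (k - 27) := by
  rw [MarkovLagrange.chainWord, At_append]
  refine ⟨(At_append.1 (At_append.1 h.word).1).1, ?_⟩
  rw [show k - 27 + (u.length : ℤ) = k - 16 by
    rw [show u.length = 11 from rfl]; push_cast; ring, At, h.per']
  decide +kernel

/-- The possible occurrences of a word that ends in the periodic part `w w w …` behind `u`. -/
lemma Starts.cross {a : ℤ → ℕ} {k : ℤ} (h : Starts a k) {f : List ℕ} (h0 : 0 < f.length) {j : ℤ}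
    (hf : At f a j) :
    j + f.length ≤ k - 16 ∨
      (∃ d < 22, compat f (MarkovLagrange.chainWord.drop d) = true ∧ 11 < d + f.length ∧
        ∃ n : ℕ, j = k - 27 + d + 11 * n) ∨
      ∃ m < f.length, compat (f.drop m) MarkovLagrange.chainWord = true ∧ 11 < f.length - m := by
  rcases le_or_gt (j + f.length) (k - 16) with hle | hlt
  · exact Or.inl hle
  right
  have hK : ∀ d ≤ MarkovLagrange.chainWord.length,
      At (MarkovLagrange.chainWord.drop d) a (k - 27 + d) := by
    intro d hd
    have := h.chainWord
    rw [← List.take_append_drop d MarkovLagrange.chainWord, At_append, List.length_take,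
      min_eq_left hd] at this
    exact this.2
  have hlen : MarkovLagrange.chainWord.length = 77 := rfl
  rcases lt_or_ge j (k - 27) with hj | hj
  · right
    have hm : (k - 27 - j).toNat < f.length := by omega
    refine ⟨(k - 27 - j).toNat, hm, ?_, by omega⟩
    have h1 := hf
    rw [← List.take_append_drop (k - 27 - j).toNat f, At_append, List.length_take,
      min_eq_left hm.le, show j + ((k - 27 - j).toNat : ℤ) = k - 27 by omega] at h1
    exact compat_of_SP h1.2 h.chainWord
  · left
    by_cases hd : (j - (k - 27)).toNat < 22
    · refine ⟨(j - (k - 27)).toNat, hd, ?_, by omega, 0, by push_cast; omega⟩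
      have := hK (j - (k - 27)).toNat (by omega)
      rw [show k - 27 + ((j - (k - 27)).toNat : ℤ) = j by omega] at this
      exact compat_of_SP hf this
    · refine ⟨11 + (j - (k - 27)).toNat % 11, by omega, ?_, ?_,
        (j - (k - 27)).toNat / 11 - 1, by omega⟩
      · have := hK (11 + (j - (k - 27)).toNat % 11) (by omega)
        refine compat_of_SP ?_ this
        have e1 : rgt a (k - 27 + ((11 + (j - (k - 27)).toNat % 11 : ℕ) : ℤ)) = rgt a j := by
          rw [show k - 27 + ((11 + (j - (k - 27)).toNat % 11 : ℕ) : ℤ) =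
              k - 16 + (((j - (k - 27)).toNat % 11 : ℕ) : ℤ) by push_cast; ring,
            ← rgt_add, h.per',
            show j = k - 16 + ((11 * ((j - (k - 27)).toNat / 11 - 1) +
              (j - (k - 27)).toNat % 11 : ℕ) : ℤ) by omega, ← rgt_add, h.per']
          funext n
          rw [add_assoc, per_w_add]
          congr 2
          omega
        rw [e1]
        exact hf
      · omega

lemma cross_basicWords : basicWords.all (fun f => Nat.ble 1 f.length && (
    ((List.range 22).all fun d => !compat f (chainWord.drop d) || Nat.ble (d + f.length) 11) &&
    ((List.range f.length).all fun m => !compat (f.drop m) chainWord ||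
      Nat.ble (f.length - m) 11))) = true := by decide +kernel

lemma cross_self :
    (((List.range 22).all fun d => !compat selfWord (chainWord.drop d) || Nat.beq d 17) &&
    ((List.range selfWord.length).all fun m => !compat (selfWord.drop m) chainWord ||
      Nat.ble (selfWord.length - m) 11)) = true := by decide +kernel

lemma cross_selfT :
    (((List.range 22).all fun d => !compat selfWord.reverse (chainWord.drop d)) &&
    ((List.range selfWord.length).all fun m => !compat (selfWord.reverse.drop m) chainWord ||
      Nat.ble (selfWord.length - m) 11)) = true := by decide +kernel

/-- The forbidden words do not end in the periodic part. -/
lemma Starts.add_length_le {a : ℤ → ℕ} {k : ℤ} (h : Starts a k) {f : List ℕ} (hf : f ∈ basicWords)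
    {j : ℤ} (hj : At f a j) : j + f.length ≤ k - 16 := by
  have hc := List.all_eq_true.1 cross_basicWords f hf
  rw [Bool.and_eq_true, Bool.and_eq_true, List.all_eq_true, List.all_eq_true] at hc
  rcases h.cross (Nat.le_of_ble_eq_true hc.1) hj with h1 | ⟨d, hd, h1, h2, -⟩ | ⟨m, hm, h1, h2⟩
  · exact h1
  · have := hc.2.1 d (List.mem_range.2 hd)
    rw [h1, Bool.not_true, Bool.false_or] at this
    have := Nat.le_of_ble_eq_true this
    omega
  · have := hc.2.2 m (List.mem_range.2 hm)
    rw [h1, Bool.not_true, Bool.false_or] at this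
    have := Nat.le_of_ble_eq_true this
    omega

lemma Starts.self {a : ℤ → ℕ} {k : ℤ} (h : Starts a k) {j : ℤ} (hj : Self a j) :
    j ≤ k - 27 ∨ ∃ n : ℕ, j = k + 11 * n := by
  have hc := cross_self
  rw [Bool.and_eq_true, List.all_eq_true, List.all_eq_true] at hc
  have hl : selfWord.length = 21 := rfl
  rcases h.cross (f := selfWord) (by decide) hj with h1 | ⟨d, hd, h1, h2, n, h3⟩ | ⟨m, hm, h1, h2⟩
  · rw [hl] at h1
    left
    push_cast at h1
    omega
  · have := hc.1 d (List.mem_range.2 hd)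
    rw [h1, Bool.not_true, Bool.false_or] at this
    have := Nat.eq_of_beq_eq_true this
    exact Or.inr ⟨n, by omega⟩
  · have := hc.2 m (List.mem_range.2 hm)
    rw [h1, Bool.not_true, Bool.false_or] at this
    have := Nat.le_of_ble_eq_true this
    omega

lemma Starts.selfT {a : ℤ → ℕ} {k : ℤ} (h : Starts a k) {j : ℤ} (hj : SelfT a j) :
    j ≤ k - 27 := by
  have hc := cross_selfT
  rw [Bool.and_eq_true, List.all_eq_true, List.all_eq_true] at hc
  have hl : selfWord.reverse.length = 21 := rfl
  rcases h.cross (f := selfWord.reverse) (by decide) hj with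
    h1 | ⟨d, hd, h1, h2, n, h3⟩ | ⟨m, hm, h1, h2⟩
  · rw [hl] at h1
    push_cast at h1
    omega
  · have := hc.1 d (List.mem_range.2 hd)
    rw [h1] at this
    exact absurd this (by decide)
  · have := hc.2 m (List.mem_range.2 (by rwa [List.length_reverse] at hm))
    rw [h1, Bool.not_true, Bool.false_or] at this
    have := Nat.le_of_ble_eq_true this
    rw [List.length_reverse] at h2
    omega

lemma Starts.self_add {a : ℤ → ℕ} {k : ℤ} (h : Starts a k) (n : ℕ) : Self a (k + 11 * n) := by
  rw [Self, At, show k + 11 * (n : ℤ) - 10 = k - 16 + ((11 * n + 6 : ℕ) : ℤ) by push_cast; ring,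
    ← rgt_add, h.per']
  simp only [add_assoc, per_w_add]
  decide +kernel

lemma Starts.self_zero {a : ℤ → ℕ} {k : ℤ} (h : Starts a k) : Self a k := by
  simpa using h.self_add 0

/-- A chain that starts after `u` has no earlier members. -/
lemma Starts.le_of_chain {a : ℤ → ℕ} {k : ℤ} (h : Starts a k) {j : ℤ}
    (hj : ∀ m : ℕ, Self a (j + 11 * m)) : k ≤ j := by
  rcases h.self (by simpa using hj 0) with h1 | ⟨n, h1⟩
  · exfalso
    obtain ⟨q, hq1, hq2⟩ : ∃ q : ℕ, k - 27 ≤ j + 11 * q ∧ j + 11 * (q : ℤ) < k - 27 + 11 :=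
      ⟨((k - 27 - j + 10) / 11).toNat, by omega, by omega⟩
    exact At_u_ne_three (At_append.1 (At_append.1 h.word).1).1 hq1 hq2 (self_iff.1 (hj q)).2.1
  · omega

lemma Starts.unique {a : ℤ → ℕ} {k j : ℤ} (h : Starts a k) (h' : Starts a j) : k = j :=
  le_antisymm (h.le_of_chain h'.self_add) (h'.le_of_chain h.self_add)

/-- The value is strictly larger at the second word of a chain than at the later ones: the first
letters that differ are `1` and `2`, behind `w w`. -/
lemma Starts.lam_lt {a : ℤ → ℕ} {k : ℤ} (ha : BiNice a) (h : Starts a k) (n : ℕ) :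
    lam a (k + 11 * (n + 1)) < lam a k := by
  have e1 : a (k + 11 * (n + 1)) = 3 := by
    have := (self_iff.1 (h.self_add (n + 1))).2.1
    push_cast at this
    exact this
  have e2 : a k = 3 := (self_iff.1 h.self_zero).2.1
  have e3 : rgt a (k + 11 * (n + 1) + 1) = rgt a (k + 1) := by
    rw [show k + 11 * ((n : ℤ) + 1) + 1 = k - 5 + ((11 * (n + 1) + 6 : ℕ) : ℤ) by push_cast; ring,
      ← rgt_add, h.per, show k + 1 = k - 5 + (6 : ℕ) by push_cast; ring, ← rgt_add, h.per]
    funext m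
    rw [add_assoc, per_w_add]
  have h1 : SP ((w ++ wL).reverse ++ [1, 2, 2, 2, 1]) (lft a k) := by
    have := h.word
    rw [show u ++ w ++ w = [2, 1, 2, 1, 2, 1] ++ (([1, 2, 2, 2, 1] ++ w ++ wL) ++ wR) from rfl,
      At_append, At_append] at this
    have := SP_reverse_lft.2 (show At ([1, 2, 2, 2, 1] ++ w ++ wL) a
      (k - ((([1, 2, 2, 2, 1] : List ℕ) ++ w ++ wL).length : ℤ)) from by
        convert this.2.1 using 1
        rw [show (([1, 2, 2, 2, 1] : List ℕ) ++ w ++ wL).length = 21 from rfl,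
          show ([2, 1, 2, 1, 2, 1] : List ℕ).length = 6 from rfl]
        push_cast
        ring)
    simpa using this
  have h2 : SP ((w ++ wL).reverse ++ [1, 2, 2, 2, 2]) (lft a (k + 11 * (n + 1))) := by
    have : SP ([2, 2, 2, 2, 1] ++ w ++ wL).reverse (lft a (k + 11 * (n + 1))) := by
      rw [SP_reverse_lft,
        show k + 11 * ((n : ℤ) + 1) - ((([2, 2, 2, 2, 1] : List ℕ) ++ w ++ wL).length : ℤ) =
        k - 16 + ((11 * n + 6 : ℕ) : ℤ) by
          rw [show (([2, 2, 2, 2, 1] : List ℕ) ++ w ++ wL).length = 21 from rfl]; push_cast; ring,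
        At, ← rgt_add, h.per']
      simp only [add_assoc, per_w_add]
      decide +kernel
    simpa using this
  have hlt := (infCF_lt_of_first_diff 20 (ha.lft k).pos (ha.lft (k + 11 * (n + 1))).pos ?_ ?_).1
    (by decide)
  · rw [lam_eq, lam_eq, e1, e2, e3]
    linarith
  · intro i hi
    have hi1 : i < ((w ++ wL).reverse ++ [1, 2, 2, 2, 1]).length := by
      rw [show ((w ++ wL).reverse ++ ([1, 2, 2, 2, 1] : List ℕ)).length = 21 from rfl]; omega
    have hi2 : i < ((w ++ wL).reverse ++ [1, 2, 2, 2, 2]).length := by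
      rw [show ((w ++ wL).reverse ++ ([1, 2, 2, 2, 2] : List ℕ)).length = 21 from rfl]; omega
    rw [h1 i hi1, h2 i hi2, ← List.getD_eq_getElem _ 0 hi1, ← List.getD_eq_getElem _ 0 hi2]
    have key : ∀ i < 20, ((w ++ wL).reverse ++ [1, 2, 2, 2, 1]).getD i 0 =
      ((w ++ wL).reverse ++ [1, 2, 2, 2, 2]).getD i 0 := by decide
    exact key i hi
  · rw [h1 20 (by decide), h2 20 (by decide)]
    decide

/-- A realization of a value in the interval that contains the self-replicating word has a chain. -/
lemma Realizes.exists_starts {a : ℤ → ℕ} {t : ℝ} (h : Realizes a t) (hi : iVal < t) (hj : t < jVal)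
    {k : ℤ} (hk : Self a k) : ∃ k, Starts a k := by
  obtain ⟨m, h1, h2⟩ := h.exists_first hi hj hk
  exact ⟨_, h2, rgt_eq_per_of_self
    (self_chain h.nice (fun k => (h.le k).trans_lt hj) h1)⟩

lemma Realizes.le_of_self {a : ℤ → ℕ} {t : ℝ} (h : Realizes a t) (hj : t < jVal) {k j : ℤ}
    (hk : Starts a k) (hs : Self a j) : ∃ n : ℕ, j = k + 11 * n := by
  have := hk.le_of_chain (self_chain h.nice (fun k => (h.le k).trans_lt hj) hs)
  rcases hk.self hs with h' | h'
  · omega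
  · exact h'

/-- A value in the interval is attained at the second word of the chain to the right, or at the
second word of the transposed chain to the left. -/
lemma Realizes.att_cases {a : ℤ → ℕ} {t : ℝ} (h : Realizes a t) (hi : iVal < t) (hj : t < jVal) :
    (∃ k, Starts a k ∧ lam a k = t) ∨ ∃ k, Starts (MarkovLagrange.rev a) k ∧
      lam (MarkovLagrange.rev a) k = t := by
  have key : ∀ a, Realizes a t → ∀ p, lam a p = t → Self a p → ∃ k, Starts a k ∧ lam a k = t := by
    intro a h p hp h'
    obtain ⟨k, hk⟩ := h.exists_starts hi hj h'
    obtain ⟨n, rfl⟩ := h.le_of_self hj hk h'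
    refine ⟨k, hk, ?_⟩
    cases n with
    | zero => simpa using hp
    | succ n =>
      have := hk.lam_lt h.nice n
      have := h.le k
      push_cast at hp
      linarith
  obtain ⟨p, hp⟩ := h.att
  rcases lam_le_or_self h.nice (h.nice.avoids_basicWords fun k => (h.le k).trans_lt hj) p with
    h' | h' | h'
  · linarith
  · exact Or.inl (key a h p hp h')
  · exact Or.inr (key _ h.rev (-p) (by rw [lam_rev, neg_neg, hp]) (by rwa [self_rev, neg_neg]))

/-! ### The sequences `… u w w* w w …` -/

lemma eq_glue (a : ℤ → ℕ) : a = glue (lft a 0) (rgt a 0) := by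
  funext k
  obtain (n | n) := k
  · simp [glue, rgt]
  · show a _ = a _
    rw [Int.negSucc_eq]
    congr 1
    ring

lemma eq_of_halves {a b : ℤ → ℕ} (h1 : lft a 0 = lft b 0) (h2 : rgt a 0 = rgt b 0) : a = b := by
  rw [eq_glue a, eq_glue b, h1, h2]

lemma toW_lft (γ : ℕ → ℕ) (v : List ℕ) : lft (toW γ v) 0 = pre (v ++ w ++ wL).reverse γ :=
  lft_glue _ _

lemma toW_rgt (γ : ℕ → ℕ) (v : List ℕ) : rgt (toW γ v) 0 = pre wR (per w) := rgt_glue _ _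

lemma toW_at (γ : ℕ → ℕ) (v : List ℕ) : At (v ++ w ++ wL) (toW γ v) (-((v.length : ℤ) + 16)) := by
  have : SP (v ++ w ++ wL).reverse (lft (toW γ v) 0) := by
    rw [toW_lft]
    exact SP_pre _ _
  rw [SP_reverse_lft] at this
  convert this using 1
  simp only [List.length_append, show w.length = 11 from rfl, show wL.length = 5 from rfl]
  push_cast
  ring

lemma rgt_of_At {a : ℤ → ℕ} {v : List ℕ} {k : ℤ} (h : At v a k) :
    rgt a k = pre v (rgt a (k + v.length)) := by
  conv_lhs => rw [eq_pre_of_SP h, rgt_add]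

lemma rgt_five {a : ℤ → ℕ} (h : At wL a (-5)) (h' : rgt a 0 = pre wR (per w)) :
    rgt a (-5) = per w := by
  rw [rgt_of_At h, show (-5 : ℤ) + wL.length = 0 from rfl, h', ← pre_append,
    show wL ++ wR = w from rfl,
    pre_per]

lemma rgt_zero {a : ℤ → ℕ} (h : rgt a (-5) = per w) : rgt a 0 = pre wR (per w) := by
  have h1 : SP (wL ++ wR) (rgt a (-5)) := by
    rw [h]
    decide +kernel
  rw [show (0 : ℤ) = -5 + wL.length from rfl, rgt_of_At (v := wR) (At_append.1 h1).2,
    show (-5 : ℤ) + wL.length + wR.length = -5 + (w.length : ℕ) from rfl, ← rgt_add, h]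
  simp only [per_add]

lemma toW_rgt_five (γ : ℕ → ℕ) (v : List ℕ) : rgt (toW γ v) (-5) = per w := by
  refine rgt_five ?_ (toW_rgt γ v)
  have := (At_append.1 (toW_at γ v)).2
  convert this using 1
  simp only [List.length_append, show w.length = 11 from rfl]
  push_cast
  ring

lemma eq_toW {a : ℤ → ℕ} {v : List ℕ} (h : At (v ++ w ++ wL) a (-((v.length : ℤ) + 16)))
    (hr : rgt a (-5) = per w) : a = toW (fun n => lft a 0 (v.length + 16 + n)) v := by
  refine eq_of_halves ?_ ?_
  · rw [toW_lft]
    have h1 : SP (v ++ w ++ wL).reverse (lft a 0) := by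
      rw [SP_reverse_lft]
      convert h using 1
      simp only [List.length_append, show w.length = 11 from rfl, show wL.length = 5 from rfl]
      push_cast
      ring
    conv_lhs => rw [eq_pre_of_SP h1]
    have e : (v ++ w ++ wL).reverse.length = v.length + 16 := by
      simp only [List.length_reverse, List.length_append, show w.length = 11 from rfl,
        show wL.length = 5 from rfl, add_assoc]
    rw [e]
  · rw [toW_rgt, rgt_zero hr]

lemma starts_zero_iff {a : ℤ → ℕ} :
    Starts a 0 ↔ At (u ++ w ++ wL) a (-27) ∧ rgt a (-5) = per w := by
  have hs : u ++ w ++ w = (u ++ w ++ wL) ++ wR := by simp [w]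
  constructor
  · rintro ⟨h1, h2⟩
    rw [hs, At_append] at h1
    exact ⟨h1.1, h2⟩
  · rintro ⟨h1, h2⟩
    refine ⟨?_, h2⟩
    rw [hs, At_append]
    refine ⟨h1, ?_⟩
    show At wR a 0
    rw [At, rgt_zero h2]
    exact SP_pre _ _

lemma starts_toW (γ : ℕ → ℕ) (z : List ℕ) : Starts (toW γ (z ++ u)) 0 := by
  refine starts_zero_iff.2 ⟨?_, toW_rgt_five _ _⟩
  have := toW_at γ (z ++ u)
  rw [List.append_assoc, List.append_assoc, At_append] at this
  rw [List.append_assoc]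
  convert this.2 using 1
  simp only [List.length_append, show u.length = 11 from rfl]
  push_cast
  ring

lemma lft_inj_of_lam {a b : ℤ → ℕ} (ha : BiNice a) (hb : BiNice b) (hra : rgt a (-5) = per w)
    (hrb : rgt b (-5) = per w) (h : lam a 0 = lam b 0) : a = b := by
  have h0 : rgt a 0 = rgt b 0 := by rw [rgt_zero hra, rgt_zero hrb]
  have h1 : rgt a (0 + 1) = rgt b (0 + 1) := by rw [← tl_rgt, ← tl_rgt, h0]
  have h2 : a 0 = b 0 := by simpa [rgt] using congrFun h0 0
  rw [lam_eq, lam_eq, h1, h2, add_right_inj] at h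
  exact eq_of_halves (infCF_injective (ha.lft 0).pos (hb.lft 0).pos h) h0

/-! ### The forbidden words -/

lemma mem_F_iff {f : List ℕ} : f ∈ F ↔ f ∈ basicWords ∨ f = selfWord ∨ f = selfWord.reverse := by
  rw [F, Set.mem_ofPred_eq, basicWords]
  generalize localWords ++ tauWords = L
  rw [List.mem_append, List.mem_append, List.mem_append, List.mem_map,
    List.mem_singleton, List.mem_singleton, List.reverse_eq_iff]
  constructor
  · rintro ((h | h) | (h | h))
    · exact Or.inl (Or.inl h)
    · exact Or.inr (Or.inl h)
    · exact Or.inl (Or.inr ⟨_, h, List.reverse_reverse f⟩)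
    · exact Or.inr (Or.inr h)
  · rintro ((h | ⟨g, h, rfl⟩) | (h | h))
    · exact Or.inl (Or.inl h)
    · exact Or.inr (Or.inl (by rwa [List.reverse_reverse]))
    · exact Or.inl (Or.inr h)
    · exact Or.inr (Or.inr h)

lemma reverse_mem_basicWords {f : List ℕ} (hf : f ∈ basicWords) : f.reverse ∈ basicWords := by
  rw [basicWords, List.mem_append, List.mem_map] at hf ⊢
  rcases hf with h | ⟨g, h, rfl⟩
  · exact Or.inr ⟨f, h, rfl⟩
  · exact Or.inl (by rwa [List.reverse_reverse])

lemma F_reverse {f : List ℕ} (hf : f ∈ F) : f.reverse ∈ F := by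
  rw [mem_F_iff] at hf ⊢
  rcases hf with h | rfl | rfl
  · exact Or.inl (reverse_mem_basicWords h)
  · exact Or.inr (Or.inr rfl)
  · exact Or.inr (Or.inl (List.reverse_reverse _))

lemma avoids_of_forall {a : ℤ → ℕ} (h : ∀ f ∈ basicWords, ∀ j, ¬ At f a j) : Avoids basicWords a :=
  fun f hf j => ⟨h f hf j, h _ (reverse_mem_basicWords hf) j⟩

lemma three_mem_of_mem_F {f : List ℕ} (hf : f ∈ F) : 3 ∈ f := by
  have h : basicWords.all (fun f => f.any fun x => Nat.beq x 3) = true := by decide +kernel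
  rw [mem_F_iff] at hf
  rcases hf with hf | rfl | rfl
  · obtain ⟨x, hx, h3⟩ := List.any_eq_true.1 (List.all_eq_true.1 h f hf)
    rwa [← Nat.eq_of_beq_eq_true h3]
  · decide
  · decide

/-- A sequence with a chain behind position `0` realizes its value there, as soon as the other
occurrences of the self-replicating word and of its transpose are controlled. -/
lemma realizes_of_starts {a : ℤ → ℕ} (ha : BiNice a) (h : Starts a 0)
    (hF : ∀ f ∈ basicWords, ∀ j, ¬ At f a j) (hs : ∀ j, Self a j → ∃ n : ℕ, j = 11 * n)
    (hT : ∀ j, SelfT a j → lam a j ≤ lam a 0) :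
    Realizes a (lam a 0) := by
  refine ⟨ha, fun j => ?_, 0, rfl⟩
  have hi := (lam_mem_of_chain ha h.word h.per).1
  rcases lam_le_or_self ha (avoids_of_forall hF) j with h' | h' | h'
  · linarith
  · obtain ⟨n, rfl⟩ := hs j h'
    cases n with
    | zero => simp
    | succ n =>
      have := h.lam_lt ha n
      rw [zero_add] at this
      push_cast
      exact this.le
  · exact hT j h'

/-! ### The set `C` -/

/-- The sequences that give the values in `C`. -/
structure InC (a : ℤ → ℕ) : Prop where
  nice : BiNice a
  starts : Starts a 0
  free : ∀ f ∈ F, ∀ j, At f a j → 6 < j + f.length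

lemma lft_six {a : ℤ → ℕ} (h : Starts a 0) :
    lft a 6 = pre (u ++ w ++ w).reverse (fun n => lft a 0 (u.length + 16 + n)) := by
  have h1 : SP (u ++ w ++ w).reverse (lft a 6) := SP_reverse_lft.2 h.word
  conv_lhs => rw [eq_pre_of_SP h1]
  congr 1
  funext n
  simp only [lft]
  rw [show (u ++ w ++ w).reverse.length = 33 from rfl, show u.length = 11 from rfl]
  congr 1
  push_cast
  ring

lemma occursLeft_iff {a : ℤ → ℕ} {f : List ℕ} {k : ℤ} :
    OccursLeft f (lft a k) ↔ ∃ j, At f a j ∧ j + f.length ≤ k := by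
  have e : ∀ i : ℕ, (fun n => lft a k (i + n)) = lft a (k - i) := by
    intro i
    funext n
    simp only [lft]
    congr 1
    push_cast
    ring
  have key : OccursLeft f (lft a k) ↔ ∃ i : ℕ, At f a (k - i - f.length) := by
    refine exists_congr fun i => ?_
    rw [← SP_reverse_lft, ← e]
    rfl
  rw [key]
  constructor
  · rintro ⟨i, h⟩
    exact ⟨_, h, by omega⟩
  · rintro ⟨j, h, hj⟩
    refine ⟨(k - j - f.length).toNat, ?_⟩
    rwa [show k - ((k - j - f.length).toNat : ℤ) - f.length = j by omega]

lemma mem_setC_iff {t : ℝ} : t ∈ setC ↔ ∃ a, InC a ∧ t = lam a 0 := by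
  constructor
  · rintro ⟨γ, hγ, hF, rfl⟩
    have hst : Starts (toW γ u) 0 := starts_toW γ []
    refine ⟨toW γ u, ⟨?_, hst, ?_⟩, rfl⟩
    · exact glue_nice (Nice.pre (letters_of_all rfl) hγ) (Nice.pre (letters_of_all rfl)
        (per_nice (letters_of_all rfl) (by decide)))
    · intro f hf j hj
      by_contra hcon
      refine hF f hf ?_
      have e : (fun n => lft (toW γ u) 0 (u.length + 16 + n)) = γ := by
        rw [toW_lft, show u.length + 16 = (u ++ w ++ wL).reverse.length from rfl]
        simp only [pre_add]
      have := lft_six hst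
      rw [e] at this
      rw [← this, occursLeft_iff]
      exact ⟨j, hj, by omega⟩
  · rintro ⟨a, ⟨h1, h2, h3⟩, rfl⟩
    refine ⟨fun n => lft a 0 (u.length + 16 + n), fun n => h1 _, ?_, ?_⟩
    · intro f hf hocc
      rw [← lft_six h2, occursLeft_iff] at hocc
      obtain ⟨j, hj, hle⟩ := hocc
      have := h3 f hf j hj
      omega
    · rw [← eq_toW (starts_zero_iff.1 h2).1 h2.per]

lemma InC.realizes {a : ℤ → ℕ} (h : InC a) : Realizes a (lam a 0) := by
  refine realizes_of_starts h.nice h.starts ?_ ?_ ?_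
  · intro f hf j hj
    have h1 := h.starts.add_length_le hf hj
    have h2 := h.free f (mem_F_iff.2 (Or.inl hf)) j hj
    omega
  · intro j hj
    rcases h.starts.self hj with h1 | ⟨n, h1⟩
    · have h2 := h.free _ (mem_F_iff.2 (Or.inr (Or.inl rfl))) _ hj
      rw [show selfWord.length = 21 from rfl] at h2
      push_cast at h2
      omega
    · exact ⟨n, by omega⟩
  · intro j hj
    have h1 := h.starts.selfT hj
    have h2 := h.free _ (mem_F_iff.2 (Or.inr (Or.inr rfl))) _ hj
    rw [show selfWord.reverse.length = 21 from rfl] at h2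
    push_cast at h2
    omega

lemma Realizes.inC {a : ℤ → ℕ} {t : ℝ} (h : Realizes a t) (hj : t < jVal) (hs : Starts a 0)
    (hT : ∀ j, ¬ SelfT a j) : InC a := by
  refine ⟨h.nice, hs, ?_⟩
  intro f hf j hfj
  have hav := h.nice.avoids_basicWords fun k => (h.le k).trans_lt hj
  rcases mem_F_iff.1 hf with hf' | rfl | rfl
  · exact absurd hfj (hav f hf' j).1
  · obtain ⟨n, hn⟩ := h.le_of_self hj hs (j := j + 10) (by
      rw [Self, add_sub_cancel_right]; exact hfj)
    rw [show selfWord.length = 21 from rfl]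
    push_cast
    omega
  · exact absurd hfj (by have := hT (j + 10); rwa [SelfT, add_sub_cancel_right] at this)

/-! ### The sets `D` and `X` -/

lemma finCF_pos_of_ne_nil {l : List ℕ} (h : l ≠ []) (hl : ∀ x ∈ l, 0 < x) : 0 < finCF l := by
  obtain ⟨x, l, rfl⟩ := List.exists_cons_of_ne_nil h
  have h1 : (0 : ℝ) < x := by exact_mod_cast hl x (by simp)
  have := finCF_nonneg l
  rw [finCF]
  positivity

/-- Finite continued fractions of the same length are ordered in the same way as their
continuations by a common tail. -/
lemma finCF_le_iff : ∀ {l l' : List ℕ} {s : ℕ → ℕ}, l.length = l'.length → (∀ x ∈ l, 0 < x) →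
    (∀ x ∈ l', 0 < x) → (∀ i, 0 < s i) →
    (finCF l ≤ finCF l' ↔ infCF (pre l s) ≤ infCF (pre l' s))
  | [], [], _, _, _, _, _ => by simp
  | [], _ :: _, _, h, _, _, _ => by simp at h
  | _ :: _, [], _, h, _, _, _ => by simp at h
  | x :: l, x' :: l', s, h, hl, hl', hs => by
    have hlen : l.length = l'.length := by simpa using h
    have hp : ∀ y ∈ l, 0 < y := fun y hy => hl y (by simp [hy])
    have hp' : ∀ y ∈ l', 0 < y := fun y hy => hl' y (by simp [hy])
    have ih := finCF_le_iff (l := l') (l' := l) hlen.symm hp' hp hs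
    have hx : (0 : ℝ) < x := by exact_mod_cast hl x (by simp)
    have hx' : (0 : ℝ) < x' := by exact_mod_cast hl' x' (by simp)
    have a1 := finCF_nonneg l
    have a2 := finCF_nonneg l'
    have a3 := finCF_le_one l hp
    have a4 := finCF_le_one l' hp'
    have b1 := infCF_pos (pre_pos hp hs)
    have b2 := infCF_pos (pre_pos hp' hs)
    have b3 := infCF_lt_one (pre_pos hp hs)
    have b4 := infCF_lt_one (pre_pos hp' hs)
    rw [infCF_step (pre_pos hl hs), infCF_step (pre_pos hl' hs), tl_pre_cons, tl_pre_cons,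
      pre_cons_zero, pre_cons_zero, finCF, finCF,
      one_div_le_one_div (by positivity) (by positivity),
      one_div_le_one_div (by positivity) (by positivity)]
    rcases lt_trichotomy x x' with hlt | rfl | hlt
    · have hlt' : (x : ℝ) + 1 ≤ x' := by exact_mod_cast hlt
      refine ⟨fun hle => ?_, fun hle => by linarith⟩
      -- equality would need `finCF l = 1` and `finCF l' = 0`, hence words of different lengths
      rcases eq_or_ne l' [] with rfl | hne
      · have : l = [] := by simpa using hlen
        subst this
        simp only [finCF] at hle
        linarith
      · have := finCF_pos_of_ne_nil hne hp'
        linarith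
    · simpa using ih
    · have hlt' : (x' : ℝ) + 1 ≤ x := by exact_mod_cast hlt
      exact ⟨fun _ => by linarith, fun _ => by linarith⟩
termination_by l l' => l.length + l'.length
decreasing_by simp only [List.length_cons]; omega

lemma infCF_pre_le_iff {v : List ℕ} {s s' : ℕ → ℕ} (hv : ∀ x ∈ v, 0 < x) (hs : ∀ i, 0 < s i)
    (hs' : ∀ i, 0 < s' i) :
    (Even v.length → (infCF (pre v s) ≤ infCF (pre v s') ↔ infCF s ≤ infCF s')) ∧
      (¬ Even v.length → (infCF (pre v s') ≤ infCF (pre v s) ↔ infCF s ≤ infCF s')) := by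
  have hinj : infCF (pre v s) = infCF (pre v s') → infCF s = infCF s' := by
    intro h
    have := infCF_injective (pre_pos hv hs) (pre_pos hv hs') h
    congr 1
    funext n
    rw [← pre_add v s, this, pre_add]
  refine ⟨fun he => ⟨fun h => ?_, (infCF_pre_le v hv hs hs' · |>.1 he)⟩,
    fun he => ⟨fun h => ?_, (infCF_pre_le v hv hs hs' · |>.2 he)⟩⟩
  · rcases le_total (infCF s) (infCF s') with h' | h'
    · exact h'
    · exact (hinj (le_antisymm h ((infCF_pre_le v hv hs' hs h').1 he))).le
  · rcases le_total (infCF s) (infCF s') with h' | h'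
    · exact h'
    · exact (hinj (le_antisymm ((infCF_pre_le v hv hs' hs h').2 he) h)).le

lemma letters_append {l m : List ℕ} : Letters123 (l ++ m) ↔ Letters123 l ∧ Letters123 m := by
  simp only [Letters123, List.mem_append]
  exact ⟨fun h => ⟨fun d hd => h d (Or.inl hd), fun d hd => h d (Or.inr hd)⟩,
    fun h d hd => hd.elim (h.1 d) (h.2 d)⟩

lemma letters_reverse {l : List ℕ} : Letters123 l.reverse ↔ Letters123 l := by
  simp [Letters123]

lemma Letters123.pos {l : List ℕ} (h : Letters123 l) : ∀ x ∈ l, 0 < x := fun x hx => by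
  rcases h x hx with h | h | h <;> omega

lemma letters_w : Letters123 w := letters_of_all rfl

lemma letters_wL : Letters123 wL := letters_of_all rfl

lemma letters_u : Letters123 u := letters_of_all rfl

lemma nice_per_w : Nice (per w) := per_nice letters_w (by decide)

/-- The sequence `… wᵀ wᵀ wᵀ y w w* w w …`. -/
noncomputable def dbl (y : List ℕ) : ℤ → ℕ := toW (per w) (w.reverse ++ w.reverse ++ y)

lemma dbl_nice {y : List ℕ} (hy : Letters123 y) : BiNice (dbl y) := by
  refine glue_nice (Nice.pre ?_ nice_per_w) (Nice.pre (letters_of_all rfl) nice_per_w)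
  exact letters_reverse.2 (letters_append.2 ⟨letters_append.2 ⟨letters_append.2
    ⟨letters_append.2 ⟨letters_reverse.2 letters_w, letters_reverse.2 letters_w⟩, hy⟩,
      letters_w⟩, letters_wL⟩)

lemma dbl_lft (y : List ℕ) : lft (dbl y) 0 = pre ((w ++ wL).reverse ++ y.reverse) (per w) := by
  rw [dbl, toW_lft, show (w.reverse ++ w.reverse ++ y ++ w ++ wL).reverse =
    ((w ++ wL).reverse ++ y.reverse) ++ (w ++ w) by simp, pre_append _ (w ++ w), pre_append w w,
    pre_per, pre_per]

lemma dbl_at (y : List ℕ) : At ((w.reverse ++ w.reverse ++ y) ++ w ++ wL) (dbl y)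
    (-((y.length : ℤ) + 38)) := by
  have := toW_at (per w) (w.reverse ++ w.reverse ++ y)
  rw [dbl]
  convert this using 1
  simp only [List.length_append, List.length_reverse, show w.length = 11 from rfl]
  push_cast
  ring

lemma dbl_at_y (y : List ℕ) : At y (dbl y) (-((y.length : ℤ) + 16)) := by
  have := (At_append.1 (At_append.1 (At_append.1 (dbl_at y)).1).1).2
  convert this using 1
  simp only [List.length_append, List.length_reverse, show w.length = 11 from rfl]
  push_cast
  ring

lemma dbl_starts (z : List ℕ) : Starts (dbl (z ++ u)) 0 := by
  rw [dbl, ← List.append_assoc]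
  exact starts_toW _ _

lemma lft_sub (a : ℤ → ℕ) (k : ℤ) (m : ℕ) : lft a (k - m) = fun n => lft a k (m + n) := by
  funext n
  simp only [lft]
  congr 1
  push_cast
  ring

lemma dbl_starts_rev (z : List ℕ) :
    Starts (rev (dbl (u.reverse ++ z))) ((u.reverse ++ z).length + 33) := by
  have hl : lft (dbl (u.reverse ++ z)) 0 =
      pre ((w ++ wL).reverse ++ z.reverse) (pre u (per w)) := by
    rw [dbl_lft, ← pre_append]
    congr 1
    simp
  have hX : ((w ++ wL).reverse ++ z.reverse).length = z.length + 16 := by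
    simp only [List.length_reverse, List.length_append, show w.length = 11 from rfl,
      show wL.length = 5 from rfl]
    ring
  have hlen : (((u.reverse ++ z).length : ℕ) : ℤ) = z.length + 11 := by
    simp only [List.length_reverse, List.length_append, show u.length = 11 from rfl]
    push_cast
    ring
  have key : lft (dbl (u.reverse ++ z)) (0 - ((z.length + 16 : ℕ) : ℤ)) = pre u (per w) := by
    rw [lft_sub, hl, ← hX]
    simp only [pre_add]
  constructor
  · rw [At, rgt_rev, hlen, show -((z.length : ℤ) + 11 + 33 - 27) + 1 =
      0 - ((z.length + 16 : ℕ) : ℤ) by push_cast; ring, key, List.append_assoc, SP_pre_append]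
    decide +kernel
  · rw [rgt_rev, hlen, show -((z.length : ℤ) + 11 + 33 - 5) + 1 =
      0 - ((z.length + 16 : ℕ) : ℤ) - ((22 : ℕ) : ℤ) by push_cast; ring, lft_sub, key]
    funext n
    rw [show 22 + n = u.length + (11 + n) by rw [show u.length = 11 from rfl]; ring, pre_add,
      show 11 + n = 11 * 1 + n by ring, per_w_add]

/-- At the central letter of the left chain, the sequence read backwards looks as at position `0`,
with the transpose of `y` in place of `y`. -/
lemma dbl_rgt (z : List ℕ) : rgt (dbl (z ++ u)) (-(((z ++ u).length : ℤ) + 33) + 1) =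
    pre ((w ++ wL).reverse ++ (z ++ u)) (per w) := by
  have h1 := dbl_at (z ++ u)
  rw [show (w.reverse ++ w.reverse ++ (z ++ u)) ++ w ++ wL =
      wR.reverse ++ (((w ++ wL).reverse ++ (z ++ u)) ++ (w ++ wL)) by simp [w],
    At_append, At_append] at h1
  have h2 := rgt_of_At h1.2.1
  have e1 : -(((z ++ u).length : ℤ) + 38) + (wR.reverse.length : ℤ) =
      -(((z ++ u).length : ℤ) + 33) + 1 := by
    rw [show wR.reverse.length = 6 from rfl]
    push_cast
    ring
  rw [e1] at h2
  rw [h2]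
  congr 1
  have e2 : -(((z ++ u).length : ℤ) + 33) + 1 +
      ((((w ++ wL).reverse ++ (z ++ u)).length : ℕ) : ℤ) = 0 - 16 := by
    rw [List.length_append (as := (w ++ wL).reverse), show (w ++ wL).reverse.length = 16 from rfl]
    push_cast
    ring
  rw [e2]
  exact (dbl_starts z).per'

lemma dbl_lam_le_iff {y z z' : List ℕ} (hy : Letters123 y) (h1 : y = z ++ u)
    (h2 : y = u.reverse ++ z') :
    lam (dbl y) (-((y.length : ℤ) + 33)) ≤ lam (dbl y) 0 ↔ finCF y ≤ finCF y.reverse := by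
  have hst : Starts (dbl y) 0 := h1 ▸ dbl_starts z
  have hst' : Starts (rev (dbl y)) (y.length + 33) := h2 ▸ dbl_starts_rev z'
  have e1 : lam (dbl y) 0 = 3 + infCF (pre wR.tail (per w)) +
      infCF (pre (w ++ wL).reverse (pre y.reverse (per w))) := by
    have h3 : rgt (dbl y) (0 + 1) = pre wR.tail (per w) := by
      rw [← tl_rgt, rgt_zero hst.per]
      exact tl_pre_cons 3 wR.tail _
    rw [lam_eq, dbl_lft, pre_append, (self_iff.1 hst.self_zero).2.1, h3]
    norm_num
  have e2 : lam (dbl y) (-((y.length : ℤ) + 33)) = 3 + infCF (pre wR.tail (per w)) +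
      infCF (pre (w ++ wL).reverse (pre y (per w))) := by
    rw [← lam_rev, lam_eq, (self_iff.1 hst'.self_zero).2.1, lft_rev]
    have h3 : rgt (rev (dbl y)) (↑y.length + 33 + 1) = pre wR.tail (per w) := by
      have h0 := Starts.shift.2 (show Starts (rev (dbl y)) ((y.length + 33) + 0) by
        rwa [add_zero])
      have := rgt_zero h0.per
      rw [rgt_shift, add_zero] at this
      rw [← tl_rgt, this]
      exact tl_pre_cons 3 wR.tail _
    have h4 : rgt (dbl y) (-((y.length : ℤ) + 33) + 1) =
        pre (w ++ wL).reverse (pre y (per w)) := by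
      rw [← pre_append, h1]
      exact dbl_rgt z
    rw [h3, h4]
    norm_num
  rw [e1, e2, add_le_add_iff_left, (infCF_pre_le_iff (letters_reverse.2
    (letters_append.2 ⟨letters_w, letters_wL⟩)).pos (pre_pos hy.pos nice_per_w.pos)
      (pre_pos (letters_reverse.2 hy).pos nice_per_w.pos)).1 (by decide),
    finCF_le_iff (by simp) hy.pos (letters_reverse.2 hy).pos nice_per_w.pos]

lemma finCF_middle {θ : List ℕ} (hθ : Letters123 θ) :
    finCF (u.reverse ++ θ ++ u) ≤ finCF (u.reverse ++ θ ++ u).reverse ↔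
      finCF θ.reverse ≤ finCF θ := by
  have hu : ∀ x ∈ u, 0 < x := letters_u.pos
  have hur : ∀ x ∈ u.reverse, 0 < x := (letters_reverse.2 letters_u).pos
  have hθ1 := hθ.pos
  have hθ2 := (letters_reverse.2 hθ).pos
  have hn := nice_per_w.pos
  have hy : ∀ x ∈ u.reverse ++ θ ++ u, 0 < x :=
    (letters_append.2 ⟨letters_append.2 ⟨letters_reverse.2 letters_u, hθ⟩, letters_u⟩).pos
  have e : (u.reverse ++ θ ++ u).reverse = u.reverse ++ θ.reverse ++ u := by simp
  have hy' : ∀ x ∈ u.reverse ++ θ.reverse ++ u, 0 < x := e ▸ fun x hx =>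
    hy x (List.mem_reverse.1 hx)
  rw [e, finCF_le_iff (s := per w) (by simp) hy hy' hn, pre_append, pre_append, pre_append,
    pre_append, (infCF_pre_le_iff hur (pre_pos hθ2 (pre_pos hu hn))
      (pre_pos hθ1 (pre_pos hu hn))).2 (by decide),
    ← finCF_le_iff (by simp) hθ2 hθ1 (pre_pos hu hn)]

lemma At.infix {y f : List ℕ} {a : ℤ → ℕ} {q j : ℤ} (hy : At y a q) (hf : At f a j) (h1 : q ≤ j)
    (h2 : j + f.length ≤ q + y.length) : f <:+: y := by
  have e : f = (y.drop (j - q).toNat).take f.length := by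
    refine List.ext_getElem ?_ fun i hi hi' => ?_
    · simp
      omega
    · rw [List.getElem_take, List.getElem_drop, ← hf i hi, ← hy _ (by omega)]
      simp only [rgt]
      congr 1
      push_cast
      omega
  rw [e]
  exact (List.take_prefix _ _).isInfix.trans (List.drop_suffix _ _).isInfix

lemma At.of_infix' {y f : List ℕ} {a : ℤ → ℕ} {q : ℤ} (hy : At y a q) (h : f <:+: y) :
    ∃ j, q ≤ j ∧ j + f.length ≤ q + y.length ∧ At f a j := by
  obtain ⟨s, t, rfl⟩ := h
  refine ⟨q + s.length, by omega, ?_, (At_append.1 (At_append.1 hy).1).2⟩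
  simp only [List.length_append]
  push_cast
  omega

/-- If the middle word `y` has the prefix `uᵀ` and the suffix `u`, avoids the forbidden words, and
is suitably oriented, then `… wᵀ wᵀ y w w* w …` realizes its value at position `0`. -/
lemma dbl_realizes {y z z' : List ℕ} (hy : Letters123 y) (h1 : y = z ++ u)
    (h2 : y = u.reverse ++ z') (hF : ∀ f ∈ F, ¬ f <:+: y) (hle : finCF y ≤ finCF y.reverse) :
    Realizes (dbl y) (lam (dbl y) 0) := by
  have hst : Starts (dbl y) 0 := h1 ▸ dbl_starts z
  have hst' : Starts (rev (dbl y)) (y.length + 33) := h2 ▸ dbl_starts_rev z'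
  have hl := (dbl_lam_le_iff hy h1 h2).2 hle
  refine realizes_of_starts (dbl_nice hy) hst ?_ ?_ ?_
  · intro f hf j hj
    have b1 := hst.add_length_le hf hj
    have b2 := hst'.add_length_le (j := -j + 1 - f.length) (reverse_mem_basicWords hf) (by
      rw [At_rev, List.reverse_reverse, List.length_reverse]
      convert hj using 1
      ring)
    rw [List.length_reverse] at b2
    exact hF f (mem_F_iff.2 (Or.inl hf)) ((dbl_at_y y).infix hj (by omega) (by omega))
  · intro j hj
    rcases hst.self hj with b1 | ⟨n, b1⟩
    · have b2 := hst'.selfT (j := -j) (by rwa [selfT_rev, neg_neg])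
      exact absurd ((dbl_at_y y).infix hj (by omega) (by
        rw [show selfWord.length = 21 from rfl]; push_cast; omega))
        (hF _ (mem_F_iff.2 (Or.inr (Or.inl rfl))))
    · exact ⟨n, by omega⟩
  · intro j hj
    have b1 := hst.selfT hj
    rcases hst'.self (j := -j) (by rwa [self_rev, neg_neg]) with b2 | ⟨n, b2⟩
    · exact absurd ((dbl_at_y y).infix hj (by omega) (by
        rw [show selfWord.reverse.length = 21 from rfl]; push_cast; omega))
        (hF _ (mem_F_iff.2 (Or.inr (Or.inr rfl))))
    · have e : lam (dbl y) (-((y.length : ℤ) + 33)) = lam (rev (dbl y)) (y.length + 33) := by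
        rw [lam_rev]
      have e' : lam (dbl y) j = lam (rev (dbl y)) (y.length + 33 + 11 * n) := by
        rw [lam_rev, ← b2, neg_neg]
      cases n with
      | zero =>
        rw [e] at hl
        rw [e']
        simpa using hl
      | succ n =>
        have := hst'.lam_lt (dbl_nice hy).rev n
        rw [e']
        push_cast
        linarith

/-! ### Sequences with a chain on both sides -/

lemma At.letters {v : List ℕ} {a : ℤ → ℕ} {k : ℤ} (ha : BiNice a) (h : At v a k) :
    Letters123 v := by
  intro x hx
  obtain ⟨i, hi, rfl⟩ := List.getElem_of_mem hx
  rw [← h i hi]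
  exact ha _

/-- A sequence with chains on both sides is determined by the word between them. -/
lemma eq_dbl {a : ℤ → ℕ} {y : List ℕ} (h : Starts a 0) (h' : Starts (rev a) (y.length + 33))
    (hy : At y a (-((y.length : ℤ) + 16))) : a = dbl y := by
  have hlw : w.length = 11 := rfl
  have hl : (w.reverse ++ w.reverse ++ y).length = y.length + 22 := by
    simp only [List.length_append, List.length_reverse, hlw]
    ring
  have h1 : At (w.reverse ++ w.reverse) a (-((y.length : ℤ) + 38)) := by
    have := At_rev.1 h'.word
    rw [show (u ++ w ++ w).reverse = (w.reverse ++ w.reverse) ++ u.reverse by simp,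
      At_append] at this
    convert this.1 using 1
    rw [show (u ++ w ++ w).length = 33 from rfl]
    push_cast
    ring
  have h2 : At (w ++ wL) a (-16) := by
    have := (starts_zero_iff.1 h).1
    rw [List.append_assoc, At_append] at this
    exact this.2
  have h3 : At (w.reverse ++ w.reverse ++ y ++ w ++ wL) a (-((y.length : ℤ) + 38)) := by
    rw [List.append_assoc, At_append, At_append]
    refine ⟨⟨h1, ?_⟩, ?_⟩
    · convert hy using 1
      rw [show (w.reverse ++ w.reverse).length = 22 from rfl]
      push_cast
      ring
    · convert h2 using 1
      rw [hl]
      push_cast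
      ring
  have h4 := eq_toW (v := w.reverse ++ w.reverse ++ y) (a := a) (by
    rw [hl]
    convert h3 using 1
    push_cast
    ring) h.per
  refine h4.trans ?_
  rw [dbl]
  congr 1
  have h5 : rgt (rev a) (y.length + 33 - 5 + (11 : ℕ)) = per w := by
    rw [← rgt_add, h'.per]
    funext n
    exact per_w_add 1 n
  rw [← h5, rgt_rev]
  funext n
  simp only [lft]
  rw [hl]
  congr 1
  push_cast
  ring

/-- The three words between the chains that arise when `uᵀ` and `u` overlap. -/
def xWords : List (List ℕ) :=
  [[1, 2, 2, 2, 1, 1, 2, 1, 2, 1, 2, 1, 2, 1, 2, 1, 1, 2, 2, 2, 1],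
   [1, 2, 2, 2, 1, 1, 2, 1, 2, 1, 2, 1, 2, 1, 1, 2, 2, 2, 1],
   [1, 2, 2, 2, 1, 1, 2, 1, 2, 1, 2, 1, 1, 2, 2, 2, 1]]

/-- The words that may stand between a transposed chain and a chain. -/
def Mid (y : List ℕ) : Prop := y ∈ xWords ∨ ∃ θ, y = u.reverse ++ θ ++ u

lemma Mid.exists_suffix {y : List ℕ} (h : Mid y) : ∃ z, y = z ++ u := by
  rcases h with h | ⟨θ, rfl⟩
  · have key : ∀ y ∈ xWords, y = y.take (y.length - 11) ++ u := by decide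
    exact ⟨_, key y h⟩
  · exact ⟨_, rfl⟩

lemma Mid.exists_prefix {y : List ℕ} (h : Mid y) : ∃ z, y = u.reverse ++ z := by
  rcases h with h | ⟨θ, rfl⟩
  · have key : ∀ y ∈ xWords, y = u.reverse ++ y.drop 11 := by decide
    exact ⟨_, key y h⟩
  · exact ⟨_, List.append_assoc _ _ _⟩

lemma Mid.starts {y : List ℕ} (h : Mid y) : Starts (dbl y) 0 := by
  obtain ⟨z, rfl⟩ := h.exists_suffix
  exact dbl_starts z

lemma Mid.starts_rev {y : List ℕ} (h : Mid y) : Starts (rev (dbl y)) (y.length + 33) := by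
  obtain ⟨z, rfl⟩ := h.exists_prefix
  exact dbl_starts_rev z

lemma overlap_check : (List.range 33).all (fun d => Nat.ble d 4 ||
    !compat ((u ++ w ++ w).reverse.drop d) (u ++ w ++ w) || Nat.beq d 28 || Nat.beq d 30 ||
      Nat.beq d 32) = true := by decide +kernel

/-- The possible overlaps of the beginnings of the two chains. -/
lemma exists_mid {a : ℤ → ℕ} {k : ℤ} (h : Starts a 0) (h' : Starts (rev a) k) :
    ∃ y, Mid y ∧ k = y.length + 33 ∧ a = dbl y := by
  have hk : 27 ≤ k := by
    have := h.selfT (j := -k) (by simpa [self_rev] using h'.self_zero)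
    omega
  have hP : At (u ++ w ++ w).reverse a (-k - 5) := by
    have := At_rev.1 h'.word
    convert this using 1
    rw [show (u ++ w ++ w).length = 33 from rfl]
    push_cast
    ring
  have hu : At u a (-27) := (At_append.1 (At_append.1 h.word).1).1
  have hur : At u.reverse a (-k + 17) := by
    have := hP
    rw [show (u ++ w ++ w).reverse = (w.reverse ++ w.reverse) ++ u.reverse by simp,
      At_append] at this
    convert this.2 using 1
    rw [show (w.reverse ++ w.reverse).length = 22 from rfl]
    push_cast
    ring
  suffices ∃ y, Mid y ∧ k = y.length + 33 ∧ At y a (-((y.length : ℤ) + 16)) by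
    obtain ⟨y, h1, h2, h3⟩ := this
    exact ⟨y, h1, h2, eq_dbl h (h2 ▸ h') h3⟩
  rcases lt_or_ge k 55 with hlt | hge
  · obtain ⟨d, hd⟩ : ∃ d : ℕ, k = d + 22 := ⟨(k - 22).toNat, by omega⟩
    have hd' : d < 33 := by omega
    have hQ : At ((u ++ w ++ w).reverse.drop d) a (-27) := by
      have := hP
      rw [← List.take_append_drop d (u ++ w ++ w).reverse, At_append, List.length_take,
        show (u ++ w ++ w).reverse.length = 33 from rfl, min_eq_left hd'.le] at this
      convert this.2 using 1
      omega
    have hc := List.all_eq_true.1 overlap_check d (List.mem_range.2 hd')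
    rw [compat_of_SP hQ h.word] at hc
    have hd3 : d = 28 ∨ d = 30 ∨ d = 32 := by
      simp only [Bool.or_eq_true, Nat.ble_eq, Nat.beq_eq] at hc
      simp only [Bool.not_true, Bool.false_eq_true, or_false] at hc
      omega
    have hy : At (u.reverse.take (d - 22) ++ u) a (-k + 17) := by
      rw [← List.take_append_drop (d - 22) u.reverse, At_append] at hur
      refine At_append.2 ⟨hur.1, ?_⟩
      convert hu using 1
      rw [List.length_take, show u.reverse.length = 11 from rfl]
      omega
    refine ⟨u.reverse.take (d - 22) ++ u, Or.inl ?_, ?_, ?_⟩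
    · rcases hd3 with rfl | rfl | rfl <;> decide
    · rw [List.length_append, List.length_take, show u.reverse.length = 11 from rfl,
        show u.length = 11 from rfl]
      omega
    · convert hy using 1
      rw [List.length_append, List.length_take, show u.reverse.length = 11 from rfl,
        show u.length = 11 from rfl]
      omega
  · set θ : List ℕ := (List.range (k - 55).toNat).map (fun i : ℕ => a (-k + 28 + i)) with hθ
    have hl : (u.reverse ++ θ ++ u).length = (k - 55).toNat + 22 := by
      simp only [hθ, List.length_append, List.length_map, List.length_range,
        show u.reverse.length = 11 from rfl, show u.length = 11 from rfl]
      ring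
    refine ⟨u.reverse ++ θ ++ u, Or.inr ⟨θ, rfl⟩, by rw [hl]; omega, ?_⟩
    rw [hl, At_append, At_append]
    refine ⟨⟨?_, ?_⟩, ?_⟩
    · convert hur using 1
      omega
    · have : At θ a (-k + 28) := SP_range_map _ _
      convert this using 1
      rw [show u.reverse.length = 11 from rfl]
      omega
    · convert hu using 1
      rw [List.length_append, hθ, List.length_map, List.length_range,
        show u.reverse.length = 11 from rfl]
      omega

/-- The words `y` for which the value of `… wᵀ wᵀ y w w* w …` belongs to the spectrum. -/
structure Good (y : List ℕ) : Prop where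
  mid : Mid y
  letters : Letters123 y
  free : ∀ f ∈ F, ¬ f <:+: y
  le : finCF y ≤ finCF y.reverse

lemma Good.realizes {y : List ℕ} (h : Good y) : Realizes (dbl y) (lam (dbl y) 0) := by
  obtain ⟨z, hz⟩ := h.mid.exists_suffix
  obtain ⟨z', hz'⟩ := h.mid.exists_prefix
  exact dbl_realizes h.letters hz hz' h.free h.le

lemma Good.lam_mem {y : List ℕ} (h : Good y) :
    iVal < lam (dbl y) 0 ∧ lam (dbl y) 0 < jVal :=
  lam_mem_of_chain h.realizes.nice h.mid.starts.word h.mid.starts.per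

lemma Realizes.good {y : List ℕ} {t : ℝ} (hy : Mid y) (h : Realizes (dbl y) t) (hj : t < jVal)
    (ht : lam (dbl y) 0 = t) : Good y := by
  have hl : Letters123 y := (dbl_at_y y).letters h.nice
  obtain ⟨z, hz⟩ := hy.exists_suffix
  obtain ⟨z', hz'⟩ := hy.exists_prefix
  refine ⟨hy, hl, ?_, ?_⟩
  · intro f hf hfy
    obtain ⟨j, hj1, hj2, hj3⟩ := (dbl_at_y y).of_infix' hfy
    rcases mem_F_iff.1 hf with hf' | rfl | rfl
    · exact (h.nice.avoids_basicWords (fun k => (h.le k).trans_lt hj) f hf' j).1 hj3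
    · obtain ⟨n, hn⟩ := h.le_of_self hj hy.starts (j := j + 10) (by
        rw [Self, add_sub_cancel_right]; exact hj3)
      rw [show selfWord.length = 21 from rfl] at hj2
      push_cast at hj2
      omega
    · obtain ⟨n, hn⟩ := h.rev.le_of_self hj hy.starts_rev (j := -(j + 10)) (by
        rw [self_rev, neg_neg, SelfT, add_sub_cancel_right]; exact hj3)
      omega
  · rw [← dbl_lam_le_iff hl hz hz', ht]
    exact h.le _

lemma mem_setD_iff {t : ℝ} : t ∈ setD ↔
    ∃ y, Good y ∧ (∃ θ, y = u.reverse ++ θ ++ u) ∧ t = lam (dbl y) 0 := by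
  have e : ∀ θ, toW (per w) (w.reverse ++ w.reverse ++ u.reverse ++ θ ++ u) =
      dbl (u.reverse ++ θ ++ u) := fun θ => by rw [dbl]; simp only [List.append_assoc]
  constructor
  · rintro ⟨θ, h1, h2, h3, rfl⟩
    refine ⟨u.reverse ++ θ ++ u, ⟨Or.inr ⟨θ, rfl⟩, ?_, h3, (finCF_middle h1).2 h2⟩,
      ⟨θ, rfl⟩, by rw [e]⟩
    exact letters_append.2 ⟨letters_append.2 ⟨letters_reverse.2 letters_u, h1⟩, letters_u⟩
  · rintro ⟨y, hy, ⟨θ, rfl⟩, rfl⟩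
    have hθ := (letters_append.1 (letters_append.1 hy.letters).1).2
    exact ⟨θ, hθ, (finCF_middle hθ).1 hy.le, hy.free, by rw [e]⟩

lemma Good.of_no_three {y : List ℕ} (hm : Mid y) (hy : ∀ x ∈ y, x = 1 ∨ x = 2)
    (hr : y.reverse = y) : Good y := by
  refine ⟨hm, fun x hx => ?_, fun f hf hfy => ?_, by rw [hr]⟩
  · rcases hy x hx with h | h
    · exact Or.inl h
    · exact Or.inr (Or.inl h)
  · have := hy 3 (hfy.subset (three_mem_of_mem_F hf))
    omega

lemma good_of_mem_xWords {y : List ℕ} (hy : y ∈ xWords) : Good y := by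
  have key : ∀ y ∈ xWords, (∀ x ∈ y, x = 1 ∨ x = 2) ∧ y.reverse = y := by decide
  exact Good.of_no_three (Or.inl hy) (key y hy).1 (key y hy).2

lemma mem_setX_iff {t : ℝ} : t ∈ setX ↔ ∃ y ∈ xWords, t = lam (dbl y) 0 := by
  simp only [setX, xWords, Set.mem_insert_iff, Set.mem_singleton_iff, List.mem_cons,
    List.not_mem_nil, or_false, exists_eq_or_imp, exists_eq_left]
  rfl

lemma mem_setD_union_setX_iff {t : ℝ} : t ∈ setD ∪ setX ↔ ∃ y, Good y ∧ t = lam (dbl y) 0 := by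
  rw [Set.mem_union, mem_setD_iff, mem_setX_iff]
  constructor
  · rintro (⟨y, h, -, ht⟩ | ⟨y, h, ht⟩)
    · exact ⟨y, h, ht⟩
    · exact ⟨y, good_of_mem_xWords h, ht⟩
  · rintro ⟨y, h, ht⟩
    rcases h.mid with h' | h'
    · exact Or.inr ⟨y, h', ht⟩
    · exact Or.inl ⟨y, h, h', ht⟩

/-- The length of the word between the chains is determined by the value. -/
lemma Good.length_eq {y y' : List ℕ} (h : Good y) (h' : Good y')
    (e : lam (dbl y) 0 = lam (dbl y') 0) : y.length = y'.length := by
  have e1 := lft_inj_of_lam h.realizes.nice h'.realizes.nice h.mid.starts.per h'.mid.starts.per e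
  have h1 := h.mid.starts_rev
  rw [e1] at h1
  have := h1.unique h'.mid.starts_rev
  omega

lemma infinite_setD : setD.Infinite := by
  have hg : ∀ n, Good (u.reverse ++ List.replicate n 2 ++ u) := fun n => by
    refine Good.of_no_three (Or.inr ⟨_, rfl⟩) ?_ (by simp)
    intro x hx
    rw [List.mem_append, List.mem_append] at hx
    have hu : ∀ x ∈ u, x = 1 ∨ x = 2 := by decide
    rcases hx with (hx | hx) | hx
    · exact hu x (List.mem_reverse.1 hx)
    · exact Or.inr (List.eq_of_mem_replicate hx)
    · exact hu x hx
  refine Set.infinite_of_injective_forall_mem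
    (f := fun n => lam (dbl (u.reverse ++ List.replicate n 2 ++ u)) 0) (fun m n e => ?_)
    fun n => mem_setD_iff.2 ⟨_, hg n, ⟨_, rfl⟩, rfl⟩
  have := (hg m).length_eq (hg n) e
  simp only [List.length_append, List.length_replicate] at this
  omega

lemma disjoint_setD_setX : Disjoint setD setX := by
  rw [Set.disjoint_left]
  intro t hD hX
  obtain ⟨y, hy, ⟨θ, rfl⟩, rfl⟩ := mem_setD_iff.1 hD
  obtain ⟨y', hy', e⟩ := mem_setX_iff.1 hX
  have h1 := hy.length_eq (good_of_mem_xWords hy') e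
  have key : ∀ y ∈ xWords, y.length ≤ 21 := by decide
  have h2 := key y' hy'
  rw [← h1, List.length_append, List.length_append, List.length_reverse,
    show u.length = 11 from rfl] at h2
  omega

lemma ncard_setX : setX.ncard = 3 := by
  have key : ∀ y ∈ xWords, ∀ y' ∈ xWords, y.length ≠ y'.length → lam (dbl y) 0 ≠ lam (dbl y') 0 :=
    fun y hy y' hy' hne e => hne ((good_of_mem_xWords hy).length_eq (good_of_mem_xWords hy') e)
  refine Set.ncard_eq_three.2 ⟨_, _, _, ?_, ?_, ?_, rfl⟩
  · exact key _ (by simp [xWords]) _ (by simp [xWords]) (by decide)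
  · exact key _ (by simp [xWords]) _ (by simp [xWords]) (by decide)
  · exact key _ (by simp [xWords]) _ (by simp [xWords]) (by decide)

/-! ### Classification of the values in the interval -/

/-- Values of the spectrum in the interval are attained at the beginning of a chain. -/
lemma exists_realizes_starts {t : ℝ} (ht : t ∈ markovSpectrum) (hi : iVal < t) (hj : t < jVal) :
    ∃ a, Realizes a t ∧ Starts a 0 ∧ lam a 0 = t := by
  have key : ∀ a, Realizes a t → (∃ k, Starts a k ∧ lam a k = t) →
      ∃ a, Realizes a t ∧ Starts a 0 ∧ lam a 0 = t := by
    rintro a h ⟨k, hk, e⟩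
    exact ⟨shift a k, h.shift k, Starts.shift.2 (by rwa [add_zero]), by rwa [lam_shift, add_zero]⟩
  obtain ⟨a, h, -⟩ := exists_realizes ht hj
  rcases h.att_cases hi hj with h' | h'
  · exact key a h h'
  · exact key _ h.rev h'

lemma mem_union_of_mem {t : ℝ} (ht : t ∈ markovSpectrum) (hi : iVal < t) (hj : t < jVal) :
    t ∈ setC ∪ (setD ∪ setX) := by
  obtain ⟨a, h, hs, rfl⟩ := exists_realizes_starts ht hi hj
  by_cases hT : ∃ j, SelfT a j
  · obtain ⟨j, hjT⟩ := hT
    obtain ⟨k, hk⟩ := h.rev.exists_starts hi hj (k := -j) (by rwa [self_rev, neg_neg])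
    obtain ⟨y, hy, -, rfl⟩ := exists_mid hs hk
    exact Or.inr (mem_setD_union_setX_iff.2 ⟨y, h.good hy hj rfl, rfl⟩)
  · exact Or.inl (mem_setC_iff.2 ⟨a, h.inC hj hs (not_exists.1 hT), rfl⟩)

theorem diff_inter_eq :
    (markovSpectrum \ lagrangeSpectrum) ∩ intervalIJ = setC ∪ setD ∪ setX := by
  rw [Set.union_assoc]
  ext t
  rw [Set.mem_inter_iff, Set.mem_sdiff, mem_intervalIJ]
  constructor
  · rintro ⟨⟨hM, -⟩, hi, hj⟩
    exact mem_union_of_mem hM hi hj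
  · intro h
    have key : t ∈ markovSpectrum ∧ iVal < t ∧ t < jVal := by
      rcases h with h | h
      · obtain ⟨a, ha, rfl⟩ := mem_setC_iff.1 h
        exact ⟨ha.realizes.mem, lam_mem_of_chain ha.nice ha.starts.word ha.starts.per⟩
      · obtain ⟨y, hy, rfl⟩ := mem_setD_union_setX_iff.1 h
        exact ⟨hy.realizes.mem, hy.lam_mem⟩
    exact ⟨⟨key.1, not_mem_lagrangeSpectrum key.2.1 key.2.2⟩, key.2⟩

/-! ### Isolated points -/

lemma Starts.of_eventually {ι : Type*} {G : Filter ι} [G.NeBot] {x : ι → ℤ → ℕ} {a : ℤ → ℕ}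
    (h : ∀ i, ∀ᶠ n in G, x n i = a i) {k : ℤ} (hx : ∀ n, Starts (x n) k) : Starts a k := by
  constructor
  · obtain ⟨n, hn⟩ := (At_eventually_iff h (u ++ w ++ w) (k - 27)).exists
    exact hn.1 (hx n).word
  · funext i
    obtain ⟨n, hn⟩ := (h (k - 5 + i)).exists
    rw [← (hx n).per]
    exact hn.symm

/-- Values close to that of `… wᵀ wᵀ y w w* w …` come from sequences that contain a long part of it;
since both chains replicate themselves, these sequences are equal to it. -/
theorem Good.isolated {y : List ℕ} (h : Good y) :
    IsIsolatedPoint markovSpectrum (lam (dbl y) 0) := by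
  refine ⟨h.realizes.mem, ?_⟩
  obtain ⟨hi, hj⟩ := h.lam_mem
  set t := lam (dbl y) 0 with ht
  by_contra! hcon
  have hex : ∀ n : ℕ, ∃ b : ℤ → ℕ, ∃ s : ℝ, Realizes b s ∧ Starts b 0 ∧ lam b 0 = s ∧ s < jVal ∧
      |s - t| < 1 / ((n : ℝ) + 1) ∧ s ≠ t := by
    intro n
    obtain ⟨s, hs, hlt, hne⟩ := hcon (min (1 / ((n : ℝ) + 1)) (min (t - iVal) (jVal - t)))
      (lt_min (by positivity) (lt_min (by linarith) (by linarith)))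
    rw [lt_min_iff, lt_min_iff] at hlt
    have hsi : iVal < s := by linarith [(abs_lt.1 hlt.2.1).1]
    have hsj : s < jVal := by linarith [(abs_lt.1 hlt.2.2).2]
    obtain ⟨b, h1, h2, h3⟩ := exists_realizes_starts hs hsi hsj
    exact ⟨b, s, h1, h2, h3, hsj, hlt.1, hne⟩
  choose b s hb hst hs hsj hlt hne using hex
  obtain ⟨a, ha, φ, hφ, hlim⟩ := exists_subseq_limit (x := b) fun k =>
    Eventually.of_forall fun n => (hb n).nice k
  have hs0 : Starts a 0 := Starts.of_eventually hlim fun n => hst (φ n)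
  have hconv : Tendsto s atTop (𝓝 t) := by
    rw [tendsto_iff_dist_tendsto_zero]
    refine squeeze_zero (fun _ => dist_nonneg) (fun n => ?_) tendsto_one_div_add_atTop_nhds_zero_nat
    rw [Real.dist_eq]
    exact (hlt n).le
  have hat : lam a 0 = t := by
    have h1 := tendsto_lam (fun n => (hb (φ n)).nice.pos) ha.pos hlim 0
    have h2 : Tendsto (fun n => lam (b (φ n)) 0) atTop (𝓝 t) := by
      simp only [hs]
      exact hconv.comp hφ.tendsto_atTop
    exact tendsto_nhds_unique h1 h2
  have hay : a = dbl y := lft_inj_of_lam ha h.realizes.nice hs0.per h.mid.starts.per hat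
  subst hay
  have hr := h.mid.starts_rev
  have e1 := At_eventually_iff (x := fun n => rev (b (φ n))) (a := rev (dbl y))
    (fun i => hlim (-i)) (u ++ w ++ w) (y.length + 33 - 27)
  have e2 := At_eventually_iff (x := fun n => rev (b (φ n))) (a := rev (dbl y))
    (fun i => hlim (-i)) selfWord (y.length + 33 - 10)
  have e3 := At_eventually_iff hlim y (-((y.length : ℤ) + 16))
  obtain ⟨n, h1, h2, h3⟩ := (e1.and (e2.and e3)).exists
  have hself : Self (rev (b (φ n))) (y.length + 33) := h2.2 hr.self_zero
  have hstr : Starts (rev (b (φ n))) (y.length + 33) := ⟨h1.2 hr.word, rgt_eq_per_of_self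
    (self_chain (hb _).rev.nice (fun k => ((hb _).rev.le k).trans_lt (hsj _)) hself)⟩
  have hfin := eq_dbl (hst (φ n)) hstr (h3.2 (dbl_at_y y))
  exact hne (φ n) (by rw [← hs, hfin])

/-! ### Compactness and total disconnectedness of `C` -/

lemma InC.lam_eq {a : ℤ → ℕ} (h : InC a) :
    lam a 0 = 3 + infCF (pre wR.tail (per w)) + infCF (lft a 0) := by
  have h3 : rgt a (0 + 1) = pre wR.tail (per w) := by
    rw [← tl_rgt, rgt_zero h.starts.per]
    exact tl_pre_cons 3 wR.tail _
  rw [MarkovLagrange.lam_eq, (self_iff.1 h.starts.self_zero).2.1, h3]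
  norm_num

lemma nonempty_setC : setC.Nonempty := by
  set a : ℤ → ℕ := toW (fun _ => 2) u with ha
  have hst : Starts a 0 := starts_toW _ []
  have hnice : BiNice a := glue_nice (Nice.pre (letters_of_all rfl) fun _ => Or.inr (Or.inl rfl))
    (Nice.pre (letters_of_all rfl) nice_per_w)
  -- there is no letter `3` to the left of the first `w`
  have h3 : ∀ i : ℤ, i < -16 → a i ≠ 3 := by
    intro i hi
    obtain ⟨n, rfl⟩ : ∃ n : ℕ, i = 0 - 1 - ((16 + n : ℕ) : ℤ) := ⟨(-17 - i).toNat, by omega⟩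
    show lft a 0 (16 + n) ≠ 3
    rw [ha, toW_lft, show (u ++ w ++ wL).reverse = (w ++ wL).reverse ++ u.reverse by simp,
      pre_append, show 16 + n = (w ++ wL).reverse.length + n from rfl, pre_add]
    by_cases hn : n < u.reverse.length
    · rw [pre_lt hn]
      have key : ∀ x ∈ u.reverse, x ≠ 3 := by decide
      exact key _ (List.getElem_mem hn)
    · obtain ⟨m, rfl⟩ := Nat.exists_eq_add_of_le (not_lt.1 hn)
      rw [pre_add]
      decide
  have hfree : ∀ f ∈ F, ∀ j, At f a j → ¬ j + f.length ≤ -16 := by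
    intro f hf j hj hle
    obtain ⟨i, hi, e⟩ := List.getElem_of_mem (three_mem_of_mem_F hf)
    exact h3 (j + i) (by omega) ((hj i hi).trans e)
  refine ⟨_, mem_setC_iff.2 ⟨a, ⟨hnice, hst, fun f hf j hj => ?_⟩, rfl⟩⟩
  have hnot := hfree f hf j hj
  rcases mem_F_iff.1 hf with hf' | rfl | rfl
  · have := hst.add_length_le hf' hj
    omega
  · have hl : selfWord.length = 21 := rfl
    rw [hl] at hnot ⊢
    push_cast at hnot ⊢
    rcases hst.self (j := j + 10) (by rw [Self, add_sub_cancel_right]; exact hj) with h | ⟨n, h⟩ <;>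
    omega
  · have hl : selfWord.reverse.length = 21 := rfl
    rw [hl] at hnot
    push_cast at hnot
    have := hst.selfT (j := j + 10) (by rw [SelfT, add_sub_cancel_right]; exact hj)
    omega

lemma isCompact_setC : IsCompact setC := by
  refine IsSeqCompact.isCompact fun x hx => ?_
  choose b hb hxb using fun n => mem_setC_iff.1 (hx n)
  obtain ⟨a, ha, φ, hφ, hlim⟩ := exists_subseq_limit (x := b) fun k =>
    Eventually.of_forall fun n => (hb n).nice k
  refine ⟨lam a 0, mem_setC_iff.2 ⟨a, ⟨ha, Starts.of_eventually hlim fun n => (hb (φ n)).starts,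
    fun f hf j hj => ?_⟩, rfl⟩, φ, hφ, ?_⟩
  · obtain ⟨n, hn⟩ := (At_eventually_iff hlim f j).exists
    exact (hb (φ n)).free f hf j (hn.2 hj)
  · have := tendsto_lam (fun n => (hb (φ n)).nice.pos) ha.pos hlim 0
    refine this.congr fun n => ?_
    rw [Function.comp_apply, hxb]

lemma isTotallyDisconnected_setC : IsTotallyDisconnected setC := by
  -- the values in `C` differ from a constant by irrational numbers
  have key : ∀ x ∈ setC, ∀ y ∈ setC, x < y → ∃ z, x < z ∧ z < y ∧ z ∉ setC := by
    intro x _ y _ hxy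
    set c : ℝ := 3 + infCF (pre wR.tail (per w)) with hc
    obtain ⟨q, h1, h2⟩ := exists_rat_btwn (show x - c < y - c by linarith)
    refine ⟨c + q, by linarith, by linarith, fun hz => ?_⟩
    obtain ⟨a, ha, e⟩ := mem_setC_iff.1 hz
    rw [ha.lam_eq, ← hc, add_right_inj] at e
    exact infCF_irrational (ha.nice.lft 0).pos ⟨q, e⟩
  intro t ht hp x hx y hy
  by_contra hne
  rcases lt_or_gt_of_ne hne with h | h
  · obtain ⟨z, h1, h2, h3⟩ := key x (ht hx) y (ht hy) h
    exact h3 (ht (hp.Icc_subset hx hy ⟨h1.le, h2.le⟩))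
  · obtain ⟨z, h1, h2, h3⟩ := key y (ht hy) x (ht hx) h
    exact h3 (ht (hp.Icc_subset hy hx ⟨h1.le, h2.le⟩))

/-! ### Perfectness of `C` -/

/-- Replace the right end of a sequence, from position `K` on, by `s`. -/
def cut (b : ℤ → ℕ) (K : ℤ) (s : ℕ → ℕ) : ℤ → ℕ := fun i => if i < K then b i else s (i - K).toNat

lemma cut_of_lt {b : ℤ → ℕ} {K : ℤ} {s : ℕ → ℕ} {i : ℤ} (h : i < K) : cut b K s i = b i := if_pos h

lemma cut_add (b : ℤ → ℕ) (K : ℤ) (s : ℕ → ℕ) (n : ℕ) : cut b K s (K + n) = s n := by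
  rw [cut, if_neg (by omega)]
  congr 1
  omega

lemma rgt_cut (b : ℤ → ℕ) (K : ℤ) (s : ℕ → ℕ) (m : ℕ) :
    rgt (cut b K s) (K + m) = fun n => s (m + n) := by
  funext n
  rw [rgt, add_assoc, ← Nat.cast_add, cut_add]

lemma lft_cut (b : ℤ → ℕ) (K : ℤ) (s : ℕ → ℕ) : lft (cut b K s) K = lft b K := by
  funext n
  exact cut_of_lt (by omega)

lemma At_of_cut {b : ℤ → ℕ} {K : ℤ} {s : ℕ → ℕ} {f : List ℕ} {j : ℤ} (h : At f (cut b K s) j)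
    (hj : j + f.length ≤ K) : At f b j := by
  intro i hi
  rw [← h i hi]
  exact (cut_of_lt (by omega)).symm

lemma InC.rev_cut {a : ℤ → ℕ} (ha : InC a) {K : ℤ} (hK : 28 ≤ K) {s : ℕ → ℕ} (hs : Nice s)
    (h : ∀ f ∈ F, ∀ j, K < j + f.length → ¬ At f (cut (rev a) K s) j) :
    InC (rev (cut (rev a) K s)) := by
  have hag : ∀ i : ℤ, -27 ≤ i → rev (cut (rev a) K s) i = a i := by
    intro i hi
    rw [rev, cut_of_lt (by omega), rev, neg_neg]
  refine ⟨fun k => ?_, ⟨fun i hi => ?_, ?_⟩, fun f hf j hj => ?_⟩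
  · rw [rev, cut]
    split_ifs
    · exact ha.nice.rev _
    · exact hs _
  · rw [rgt, hag _ (by omega)]
    exact ha.starts.word i hi
  · rw [← ha.starts.per]
    funext n
    exact hag _ (by omega)
  · have h1 := At_rev.1 hj
    by_contra hcon
    refine h _ (F_reverse hf) _ ?_ h1
    rw [List.length_reverse]
    by_contra hle
    have h2 := At_of_cut h1 (by rw [List.length_reverse]; omega)
    rw [At_rev, List.reverse_reverse, List.length_reverse] at h2
    exact hcon (ha.free f hf j (by convert h2 using 1; ring))

/-- The longest forbidden words have 45 letters. -/
lemma length_le_of_mem_F {f : List ℕ} (hf : f ∈ F) : f.length ≤ 45 := by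
  have h : basicWords.all (fun f => Nat.ble f.length 45) = true := by decide +kernel
  rcases mem_F_iff.1 hf with hf | rfl | rfl
  · exact Nat.le_of_ble_eq_true (List.all_eq_true.1 h f hf)
  · decide
  · decide

/-- Words that do not occur, since all their continuations by two letters contain a word of `F`. -/
def deadWords : List (List ℕ) :=
  [[2, 1, 2, 3, 2, 1, 1, 1, 1, 1, 2, 2, 3, 2, 2, 2, 2, 2, 2, 3],
   [1, 2, 1, 1, 2, 1, 1, 1, 1, 2, 2, 2, 2, 3, 2, 2, 1, 1, 1, 1, 2, 2, 2, 3]]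

lemma deadWords_check : deadWords.all (fun D => [1, 2, 3].all fun x => [1, 2, 3].all fun y =>
    (D ++ [x, y]).tails.any fun v => (trie basicWords).hit v) = true := by decide +kernel

lemma Avoids.dead {a : ℤ → ℕ} (ha : BiNice a) (h : Avoids basicWords a) :
    Avoids (basicWords ++ deadWords) a := by
  have key : ∀ a : ℤ → ℕ, BiNice a → MarkovLagrange.Avoids basicWords a →
      ∀ D ∈ deadWords, ∀ j, ¬ At D a j := by
    intro a ha h D hD j hj
    have hx : ∀ i, a i ∈ [1, 2, 3] := fun i => by simpa using ha i
    obtain ⟨v, hv, hit⟩ := List.any_eq_true.1 (List.all_eq_true.1 (List.all_eq_true.1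
      (List.all_eq_true.1 deadWords_check D hD) _ (hx (j + D.length))) _ (hx (j + D.length + 1)))
    obtain ⟨f, hf, hp⟩ := trie_hit hit
    have hA : At (D ++ [a (j + D.length), a (j + D.length + 1)]) a j :=
      At_append.2 ⟨hj, At_cons.2 ⟨rfl, At_cons.2 ⟨rfl, At_nil _ _⟩⟩⟩
    obtain ⟨i, hi⟩ := hA.of_infix (hp.isInfix.trans ((List.mem_tails _ _).1 hv).isInfix)
    exact (h f hf i).1 hi
  intro f hf j
  rcases List.mem_append.1 hf with hf | hf
  · exact h f hf j
  · refine ⟨key a ha h f hf j, fun hj => ?_⟩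
    refine key (MarkovLagrange.rev a) ha.rev (Avoids.rev h) f hf (-j + 1 - f.length) (At_rev.2 ?_)
    convert hj using 1
    ring

/-- The right end `t 2 2 2 …` contains no forbidden word, also if it follows a letter `3`, unless
the letters before it, read backwards, begin with one of the words `obs`. A beginning of `60`
letters is longer than all forbidden words, and an occurrence from the index `5` on would lack the
letter `3`. -/
def validEnd (obs : List (List ℕ)) (t : List ℕ) : Bool :=
  Nat.ble t.length 5 && (basicWords ++ [selfWord, selfWord.reverse]).all fun f =>
    ((List.range 5).all fun i => !compat f ((t ++ List.replicate 60 2).drop i)) &&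
    (List.range f.length).all fun i => !compat (f.drop i) (t ++ List.replicate 60 2) ||
      (!compat (f.take i).reverse [3] || obs.any fun c => pfx c (f.take i).reverse)

lemma SP.drop {l : List ℕ} {s : ℕ → ℕ} (h : SP l s) (i : ℕ) :
    SP (l.drop i) (fun n => s (i + n)) := by
  intro m hm
  rw [List.getElem_drop]
  rw [List.length_drop] at hm
  exact h (i + m) (by omega)

lemma not_At_cut {obs : List (List ℕ)} {t : List ℕ} (hv : validEnd obs t = true) {b : ℤ → ℕ} {K : ℤ}
    (h3 : b (K - 1) = 3) (hobs : ∀ c ∈ obs, ¬ SP c (lft b K)) {f : List ℕ} (hf : f ∈ F) {j : ℤ}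
    (hlt : K < j + f.length) : ¬ At f (cut b K (pre t fun _ => 2)) j := by
  intro hj
  rw [validEnd, Bool.and_eq_true] at hv
  have hf' : f ∈ basicWords ++ [selfWord, selfWord.reverse] := by
    rw [List.mem_append, List.mem_pair]
    exact mem_F_iff.1 hf
  have hc := List.all_eq_true.1 hv.2 f hf'
  rw [Bool.and_eq_true, List.all_eq_true, List.all_eq_true] at hc
  have hS : SP (t ++ List.replicate 60 2) (pre t fun _ => 2) :=
    SP_pre_append.2 fun i hi => by rw [List.getElem_replicate]
  rcases le_or_gt K j with hle | hgt
  · obtain ⟨i, rfl⟩ : ∃ i : ℕ, j = K + i := ⟨(j - K).toNat, by omega⟩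
    rw [At, rgt_cut] at hj
    by_cases hi : i < 5
    · have := hc.1 i (List.mem_range.2 hi)
      rw [compat_of_SP hj (hS.drop i)] at this
      exact absurd this (by decide)
    · obtain ⟨m, hm, e⟩ := List.getElem_of_mem (three_mem_of_mem_F hf)
      have h2 := (hj m hm).trans e
      have := Nat.le_of_ble_eq_true hv.1
      obtain ⟨n, hn⟩ := Nat.exists_eq_add_of_le (show t.length ≤ i + m by omega)
      simp only [hn, pre_add] at h2
      omega
  · obtain ⟨i, rfl⟩ : ∃ i : ℕ, j = K - i := ⟨(K - j).toNat, by omega⟩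
    have hi : i < f.length := by omega
    rw [← List.take_append_drop i f, At_append, List.length_take, min_eq_left hi.le,
      sub_add_cancel] at hj
    have h1 : SP (f.drop i) (pre t fun _ => 2) := by
      have h0 := rgt_cut b K (pre t fun _ => 2) 0
      simp only [Nat.cast_zero, add_zero, zero_add] at h0
      have h1 := hj.2
      rwa [At, h0] at h1
    have h2 : SP (f.take i).reverse (lft b K) := by
      rw [← lft_cut b K (pre t fun _ => 2), SP_reverse_lft, List.length_take, min_eq_left hi.le]
      exact hj.1
    have h4 : SP [3] (lft b K) := SP_cons.2 ⟨by simpa [lft] using h3, SP_nil _⟩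
    have := hc.2 i (List.mem_range.2 hi)
    rw [compat_of_SP h1 hS, compat_of_SP h2 h4, Bool.not_true, Bool.false_or, Bool.false_or] at this
    obtain ⟨c, hc1, hc2⟩ := List.any_eq_true.1 this
    exact hobs c hc1 (h2.of_prefix (pfx_iff hc2))

/-- Pairs `t`, `t'` of beginnings of different right ends `t 2 2 2 …` and `t' 2 2 2 …`, with their
common obstructions. -/
def endings : List (List ℕ × List ℕ × List (List ℕ)) :=
  [([3, 3, 3], [3, 3],
     [[3, 2, 1, 1, 1, 1, 1, 2, 2, 3, 2, 2, 2, 2, 2, 2],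
      [3, 2, 2, 2, 2, 2, 2, 3, 2, 2, 1, 1, 1, 1, 1, 2],
      [3, 2, 1, 1, 1, 1, 2, 2, 2, 2, 3, 2, 2, 1, 1, 1, 1, 2, 2, 2, 1, 1, 2, 1],
      [3, 2, 2, 2, 1, 1, 1, 1, 2, 2, 3, 2, 2, 2, 2, 1, 1, 1, 1, 2, 1, 1, 2, 1],
      [3, 2, 1, 1, 2, 2, 2, 1, 1, 1, 1, 2, 2, 3, 2, 2, 2, 2, 1, 1, 1, 1, 2, 3, 2],
      [3, 3, 2, 1, 1, 1, 1, 2, 2, 2, 2, 3, 2, 2, 1, 1, 1, 1, 2, 2, 2, 1, 1, 2, 1]]),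
   ([2, 3, 3, 3], [2, 3, 3],
     [[3, 2, 3],
      [3, 2, 2],
      [3, 2, 1, 1, 1, 1, 2, 2, 2, 2, 3, 2, 2, 1, 1, 1, 1, 2, 2, 2, 1, 1, 2]]),
   ([3, 2, 3, 3], [3, 2, 3, 3, 3],
     [[3, 2, 1, 1, 1, 1, 1, 2, 2, 3, 2, 2, 2, 2, 2, 2],
      [3, 2, 2, 2, 2, 2, 2, 3, 2, 2, 1, 1, 1, 1, 1, 2],
      [3, 2, 2, 2, 1, 1, 1, 1, 2, 2, 3, 2, 2, 2, 2, 1, 1, 1, 1, 2, 1, 1, 2, 1],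
      [3, 2, 1, 1, 2, 2, 2, 1, 1, 1, 1, 2, 2, 3, 2, 2, 2, 2, 1, 1, 1, 1, 2, 3, 2],
      [3, 3, 2, 1, 1, 1, 1, 2, 2, 2, 2, 3, 2, 2, 1, 1, 1, 1, 2, 2, 2, 1, 1, 2, 1]]),
   ([], [2, 2, 3, 3],
     [[3, 2, 3],
      [3, 2, 2, 1, 2],
      [3, 2, 2, 1, 1, 1, 2],
      [3, 2, 2, 1, 1, 1, 1, 1, 2],
      [3, 2, 2, 2, 2, 2, 2, 3, 2, 2, 1, 1, 1, 1, 1, 2, 3, 2, 1, 2],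
      [3, 2, 1, 1, 1, 1, 2, 2, 2, 2, 3, 2, 2, 1, 1, 1, 1, 2, 2, 2, 1, 1, 2],
      [3, 2, 2, 2, 1, 1, 1, 1, 2, 2, 3, 2, 2, 2, 2, 1, 1, 1, 1, 2, 1, 1, 2],
      [3, 3, 2, 1, 1, 1, 1, 2, 2, 2, 2, 3, 2, 2, 1, 1, 1, 1, 2, 2, 2, 1, 1, 2, 1]])]

lemma endings_valid : endings.all (fun p => (validEnd p.2.2 p.1 && validEnd p.2.2 p.2.1) &&
    !compat (p.1 ++ List.replicate 6 2) (p.2.1 ++ List.replicate 6 2)) = true := by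
  decide +kernel

lemma endings_search : srch (trie (basicWords ++ deadWords))
    (fun A _ => endings.any fun p => p.2.2.all fun c => !compat c (3 :: A.reverse))
    (fun _ => true) 26 [] [] = true := by
  decide +kernel

/-- Behind each letter `3` one of the pairs of right ends is admissible. -/
lemma exists_ending {b : ℤ → ℕ} (hb : BiNice b) (h : Avoids basicWords b) {K : ℤ}
    (h3 : b (K - 1) = 3) : ∃ p ∈ endings, ∀ c ∈ p.2.2, ¬ SP c (lft b K) := by
  refine srch_sound hb h3 (Avoids.dead hb h) ?_ _ _ _ endings_search (SP_nil _) (SP_nil _)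
  intro A B hA hS _
  obtain ⟨p, hp, hc⟩ := List.any_eq_true.1 hA
  refine ⟨p, hp, fun c hcm hSP => ?_⟩
  have h1 := List.all_eq_true.1 hc c hcm
  have h2 : SP (3 :: A.reverse) (lft b K) := by
    refine SP_cons.2 ⟨by simpa [lft] using h3, ?_⟩
    convert hS using 1
    funext n
    simp only [tl, lft]
    congr 1
    push_cast
    ring
  rw [compat_of_SP hSP h2] at h1
  exact absurd h1 (by decide)

lemma SP.ne {l l' : List ℕ} {s s' : ℕ → ℕ} (h : SP l s) (h' : SP l' s') (hc : compat l l' ≠ true) :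
    s ≠ s' := fun e => hc (compat_of_SP h (e ▸ h'))

lemma nice_pre_two {t : List ℕ} (h : Letters123 t) : Nice (pre t fun _ => 2) :=
  Nice.pre h fun _ => Or.inr (Or.inl rfl)

/-- The far left of a sequence in the definition of `C` may be replaced by two different left
ends. -/
lemma InC.exists_ends {a : ℤ → ℕ} (ha : InC a) (N : ℕ) : ∃ K : ℤ, N < K ∧ ∃ s s' : ℕ → ℕ, s ≠ s' ∧
    InC (rev (cut (rev a) K s)) ∧ InC (rev (cut (rev a) K s')) := by
  have havoid : Avoids basicWords a := ha.realizes.nice.avoids_basicWords fun k =>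
    (ha.realizes.le k).trans_lt (lam_mem_of_chain ha.nice ha.starts.word ha.starts.per).2
  by_cases h : ∃ K : ℤ, N + 28 < K ∧ rev a (K - 1) = 3
  · obtain ⟨K, hK, h3⟩ := h
    obtain ⟨p, hp, hobs⟩ := exists_ending ha.nice.rev (Avoids.rev havoid) h3
    have hv := List.all_eq_true.1 endings_valid p hp
    rw [Bool.and_eq_true, Bool.and_eq_true, Bool.not_eq_true'] at hv
    have hl : ∀ p ∈ endings, (∀ x ∈ p.1, x = 2 ∨ x = 3) ∧ ∀ x ∈ p.2.1, x = 2 ∨ x = 3 := by decide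
    have hS : ∀ t, SP (t ++ List.replicate 6 2) (pre t fun _ => 2) := fun t =>
      SP_pre_append.2 fun i hi => by rw [List.getElem_replicate]
    refine ⟨K, by omega, _, _, (hS p.1).ne (hS p.2.1) (ne_true_of_eq_false hv.2), ?_, ?_⟩
    · exact ha.rev_cut (by omega) (nice_pre_two fun x hx => Or.inr ((hl p hp).1 x hx))
        fun f hf j hj => not_At_cut hv.1.1 h3 hobs hf hj
    · exact ha.rev_cut (by omega) (nice_pre_two fun x hx => Or.inr ((hl p hp).2 x hx))
        fun f hf j hj => not_At_cut hv.1.2 h3 hobs hf hj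
  · push Not at h
    -- without a letter `3` far to the left, any left end in `{1, 2}` is possible
    have key : ∀ d : ℕ, d = 1 ∨ d = 2 → InC (rev (cut (rev a) (N + 100) fun _ => d)) := by
      intro d hd
      refine ha.rev_cut (by omega) (fun _ => by omega) fun f hf j hj hcon => ?_
      obtain ⟨m, hm, e⟩ := List.getElem_of_mem (three_mem_of_mem_F hf)
      have h1 := (hcon m hm).trans e
      have h2 := length_le_of_mem_F hf
      rw [rgt] at h1
      rcases lt_or_ge (j + m) (N + 100) with hlt | hge
      · rw [cut_of_lt hlt] at h1
        refine h (j + m + 1) (by omega) ?_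
        rwa [add_sub_cancel_right]
      · rw [cut, if_neg (by omega)] at h1
        omega
    refine ⟨N + 100, by omega, fun _ => 1, fun _ => 2, fun e => ?_, key 1 (Or.inl rfl),
      key 2 (Or.inr rfl)⟩
    exact absurd (congrFun e 0) (by decide)

lemma InC.exists_ne {a : ℤ → ℕ} (ha : InC a) (N : ℕ) :
    ∃ b, InC b ∧ b ≠ a ∧ ∀ i : ℤ, -N ≤ i → b i = a i := by
  obtain ⟨K, hK, s, s', hne, h1, h2⟩ := ha.exists_ends N
  have hag : ∀ s, ∀ i : ℤ, -N ≤ i → rev (cut (rev a) K s) i = a i := by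
    intro s i hi
    rw [rev, cut_of_lt (by omega), rev, neg_neg]
  by_cases h : rev (cut (rev a) K s) = a
  · refine ⟨_, h2, fun h' => hne ?_, hag s'⟩
    have h3 : cut (rev a) K s = cut (rev a) K s' := by
      rw [← rev_rev (cut (rev a) K s), ← rev_rev (cut (rev a) K s'), h, h']
    funext n
    rw [← cut_add (rev a) K s, h3, cut_add]
  · exact ⟨_, h1, h, hag s⟩

lemma perfect_setC : Perfect setC := by
  refine ⟨isCompact_setC.isClosed, fun t ht => ?_⟩
  obtain ⟨a, ha, rfl⟩ := mem_setC_iff.1 ht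
  choose b hb hne hag using ha.exists_ne
  rw [accPt_iff_nhds]
  intro U hU
  have hlim : Tendsto (fun n => lam (b n) 0) atTop (𝓝 (lam a 0)) := by
    refine tendsto_lam (fun n => (hb n).nice.pos) ha.nice.pos (fun i => ?_) 0
    filter_upwards [eventually_ge_atTop i.natAbs] with n hn
    exact hag n i (by omega)
  obtain ⟨n, hn⟩ := (hlim.eventually_mem hU).exists
  exact ⟨_, ⟨hn, mem_setC_iff.2 ⟨_, hb n, rfl⟩⟩, fun e => hne n
    (lft_inj_of_lam (hb n).nice ha.nice (hb n).starts.per ha.starts.per e)⟩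

theorem isCantorSet_setC : IsCantorSet setC :=
  ⟨nonempty_setC, isCompact_setC, perfect_setC, isTotallyDisconnected_setC⟩

end MarkovLagrange

theorem mainTheorem2 :
    (MarkovLagrange.markovSpectrum \ MarkovLagrange.lagrangeSpectrum) ∩ MarkovLagrange.intervalIJ =
        MarkovLagrange.setC ∪ MarkovLagrange.setD ∪ MarkovLagrange.setX ∧
      MarkovLagrange.IsCantorSet MarkovLagrange.setC ∧
      MarkovLagrange.setD.Infinite ∧
      (∀ t ∈ MarkovLagrange.setD,
        MarkovLagrange.IsIsolatedPoint MarkovLagrange.markovSpectrum t) ∧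
      MarkovLagrange.setX.ncard = 3 ∧
      Disjoint MarkovLagrange.setD MarkovLagrange.setX ∧
      ∀ t ∈ MarkovLagrange.setX,
        MarkovLagrange.IsIsolatedPoint MarkovLagrange.markovSpectrum t := by
  have key : ∀ t ∈ MarkovLagrange.setD ∪ MarkovLagrange.setX,
      MarkovLagrange.IsIsolatedPoint MarkovLagrange.markovSpectrum t := fun t ht => by
    obtain ⟨y, hy, rfl⟩ := MarkovLagrange.mem_setD_union_setX_iff.1 ht
    exact hy.isolated
  exact ⟨MarkovLagrange.diff_inter_eq, MarkovLagrange.isCantorSet_setC,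
    MarkovLagrange.infinite_setD, fun t ht => key t (Or.inl ht), MarkovLagrange.ncard_setX,
    MarkovLagrange.disjoint_setD_setX, fun t ht => key t (Or.inr ht)⟩
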